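/- **Setting.** Fix $L\ge 0$, finitely many labels $\alpha_s\in\{1,\dots,m_s\}$ for each stage $s\in\{-1,0,\dots,L\}$, and Grassmann parities $\varepsilon_{\alpha_s}\in\mathbb Z/2$. The variables are the original fields $\varphi^i=\Phi^{\alpha_{-1}}$ (parity $\varepsilon_i$), the ghosts $c^{\alpha_s}=\Phi^{\alpha_s}$, $0\le s\le L$ (parity $\varepsilon_{\alpha_s}+s+1$), and the antifields $\Phi^*_{\alpha_s}$, $-1\le s\le L$ (parity $\varepsilon_{\alpha_s}+s$); write $\varphi^*_i=\Phi^*_{\alpha_{-1}}$. The antifield number is ${\rm afn}(\Phi^*_{\alpha_s})=s+2$ and ${\rm afn}(\varphi^i)={\rm afn}(c^{\alpha_s})=0$. A function on an open set $U$ of the real coordinate space of the even original fields (a "$\varphi$-neighborhood" of its points) is a formal power series in the ghosts and antifields whose coefficients are smooth functions on $U$ with values in the real Grassmann algebra of the odd original fields; functions of $\varphi$ alone contain no ghosts or antifields. **Data.** Let $S_0=S_0(\varphi)$ be an even smooth function on $U$ with equations of motion $T_i=S_0\overleftarrow{\partial}/\partial\varphi^i$. Let $Z^{\alpha_{s-1}}{}_{\alpha_s}(\varphi)$,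 $0\le s\le L$ (with $R^i{}_{\alpha_0}=Z^{\alpha_{-1}}{}_{\alpha_0}$), be smooth functions on $U$ of parity $\varepsilon_{\alpha_{s-1}}+\varepsilon_{\alpha_s}$. Put $M_s=\sum_{r\ge 0}(-1)^r m_{r+s}$, where $m_s=0$ for $s>L$, and assume the rank conditions $$\operatorname{rank}\Big(\tfrac{\overrightarrow\partial}{\partial\varphi^i}S_0\tfrac{\overleftarrow\partial}{\partial\varphi^j}\Big)=M_{-1},\qquad \operatorname{rank}\big(Z^{\alpha_{s-1}}{}_{\alpha_s}\big)=M_s\quad(0\le s\le L)$$ at all points of $U$, where the rank of a supermatrix is the rank of its body (the real matrix obtained by setting the odd fields to zero). Let $$V_i=T_i,\qquad V_{\alpha_s}=\Phi^*_{\alpha_{s-1}}Z^{\alpha_{s-1}}{}_{\alpha_s}+M_{\alpha_s}\quad(0\le s\le L),$$ where the $M_{\alpha_s}$ are smooth functions of $(\varphi,\Phi^*)$ on $U$, independent of the ghosts, at least quadratic in the antifields, of parity $\varepsilon(\Phi^*_{\alpha_s})+1$ and of antifield number ${\rm afn}(\Phi^*_{\alpha_s})-1=s+1$ (so that $M_{\alpha_0}=0$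 and $V_{\alpha_0}=\varphi^*_iR^i{}_{\alpha_0}$). The Koszul–Tate operator is ${\bf s}_{-1}=V_\alpha\,\overrightarrow\partial/\partial\Phi^*_\alpha$, acting on functions of all variables. **Theorem (local acyclicity of the Koszul–Tate operator).** Let $p\in U$ be a stationary point, i.e. all $T_i$ vanish at $p$ (with the odd fields set to zero), and assume that $({\bf s}_{-1})^2=0$ on $U$. Then there is an open neighborhood $U'\subseteq U$ of $p$ on which ${\bf s}_{-1}$ is acyclic: for every function $f=f(\varphi,c,\Phi^*)$ on $U'$ all of whose terms have positive antifield number, ${\bf s}_{-1}f=0$ implies that there is a function $g$ on $U'$ with $f={\bf s}_{-1}g$. -/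

import Mathlib

open scoped ContDiff

noncomputable section

/-- The content of a gauge theory with reducibility stage `L`: for every stage
`s ∈ {-1, …, L}` the number `m_s` of labels `α_s` and their Grassmann parities `ε_{α_s}`.
The stage `s` is stored at position `s + 1 : Fin (L + 2)`, so position `0` holds the original
fields `φ^i`. -/
structure FieldContent where
  L : ℕ
  m : Fin (L + 2) → ℕ
  ε : (k : Fin (L + 2)) → Fin (m k) → ZMod 2

namespace FieldContent

variable (C : FieldContent)

/-- Labels of the ghosts `c^{α_s}`, `s ∈ {0, …, L}`. -/
abbrev Ghost : Type := Σ s : Fin (C.L + 1), Fin (C.m s.succ)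

/-- Labels of the antifields `Φ*_{α_s}`, `s ∈ {-1, …, L}` (position `k = s + 1`). -/
abbrev Anti : Type := Σ k : Fin (C.L + 2), Fin (C.m k)

/-- Labels of the auxiliary variables: ghosts and antifields. -/
abbrev Aux : Type := C.Ghost ⊕ C.Anti

/-- Grassmann parity of the auxiliary variables: `ε(c^{α_s}) = ε_{α_s} + s + 1` and
`ε(Φ*_{α_s}) = ε(Φ^{α_s}) + 1`. -/
def auxParity : C.Aux → ZMod 2
  | Sum.inl g => C.ε g.1.succ g.2 + ((g.1 : ℕ) : ZMod 2) + 1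
  | Sum.inr a => C.ε a.1 a.2 + ((a.1 : ℕ) : ZMod 2) + 1

/-- Antifield number of the antifields: `afn(Φ*_{α_s}) = s + 2`. -/
def antiAfn (a : C.Anti) : ℕ := (a.1 : ℕ) + 1

abbrev EvenField : Type := {i : Fin (C.m 0) // C.ε 0 i = 0}
abbrev OddField : Type := {i : Fin (C.m 0) // C.ε 0 i ≠ 0}
abbrev EvenAux : Type := {v : C.Aux // C.auxParity v = 0}
abbrev OddAux : Type := {v : C.Aux // C.auxParity v ≠ 0}

/-- All Grassmann-odd variables: odd original fields, odd ghosts and odd antifields. -/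
abbrev OddVar : Type := C.OddField ⊕ C.OddAux

/-- The space in which the Grassmann-even original fields take their values; its points are the
`φ`-points. -/
abbrev Pt : Type := C.EvenField → ℝ

/-- The Grassmann algebra of the odd original fields. A function of the original fields `φ` is a
function `C.Pt → C.FieldAlg`. -/
abbrev FieldAlg : Type := ExteriorAlgebra ℝ (C.OddField → ℝ)

/-- The formal power series in the even auxiliary variables with coefficients in the Grassmann
algebra of all odd variables. A function of all variables `φ, c, Φ*` is a function
`C.Pt → C.FullAlg`. -/
abbrev FullAlg : Type := MvPowerSeries C.EvenAux (ExteriorAlgebra ℝ (C.OddVar → ℝ))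

variable {C}

/-! ### Smoothness and parity -/

/-- Smoothness on `U` of a function of the original fields (the Grassmann algebra is finite
dimensional). -/
def FieldSmoothOn (F : C.Pt → C.FieldAlg) (U : Set C.Pt) : Prop :=
  ∀ l : Module.Dual ℝ C.FieldAlg, ContDiffOn ℝ ∞ (fun x => l (F x)) U

/-- Smoothness on `U` of a function of all variables: every coefficient is smooth. -/
def SmoothOn (F : C.Pt → C.FullAlg) (U : Set C.Pt) : Prop :=
  ∀ (e : C.EvenAux →₀ ℕ) (l : Module.Dual ℝ (ExteriorAlgebra ℝ (C.OddVar → ℝ))),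
    ContDiffOn ℝ ∞ (fun x => l (MvPowerSeries.coeff e (F x))) U

/-- `f` is homogeneous of Grassmann parity `q`. -/
def FieldHasParity (f : C.FieldAlg) (q : ZMod 2) : Prop :=
  f ∈ CliffordAlgebra.evenOdd (0 : QuadraticForm ℝ (C.OddField → ℝ)) q

/-- `f` is homogeneous of Grassmann parity `q`. -/
def HasParity (f : C.FullAlg) (q : ZMod 2) : Prop :=
  ∀ e : C.EvenAux →₀ ℕ,
    MvPowerSeries.coeff e f ∈ CliffordAlgebra.evenOdd (0 : QuadraticForm ℝ (C.OddVar → ℝ)) q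

/-! ### Derivatives with respect to the original fields -/

/-- The partial derivative with respect to an even original field, taken coefficientwise in the
monomial basis of the Grassmann algebra. -/
def evenFieldDeriv (i : C.EvenField) (S : C.Pt → C.FieldAlg) (x : C.Pt) : C.FieldAlg :=
  ∑ J : Finset C.OddField,
    (fderiv ℝ (fun y => (Pi.basisFun ℝ C.OddField).ExteriorAlgebra.repr (S y) J) x
      (Pi.single i 1)) • (Pi.basisFun ℝ C.OddField).ExteriorAlgebra J

open Classical in
/-- The left derivative with respect to `φ^i`. -/
def fieldLeftDeriv (i : Fin (C.m 0)) (S : C.Pt → C.FieldAlg) (x : C.Pt) : C.FieldAlg :=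
  if h : C.ε 0 i = 0 then evenFieldDeriv ⟨i, h⟩ S x
  else CliffordAlgebra.contractLeft
    (LinearMap.proj (R := ℝ) (φ := fun _ : C.OddField => ℝ) ⟨i, h⟩) (S x)

open Classical in
/-- The right derivative with respect to `φ^i`. -/
def fieldRightDeriv (i : Fin (C.m 0)) (S : C.Pt → C.FieldAlg) (x : C.Pt) : C.FieldAlg :=
  if h : C.ε 0 i = 0 then evenFieldDeriv ⟨i, h⟩ S x
  else CliffordAlgebra.contractRight (S x)
    (LinearMap.proj (R := ℝ) (φ := fun _ : C.OddField => ℝ) ⟨i, h⟩)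

/-- The value of a function of `φ` with all odd original fields set to zero. -/
def body (f : C.FieldAlg) : ℝ := ExteriorAlgebra.algebraMapInv f

/-- The (body of the) Hessian of `S` at `x`. -/
def hessian (S : C.Pt → C.FieldAlg) (x : C.Pt) : Matrix (Fin (C.m 0)) (Fin (C.m 0)) ℝ :=
  Matrix.of fun i j => body (fieldLeftDeriv i (fieldRightDeriv j S) x)

/-- `x` lies on the stationary surface of `S`: all equations of motion hold at `x` (where the odd
fields vanish). -/
def IsStationary (S : C.Pt → C.FieldAlg) (x : C.Pt) : Prop :=
  ∀ i : Fin (C.m 0), body (fieldRightDeriv i S x) = 0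

/-! ### The algebra of all variables -/

/-- The element with prescribed coefficients. -/
def ofCoeff (c : (C.EvenAux →₀ ℕ) → ExteriorAlgebra ℝ (C.OddVar → ℝ)) : C.FullAlg := c

theorem coeff_ofCoeff (c : (C.EvenAux →₀ ℕ) → ExteriorAlgebra ℝ (C.OddVar → ℝ))
    (e : C.EvenAux →₀ ℕ) : MvPowerSeries.coeff e (ofCoeff c) = c e := rfl

/-- The inclusion of functions of the original fields into functions of all variables. -/
def incl : C.FieldAlg →+* C.FullAlg :=
  MvPowerSeries.C.comp
    (ExteriorAlgebra.map
      ({ toFun := fun f => Sum.elim f 0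
         map_add' := by intro f g; funext v; cases v <;> simp
         map_smul' := by intro r f; funext v; cases v <;> simp } :
        (C.OddField → ℝ) →ₗ[ℝ] (C.OddVar → ℝ))).toRingHom

open Classical in
/-- An auxiliary variable as an element of the algebra of all variables. -/
def auxVar (v : C.Aux) : C.FullAlg :=
  if h : C.auxParity v = 0 then MvPowerSeries.X ⟨v, h⟩
  else MvPowerSeries.C (ExteriorAlgebra.ι ℝ (Pi.single (Sum.inr ⟨v, h⟩) 1))

open Classical in
/-- The left derivative with respect to an auxiliary variable. -/
def auxDeriv (v : C.Aux) (f : C.FullAlg) : C.FullAlg :=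
  if h : C.auxParity v = 0 then
    ofCoeff fun e => ((e ⟨v, h⟩ : ℝ) + 1) • MvPowerSeries.coeff (e + Finsupp.single ⟨v, h⟩ 1) f
  else
    ofCoeff fun e => CliffordAlgebra.contractLeft
      (LinearMap.proj (R := ℝ) (φ := fun _ : C.OddVar => ℝ) (Sum.inr ⟨v, h⟩))
      (MvPowerSeries.coeff e f)

/-- The antifield `Φ*_a`. -/
def antifield (a : C.Anti) : C.FullAlg := auxVar (Sum.inr a)

/-- The left derivative `∂/∂Φ*_a`. -/
def antiDeriv (a : C.Anti) (f : C.FullAlg) : C.FullAlg := auxDeriv (Sum.inr a) f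

open Classical in
/-- Restriction to vanishing antifields, `f ↦ f|_{Φ* = 0}`. -/
def atZeroAnti (f : C.FullAlg) : C.FullAlg := ofCoeff fun e =>
  if ∀ v : C.EvenAux, v.1.isRight = true → e v = 0 then
    ExteriorAlgebra.map
      ({ toFun := fun g v => Sum.elim (fun _ => g v)
            (fun w : C.OddAux => if w.1.isRight = true then 0 else g v) v
         map_add' := by intro f g; funext v; rcases v with v | v <;> simp; split_ifs <;> simp
         map_smul' := by intro r f; funext v; rcases v with v | v <;> simp } :
        (C.OddVar → ℝ) →ₗ[ℝ] (C.OddVar → ℝ)) (MvPowerSeries.coeff e f)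
  else 0

/-- `f = O((Φ*)²)`: `f` and its first antifield derivatives vanish at `Φ* = 0`. -/
def AntiQuadratic (f : C.FullAlg) : Prop :=
  atZeroAnti f = 0 ∧ ∀ a : C.Anti, atZeroAnti (antiDeriv a f) = 0

/-- `f` is homogeneous of antifield number `r`, expressed by the Euler operator that counts
antifields with weight `afn(Φ*_a)`. -/
def HasAfn (f : C.FullAlg) (r : ℕ) : Prop :=
  ∑ a : C.Anti, (C.antiAfn a : ℝ) • (antifield a * antiDeriv a f) = (r : ℝ) • f

/-- `afn(f) > 0`: every term of `f` has positive antifield number. Since antifields have positive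
antifield number and the other variables have antifield number zero, this says that `f`
vanishes at `Φ* = 0`. -/
def PosAfn (f : C.FullAlg) : Prop := atZeroAnti f = 0

/-- `f` does not depend on the ghosts. -/
def GhostFree (f : C.FullAlg) : Prop := ∀ g : C.Ghost, auxDeriv (Sum.inl g) f = 0

/-! ### The Koszul–Tate operator -/

/-- The structure functions `V_α` built from the action `S₀`, the generators `Z` (with
`Z 0 = R`) and the remainders `M`:
`V_i = T_i = S₀ ∂←/∂φ^i` and `V_{α_s} = Φ*_{α_{s-1}} Z^{α_{s-1}}_{α_s} + M_{α_s}`,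
`s ∈ {0, …, L}`. -/
def structureFn (S₀ : C.Pt → C.FieldAlg)
    (Z : (s : Fin (C.L + 1)) → C.Pt →
      Matrix (Fin (C.m s.castSucc)) (Fin (C.m s.succ)) C.FieldAlg)
    (M : (s : Fin (C.L + 1)) → Fin (C.m s.succ) → C.Pt → C.FullAlg)
    (a : C.Anti) (x : C.Pt) : C.FullAlg :=
  Fin.cases (motive := fun k => Fin (C.m k) → C.FullAlg)
    (fun i => incl (fieldRightDeriv i S₀ x))
    (fun s β => (∑ α : Fin (C.m s.castSucc), antifield ⟨s.castSucc, α⟩ * incl (Z s x α β))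
      + M s β x)
    a.1 a.2

/-- The operator `V_α ∂/∂Φ*_α` acting on functions of all variables. -/
def koszulTate (V : C.Anti → C.Pt → C.FullAlg) (F : C.Pt → C.FullAlg) : C.Pt → C.FullAlg :=
  fun x => ∑ a : C.Anti, V a x * antiDeriv a (F x)

variable (C) in
/-- `M_s = ∑_{r ≥ 0} (-1)^r m_{r+s}`, with the stage `s` at position `k = s + 1`. -/
def altMult (k : Fin (C.L + 2)) : ℤ :=
  ∑ j ∈ Finset.Ici k, (-1) ^ ((j : ℕ) - (k : ℕ)) * (C.m j : ℤ)

/-- The rank conditions on `U`: the Hessian of `S₀` has rank `M_{-1}`, and `Z^{α_{s-1}}_{α_s}` has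
rank `M_s` for `s ∈ {0, …, L}`. Ranks are those of the bodies of the supermatrices. -/
def RankConditions (S₀ : C.Pt → C.FieldAlg)
    (Z : (s : Fin (C.L + 1)) → C.Pt →
      Matrix (Fin (C.m s.castSucc)) (Fin (C.m s.succ)) C.FieldAlg)
    (U : Set C.Pt) : Prop :=
  ∀ x ∈ U, ((hessian S₀ x).rank : ℤ) = C.altMult 0 ∧
    ∀ s : Fin (C.L + 1), (((Z s x).map body).rank : ℤ) = C.altMult s.succ

end FieldContent

end

noncomputable section

namespace SuperAlg

open Classical FieldContent
open scoped ContDiff Topology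
open MvPowerSeries (coeff)

/-! At the stationary point `p` the operator is governed by the Jacobian `jac` of its coefficients
with respect to antifields and original fields, whose blocks are the bodies of the Hessian, of `R`
and of the higher `Z`. Nilpotency forces consecutive blocks to compose to zero at `p`
(`jac_mul_jac`). The rank conditions, through M_s + M_{s+1} = m_s, make the resulting complex exact
at every antifield level. Exactness yields a set `A` of antifields (columns) and a set `Y` of fields
such that the rows `Y`, together with the antifields outside `A`, give an invertible square minor
(`minor_injective`, `nonempty_selection`). The Jacobian respects level and parity, so the minor is
block diagonal.

The block of the equations of motion of even fields shows that the selected ones have independent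
differentials at `p`. The inverse function theorem turns them into coordinates x_i, paired with odd
antifields κ_i (`fderiv_coord_injective`, `exists_chart`). The remaining block `c` stays invertible
near `p` and pairs the other selected antifields with the unselected antifields and the odd fields
in `Y`. In these coordinates the operator is δ₀ + δ₁ with δ₀ = ∑ c_{uw} u ∂/∂w + ∑ x_i ∂/∂κ_i
(`NormalForm`).

The leading part δ₀ is contractible. For the linear pairs, ∑ g_{wu} w ∂/∂u with `g` inverse to `c`
anticommutes with δ₀ to the operator counting the paired variables, and one divides by the count
(`lin_homotopy`). For the coordinates, ∑ κ_i ∂/∂x_i gives the Euler operator of the pairs (x_i,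
κ_i), which is inverted on smooth functions by weighted averages along the rescaling of the x_i
(`y_homotopy`). Every antifield is contracted one way or the other, so positive antifield number
excludes the common kernel of the two counting operators.

The remainder δ₁ is treated by perturbation. For the weight `W` the homotopy h raises the order by
two and δ₁ lowers it by at most one. Hence F - δhF is again closed and of higher order
(`sub_op_hom_mem`), and the corrections add up to a finite sum in every coefficient
(`NormalForm.acyclic`). No step shrinks the domain, so one neighborhood serves all functions. -/

/-- The Grassmann algebra on generators labelled by `O`. -/
abbrev Lam (O : Type) : Type := ExteriorAlgebra ℝ (O → ℝ)

/-- Formal power series in even variables `E` over the Grassmann algebra on odd variables `O`. -/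
abbrev Alg (E O : Type) : Type := MvPowerSeries E (Lam O)

/-! ### Grassmann algebra: derivatives, multidegree operators, weight filtration. -/

section Lam
variable {O : Type}

/-- The odd generators. -/
def th (o : O) : Lam O := ExteriorAlgebra.ι ℝ (Pi.single o 1)

/-- The left derivative with respect to an odd generator. -/
def dth (o : O) : Lam O →ₗ[ℝ] Lam O :=
  CliffordAlgebra.contractLeft (LinearMap.proj (R := ℝ) (φ := fun _ : O => ℝ) o)

theorem th_mul_th (o o' : O) : th o * th o' = -(th o' * th o) :=
  eq_neg_of_add_eq_zero_left
    (ExteriorAlgebra.ι_add_mul_swap (R := ℝ) (M := O → ℝ) (Pi.single o 1) (Pi.single o' 1))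

theorem dth_th_mul (o o' : O) (x : Lam O) :
    dth o (th o' * x) = (if o = o' then x else 0) - th o' * dth o x := by
  unfold dth th
  erw [CliffordAlgebra.contractLeft_ι_mul]
  by_cases h : o = o'
  · subst h; simp
  · simp [h]

theorem dth_algebraMap (o : O) (r : ℝ) : dth o (algebraMap ℝ (Lam O) r) = 0 :=
  CliffordAlgebra.contractLeft_algebraMap (Q := (0 : QuadraticForm ℝ (O → ℝ)))
    (LinearMap.proj o) r

theorem dth_dth (o o' : O) (x : Lam O) : dth o (dth o' x) = -dth o' (dth o x) :=
  CliffordAlgebra.contractLeft_comm _ _ _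

variable [Fintype O]

theorem ι_eq_sum (m : O → ℝ) : ExteriorAlgebra.ι ℝ m = ∑ o, m o • th o := by
  conv_lhs => rw [pi_eq_sum_univ' m]
  simp only [map_sum, map_smul, th, Pi.single]

theorem Lam.induction {P : Lam O → Prop} (h0 : ∀ r : ℝ, P (algebraMap ℝ _ r))
    (hadd : ∀ x y, P x → P y → P (x + y)) (hmul : ∀ o x, P x → P (th o * x)) (x : Lam O) : P x := by
  -- The scalar is carried along because `P` is not assumed stable under scaling; it absorbs the
  -- coordinates of a vector expanded in generators.
  have key : ∀ r : ℝ, P (r • x) := by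
    refine CliffordAlgebra.left_induction (Q := (0 : QuadraticForm ℝ (O → ℝ)))
      (P := fun x => ∀ r : ℝ, P (r • x)) ?_ ?_ ?_ x
    · intro r s
      have := h0 (s * r)
      rwa [map_mul, ← Algebra.smul_def] at this
    · intro x y hx hy r
      rw [smul_add]
      exact hadd _ _ (hx r) (hy r)
    · intro x m hx r
      have e : r • (CliffordAlgebra.ι (0 : QuadraticForm ℝ (O → ℝ)) m * x)
          = ∑ o, th o * ((r * m o) • x) := by
        have := ι_eq_sum m
        unfold ExteriorAlgebra.ι at this
        rw [this, Finset.sum_mul, Finset.smul_sum]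
        refine Finset.sum_congr rfl fun o _ => ?_
        rw [smul_mul_assoc, smul_smul, mul_smul_comm]
      rw [e]
      refine Finset.sum_induction _ P hadd ?_ fun o _ => hmul o _ (hx _)
      simpa using h0 0
  simpa using key 1

/-- One step of the recursion that defines `diagLam`. -/
def diagStep : (O → ℝ) →ₗ[ℝ] (((O →₀ ℕ) → ℝ) → Lam O) →ₗ[ℝ] (((O →₀ ℕ) → ℝ) → Lam O) :=
  LinearMap.mk₂ ℝ
    (fun m n a => ∑ o, m o • (th o * n fun ν => a (ν + Finsupp.single o 1)))
    (by intro m m' n; funext a; simp [add_smul, Finset.sum_add_distrib])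
    (by intro c m n; funext a; simp [mul_smul, Finset.smul_sum])
    (by intro m n n'; funext a; simp [mul_add, Finset.sum_add_distrib])
    (by intro c m n; funext a; simp [Finset.smul_sum, smul_comm c])

/-- The recursion descends to the exterior algebra only if its step squares to zero. Degree shifts
commute while generators anticommute, so the double sum equals its own negative. -/
theorem diagStep_diagStep (m : O → ℝ) (n : ((O →₀ ℕ) → ℝ) → Lam O) :
    diagStep m (diagStep m n) = (0 : QuadraticForm ℝ (O → ℝ)) m • n := by
  funext a
  simp only [diagStep, LinearMap.mk₂_apply, zero_apply, zero_smul, Pi.zero_apply]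
  set g : O → O → Lam O := fun o o' => m o • (th o * (m o' • (th o' * n fun ν =>
    a (ν + Finsupp.single o' 1 + Finsupp.single o 1)))) with hg
  have h1 : ∀ o o', g o o' = -g o' o := by
    intro o o'
    simp only [hg, mul_smul_comm, ← mul_assoc]
    rw [th_mul_th o o', smul_comm (m o), neg_mul, smul_neg, smul_neg]
    simp only [add_right_comm _ (Finsupp.single o' 1) (Finsupp.single o 1)]
  have h2 : ∑ o, ∑ o', g o o' = -∑ o, ∑ o', g o o' := by
    conv_lhs => rw [Finset.sum_comm]
    rw [← Finset.sum_neg_distrib]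
    refine Finset.sum_congr rfl fun o _ => ?_
    rw [← Finset.sum_neg_distrib]
    exact Finset.sum_congr rfl fun o' _ => h1 _ _
  have h3 : ∑ o, ∑ o', g o o' = 0 := by
    have h4 : (2 : ℝ) • ∑ o, ∑ o', g o o' = 0 := by
      rw [two_smul]; nth_rewrite 1 [h2]; simp
    exact (smul_eq_zero.mp h4).resolve_left two_ne_zero
  simpa [hg, Finset.mul_sum, Finset.smul_sum] using h3

/-- The operator that multiplies every monomial by a function of its multidegree. -/
def diagLam (a : (O →₀ ℕ) → ℝ) : Lam O →ₗ[ℝ] Lam O :=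
  (LinearMap.proj a).comp (CliffordAlgebra.foldr (0 : QuadraticForm ℝ (O → ℝ)) diagStep
    diagStep_diagStep fun a => algebraMap ℝ _ (a 0))

theorem diagLam_algebraMap (a : (O →₀ ℕ) → ℝ) (r : ℝ) :
    diagLam a (algebraMap ℝ _ r) = algebraMap ℝ _ (a 0 * r) := by
  unfold diagLam
  simp only [LinearMap.comp_apply]
  erw [CliffordAlgebra.foldr_algebraMap]
  simp [Algebra.smul_def, mul_comm]

theorem diagLam_th_mul (a : (O →₀ ℕ) → ℝ) (o : O) (x : Lam O) :
    diagLam a (th o * x) = th o * diagLam (fun ν => a (ν + Finsupp.single o 1)) x := by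
  unfold diagLam
  simp only [LinearMap.comp_apply]
  rw [CliffordAlgebra.foldr_mul]
  unfold th
  erw [CliffordAlgebra.foldr_ι]
  simp only [diagStep, LinearMap.mk₂_apply, LinearMap.proj_apply]
  rw [Finset.sum_eq_single o]
  · simp [th]
  · intro b _ hb; simp [hb]
  · simp

theorem diagLam_one (x : Lam O) : diagLam (fun _ => 1) x = x := by
  induction x using Lam.induction with
  | h0 r => simp [diagLam_algebraMap]
  | hadd x y hx hy => rw [map_add, hx, hy]
  | hmul o x hx => rw [diagLam_th_mul, hx]

theorem diagLam_diagLam (a b : (O →₀ ℕ) → ℝ) (x : Lam O) :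
    diagLam a (diagLam b x) = diagLam (a * b) x := by
  induction x using Lam.induction generalizing a b with
  | h0 r => simp only [diagLam_algebraMap, Pi.mul_apply, mul_assoc]
  | hadd x y hx hy => simp only [map_add, hx, hy]
  | hmul o x hx => simp only [diagLam_th_mul, hx]; rfl

theorem diagLam_add (a b : (O →₀ ℕ) → ℝ) (x : Lam O) :
    diagLam (a + b) x = diagLam a x + diagLam b x := by
  induction x using Lam.induction generalizing a b with
  | h0 r => simp only [diagLam_algebraMap, Pi.add_apply, add_mul, map_add]
  | hadd x y hx hy => simp only [map_add, hx, hy]; abel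
  | hmul o x hx => simp only [diagLam_th_mul, ← mul_add, ← hx]; rfl

theorem diagLam_smul (r : ℝ) (a : (O →₀ ℕ) → ℝ) (x : Lam O) :
    diagLam (r • a) x = r • diagLam a x := by
  induction x using Lam.induction generalizing a with
  | h0 s => simp [diagLam_algebraMap, Algebra.smul_def, mul_assoc]
  | hadd x y hx hy => simp only [map_add, hx, hy, smul_add]
  | hmul o x hx => simp only [diagLam_th_mul, ← mul_smul_comm, ← hx]; rfl

theorem dth_diagLam (a : (O →₀ ℕ) → ℝ) (o : O) (x : Lam O) :
    dth o (diagLam a x) = diagLam (fun ν => a (ν + Finsupp.single o 1)) (dth o x) := by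
  induction x using Lam.induction generalizing a with
  | h0 r => rw [diagLam_algebraMap, dth_algebraMap, dth_algebraMap, map_zero]
  | hadd x y hx hy => simp only [map_add, hx, hy]
  | hmul o' x hx =>
    rw [diagLam_th_mul, dth_th_mul, dth_th_mul, map_sub, diagLam_th_mul, hx]
    congr 1
    · split_ifs with h
      · rw [h]
      · simp
    · simp only [add_right_comm _ (Finsupp.single o' 1) (Finsupp.single o 1)]

/-- Euler's identity, by induction on the number of factors. A new factor is hit once by its own
derivative, which adds its weight; in the other terms the sign from the derivative cancels the sign
from reordering. -/
theorem sum_th_dth (w : O → ℕ) (x : Lam O) :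
    ∑ o, (w o : ℝ) • (th o * dth o x) = diagLam (fun ν => (Finsupp.weight w ν : ℝ)) x := by
  have shift : ∀ o' x, diagLam (fun ν => (Finsupp.weight w (ν + Finsupp.single o' 1) : ℝ)) x
      = diagLam (fun ν => (Finsupp.weight w ν : ℝ)) x + (w o' : ℝ) • x := by
    intro o' x
    conv_rhs => rw [← diagLam_one x, diagLam_diagLam, ← diagLam_smul, ← diagLam_add]
    congr 2
    funext ν
    simp [Finsupp.weight_single]
  induction x using Lam.induction with
  | h0 r => simp [diagLam_algebraMap, dth_algebraMap]
  | hadd x y hx hy => simp only [map_add, mul_add, smul_add, Finset.sum_add_distrib, hx, hy]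
  | hmul o' x hx =>
    rw [diagLam_th_mul, shift, ← hx]
    simp only [dth_th_mul, mul_sub, smul_sub, Finset.sum_sub_distrib, mul_add, Finset.mul_sum]
    rw [Finset.sum_eq_single o' (by intro b _ hb; simp [hb]) (by simp)]
    rw [if_pos rfl, mul_smul_comm, add_comm, sub_eq_add_neg, ← Finset.sum_neg_distrib]
    congr 1
    refine Finset.sum_congr rfl fun o _ => ?_
    rw [← mul_assoc, th_mul_th, mul_smul_comm, neg_mul, mul_assoc, smul_neg, neg_neg]

/-- The ideal spanned by the monomials of weight at least `n`. -/
def FilLam (w : O → ℕ) (n : ℕ) : Submodule ℝ (Lam O) where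
  carrier := {x | ∀ a : (O →₀ ℕ) → ℝ, (∀ ν, n ≤ Finsupp.weight w ν → a ν = 0) → diagLam a x = 0}
  add_mem' := by intro x y hx hy a ha; rw [map_add, hx a ha, hy a ha, add_zero]
  zero_mem' := by intro a _; rw [map_zero]
  smul_mem' := by intro r x hx a ha; rw [map_smul, hx a ha, smul_zero]

theorem FilLam_zero (w : O → ℕ) (x : Lam O) : x ∈ FilLam w 0 := by
  intro a ha
  have : a = (0 : ℝ) • fun _ => 1 := by funext ν; simp [ha ν (Nat.zero_le _)]
  rw [this, diagLam_smul, zero_smul]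

theorem FilLam_anti (w : O → ℕ) {m n : ℕ} (h : m ≤ n) {x : Lam O} (hx : x ∈ FilLam w n) :
    x ∈ FilLam w m := fun a ha => hx a fun ν hν => ha ν (h.trans hν)

theorem diagLam_mem_FilLam {w : O → ℕ} {n : ℕ} (a : (O →₀ ℕ) → ℝ) {x : Lam O}
    (hx : x ∈ FilLam w n) : diagLam a x ∈ FilLam w n := by
  intro b hb
  rw [diagLam_diagLam]
  exact hx _ fun ν hν => by simp [hb ν hν]

theorem dth_mem_FilLam {w : O → ℕ} {n : ℕ} (o : O) {x : Lam O} (hx : x ∈ FilLam w n) :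
    dth o x ∈ FilLam w (n - w o) := by
  intro a ha
  -- A multiplier whose shift by `o` is `a`; its value 0 at degrees not containing `o` keeps it
  -- supported on low weights.
  have h := dth_diagLam (fun ν => if 1 ≤ ν o then a (ν - Finsupp.single o 1) else 0) o x
  have e : (fun ν : O →₀ ℕ => (fun ν : O →₀ ℕ =>
      if 1 ≤ ν o then a (ν - Finsupp.single o 1) else 0) (ν + Finsupp.single o 1)) = a := by
    funext ν; simp
  rw [e] at h
  rw [← h, hx, map_zero]
  intro ν hν
  split_ifs with h1
  · apply ha
    have h2 : ν = (ν - Finsupp.single o 1) + Finsupp.single o 1 :=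
      (tsub_add_cancel_of_le (by simpa using h1)).symm
    rw [h2] at hν
    simp only [map_add, Finsupp.weight_single, one_smul] at hν
    omega
  · rfl

/-- Weights add under products. The left factor is truncated to weights at least `m` instead of
being assumed to lie in `FilLam w m`, since membership does not pass to the pieces of an induction;
truncation does, with `m` replaced by `m - w o`. -/
theorem diagLam_mul_eq_zero {w : O → ℕ} {n : ℕ} {y : Lam O} (hy : y ∈ FilLam w n) (x : Lam O) :
    ∀ (m : ℕ) (a : (O →₀ ℕ) → ℝ), (∀ ν, m + n ≤ Finsupp.weight w ν → a ν = 0) →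
      diagLam a (diagLam (fun ν => if m ≤ Finsupp.weight w ν then 1 else 0) x * y) = 0 := by
  induction x using Lam.induction with
  | h0 r =>
    intro m a ha
    rw [diagLam_algebraMap, ← Algebra.smul_def, map_smul]
    rcases Nat.eq_zero_or_pos m with rfl | hm
    · rw [hy a (by simpa using ha), smul_zero]
    · simp [hm.ne']
  | hadd x x' hx hx' => intro m a ha; rw [map_add, add_mul, map_add, hx m a ha, hx' m a ha, add_zero]
  | hmul o x hx =>
    intro m a ha
    rw [diagLam_th_mul, mul_assoc, diagLam_th_mul]
    have e : (fun ν : O →₀ ℕ => if m ≤ Finsupp.weight w (ν + Finsupp.single o 1) then (1 : ℝ) else 0)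
        = fun ν => if m - w o ≤ Finsupp.weight w ν then 1 else 0 := by
      funext ν; simp [Finsupp.weight_single]
    rw [e, hx (m - w o) _ ?_, mul_zero]
    intro ν hν
    apply ha
    simp only [map_add, Finsupp.weight_single, one_smul]
    omega

theorem eq_diagLam_of_mem_FilLam {w : O → ℕ} {n : ℕ} {x : Lam O} (hx : x ∈ FilLam w n) :
    diagLam (fun ν => if n ≤ Finsupp.weight w ν then 1 else 0) x = x := by
  conv_rhs => rw [← diagLam_one x]
  rw [← sub_eq_zero, sub_eq_add_neg, ← neg_one_smul ℝ (diagLam _ x), ← diagLam_smul, ← diagLam_add]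
  exact hx _ fun ν hν => by simp [hν]

theorem mul_mem_FilLam {w : O → ℕ} {m n : ℕ} {x y : Lam O} (hx : x ∈ FilLam w m)
    (hy : y ∈ FilLam w n) : x * y ∈ FilLam w (m + n) := by
  intro a ha
  rw [← eq_diagLam_of_mem_FilLam hx]
  exact diagLam_mul_eq_zero hy x m a ha

instance : Module.Finite ℝ (Lam O) := by
  let _ : LinearOrder O := LinearOrder.lift' (Fintype.equivFin O) (Fintype.equivFin O).injective
  exact Module.Finite.of_basis (Pi.basisFun ℝ O).ExteriorAlgebra

theorem exists_forall_diagLam_eq_zero (w : O → ℕ) (x : Lam O) :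
    ∃ D : ℕ, ∀ a : (O →₀ ℕ) → ℝ, (∀ ν, Finsupp.weight w ν < D → a ν = 0) → diagLam a x = 0 := by
  induction x using Lam.induction with
  | h0 r => exact ⟨1, fun a ha => by simp [diagLam_algebraMap, ha 0]⟩
  | hadd x y hx hy =>
    obtain ⟨D, hD⟩ := hx
    obtain ⟨D', hD'⟩ := hy
    refine ⟨max D D', fun a ha => ?_⟩
    rw [map_add, hD a fun ν hν => ha ν (by omega), hD' a fun ν hν => ha ν (by omega), add_zero]
  | hmul o x hx =>
    obtain ⟨D, hD⟩ := hx
    refine ⟨D + w o, fun a ha => ?_⟩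
    rw [diagLam_th_mul, hD _ fun ν hν => ha _ ?_, mul_zero]
    simp only [map_add, Finsupp.weight_single, one_smul]
    omega

/-- Weights of monomials in the Grassmann algebra are bounded. -/
theorem exists_bound_diagLam (w : O → ℕ) :
    ∃ D : ℕ, ∀ a : (O →₀ ℕ) → ℝ, (∀ ν, Finsupp.weight w ν < D → a ν = 0) →
      ∀ x : Lam O, diagLam a x = 0 := by
  obtain ⟨s, hs⟩ := (inferInstance : Module.Finite ℝ (Lam O)).fg_top
  choose D hD using exists_forall_diagLam_eq_zero (O := O) w
  refine ⟨s.sup D, fun a ha x => ?_⟩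
  have : diagLam a = 0 := by
    refine LinearMap.ext_on_range (v := fun y : s => (y : Lam O)) (by simpa using hs) fun y => ?_
    exact hD _ a fun ν hν => ha ν (hν.trans_le (Finset.le_sup y.2))
  rw [this, LinearMap.zero_apply]

/-- Odd variables occur at most once, so weights are bounded. This makes the filtration separated
even though some variables have weight zero. -/
theorem exists_FilLam_eq_bot (w : O → ℕ) : ∃ D : ℕ, ∀ x ∈ FilLam w D, x = 0 := by
  obtain ⟨D, hD⟩ := exists_bound_diagLam w
  refine ⟨D, fun x hx => ?_⟩
  rw [← eq_diagLam_of_mem_FilLam hx]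
  exact hD _ (fun ν hν => by simp [hν]) x

end Lam

/-! ### Power series: variables, derivatives, multidegrees, filtration. -/

section Alg
variable {E O : Type}

/-- The linear operator on power series whose coefficient at `e` is obtained from the one at `s e`
by the linear map `l e`. -/
def coeffLin (s : (E →₀ ℕ) → (E →₀ ℕ)) (l : (E →₀ ℕ) → Lam O →ₗ[ℝ] Lam O) :
    Alg E O →ₗ[ℝ] Alg E O where
  toFun f := fun e => l e (coeff (s e) f)
  map_add' f g := by funext e; exact (l e).map_add _ _
  map_smul' r f := by funext e; exact (l e).map_smul _ _

theorem coeff_coeffLin (s : (E →₀ ℕ) → (E →₀ ℕ)) (l : (E →₀ ℕ) → Lam O →ₗ[ℝ] Lam O)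
    (f : Alg E O) (e : E →₀ ℕ) : coeff e (coeffLin s l f) = l e (coeff (s e) f) := rfl

theorem coeff_rsmul (r : ℝ) (f : Alg E O) (e : E →₀ ℕ) : coeff e (r • f) = r • coeff e f := rfl

/-- The variables as elements of the algebra. -/
def mv : E ⊕ O → Alg E O
  | Sum.inl e => MvPowerSeries.X e
  | Sum.inr o => MvPowerSeries.C (th o)

/-- Left multiplication by a variable. -/
def lmv : E ⊕ O → Alg E O →ₗ[ℝ] Alg E O
  | Sum.inl v => coeffLin (fun e => e - Finsupp.single v 1)
      fun e => if Finsupp.single v 1 ≤ e then LinearMap.id else 0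
  | Sum.inr o => coeffLin id fun _ => LinearMap.mulLeft ℝ (th o)

/-- Left multiplication by a variable thereby becomes an operator in the class `IsCL`, which
commutes with scalar operators applied coefficientwise. -/
theorem mv_mul (v : E ⊕ O) (f : Alg E O) : mv v * f = lmv v f := by
  ext1 e
  cases v with
  | inl v =>
    simp only [mv, lmv, coeff_coeffLin, MvPowerSeries.X, MvPowerSeries.coeff_monomial_mul, one_mul]
    split_ifs <;> simp
  | inr o => simp [mv, lmv, coeff_coeffLin]

/-- The left derivative with respect to a variable. -/
def dv : E ⊕ O → Alg E O →ₗ[ℝ] Alg E O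
  | Sum.inl v => coeffLin (fun e => e + Finsupp.single v 1)
      fun e => ((e v : ℝ) + 1) • LinearMap.id
  | Sum.inr o => coeffLin id fun _ => dth o

/-- The sign for exchanging two variables. -/
def sg : E ⊕ O → E ⊕ O → ℝ
  | Sum.inr _, Sum.inr _ => -1
  | _, _ => 1

theorem lmv_lmv (u v : E ⊕ O) (f : Alg E O) : lmv u (lmv v f) = sg u v • lmv v (lmv u f) := by
  simp only [← mv_mul, ← mul_assoc, ← smul_mul_assoc]
  congr 1
  rcases u with u | u <;> rcases v with v | v <;> simp only [mv, sg, one_smul]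
  · exact MvPowerSeries.X_mul
  · exact MvPowerSeries.X_mul
  · exact MvPowerSeries.X_mul.symm
  · rw [← map_mul, th_mul_th, map_neg, map_mul, neg_smul, one_smul, neg_mul]

theorem dv_dv (u v : E ⊕ O) (f : Alg E O) : dv u (dv v f) = sg u v • dv v (dv u f) := by
  ext1 e
  rcases u with u | u <;> rcases v with v | v <;>
    simp only [dv, sg, one_smul, coeff_coeffLin, LinearMap.smul_apply, LinearMap.id_apply, id,
      coeff_rsmul]
  · rw [add_right_comm, smul_smul, smul_smul]
    congr 1
    by_cases h : u = v
    · subst h; rfl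
    · simp [h, Ne.symm h, mul_comm]
  · rw [map_smul]
  · rw [map_smul]
  · rw [dth_dth, neg_smul, one_smul]

theorem dv_lmv (v u : E ⊕ O) (f : Alg E O) :
    dv v (lmv u f) = (if v = u then f else 0) + sg v u • lmv u (dv v f) := by
  ext1 e
  rcases u with u | u <;> rcases v with v | v <;>
    simp only [dv, sg, one_smul, coeff_coeffLin, LinearMap.smul_apply, LinearMap.id_apply, id,
      coeff_rsmul, lmv, map_add, LinearMap.mulLeft_apply, reduceCtorEq, if_false, zero_add]
  · by_cases h : v = u
    · subst h
      by_cases h1 : 1 ≤ e v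
      · have h2 : Finsupp.single v 1 ≤ e := by simpa using h1
        rw [if_pos (by simp), if_pos h2, if_pos rfl]
        have h3 : (e - Finsupp.single v 1 : E →₀ ℕ) + Finsupp.single v 1 = e :=
          tsub_add_cancel_of_le h2
        simp only [LinearMap.id_apply, h3, add_tsub_cancel_right]
        have h4 : (e - Finsupp.single v 1 : E →₀ ℕ) v = e v - 1 := by simp
        rw [h4]
        push_cast [h1]
        module
      · have h0 : e v = 0 := by omega
        have hn : ¬ Finsupp.single v 1 ≤ e := by simp [h0]
        rw [if_pos (by simp), if_pos rfl, if_neg hn]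
        simp [h0]
    · have h5 : Finsupp.single u 1 ≤ e + Finsupp.single v 1 ↔ Finsupp.single u 1 ≤ e := by
        simp [h]
      simp only [h5, Sum.inl.injEq, h, if_false, map_zero, zero_add]
      split_ifs with h6
      · have h7 : e + Finsupp.single v 1 - Finsupp.single u 1
            = e - Finsupp.single u 1 + Finsupp.single v 1 := by
          ext i
          simp only [Finsupp.coe_add, Finsupp.coe_tsub, Pi.add_apply, Pi.sub_apply]
          have h8 : (Finsupp.single u 1 : E →₀ ℕ) i ≤ e i := h6 i
          omega
        have h9 : (e - Finsupp.single u 1 : E →₀ ℕ) v = e v := by simp [Ne.symm h]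
        simp only [LinearMap.id_apply, h7, h9]
      · simp
  · split_ifs <;> simp
  · rw [mul_smul_comm]
  · rw [dth_th_mul, sub_eq_add_neg, neg_smul, one_smul]
    congr 1
    simp only [Sum.inr.injEq]
    split_ifs <;> simp

/-- Two variables of opposite parity. -/
def Opp (u w : E ⊕ O) : Prop := u.isRight ≠ w.isRight

/-- When `u` and `w` have opposite parity, u ∂/∂w is an odd derivation. In the anticommutator of two
of them the second order terms cancel, and only the contractions of a derivative with a variable
remain. -/
theorem anticomm_lmv_dv {u w u' w' : E ⊕ O} (h : Opp u w) (h' : Opp u' w') (f : Alg E O) :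
    lmv u (dv w (lmv w' (dv u' f))) + lmv w' (dv u' (lmv u (dv w f)))
      = (if w = w' then lmv u (dv u' f) else 0) + (if u' = u then lmv w' (dv w f) else 0) := by
  simp only [dv_lmv, map_add, map_smul]
  rw [dv_dv u' w, lmv_lmv w' u]
  simp only [map_smul]
  -- The sign that cancels the second order terms; it depends on both operators being odd.
  have hs : sg w w' + sg u' u * (sg u' w * sg w' u) = 0 := by
    unfold Opp at h h'
    rcases u with u | u <;> rcases w with w | w <;> rcases u' with u' | u' <;>
      rcases w' with w' | w' <;> simp_all [sg]
  have h1 : sg u' u • sg w' u • sg u' w • lmv u (lmv w' (dv w (dv u' f)))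
      = -(sg w w' • lmv u (lmv w' (dv w (dv u' f)))) := by
    rw [smul_smul, smul_smul, ← neg_smul]
    congr 1
    linear_combination hs
  have h2 : lmv u (if w = w' then dv u' f else 0) = if w = w' then lmv u (dv u' f) else 0 := by
    split_ifs <;> simp
  have h3 : lmv w' (if u' = u then dv w f else 0) = if u' = u then lmv w' (dv w f) else 0 := by
    split_ifs <;> simp
  rw [h2, h3, h1]
  abel

/-- Multidegrees of monomials. -/
abbrev Mo (E O : Type) : Type := (E →₀ ℕ) × (O →₀ ℕ)

/-- The multidegree of a variable. -/
def sv : E ⊕ O → Mo E O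
  | Sum.inl e => (Finsupp.single e 1, 0)
  | Sum.inr o => (0, Finsupp.single o 1)

/-- The weight of a multidegree. -/
def wt (w : E ⊕ O → ℕ) (μ : Mo E O) : ℕ :=
  Finsupp.weight (w ∘ Sum.inl) μ.1 + Finsupp.weight (w ∘ Sum.inr) μ.2

theorem wt_add_sv (w : E ⊕ O → ℕ) (μ : Mo E O) (v : E ⊕ O) : wt w (μ + sv v) = wt w μ + w v := by
  cases v <;> simp [wt, sv, Finsupp.weight_single] <;> ring

theorem wt_zero (w : E ⊕ O → ℕ) : wt w 0 = 0 := by simp [wt]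

variable [Fintype O]

/-- The operator that multiplies every monomial by a function of its multidegree. -/
def diag (a : Mo E O → ℝ) : Alg E O →ₗ[ℝ] Alg E O :=
  coeffLin id fun e => diagLam fun ν => a (e, ν)

theorem coeff_diag (a : Mo E O → ℝ) (f : Alg E O) (e : E →₀ ℕ) :
    coeff e (diag a f) = diagLam (fun ν => a (e, ν)) (coeff e f) := rfl

theorem diag_one (f : Alg E O) : diag (fun _ => 1) f = f := by
  ext1 e; rw [coeff_diag, diagLam_one]

theorem diag_diag (a b : Mo E O → ℝ) (f : Alg E O) :
    diag a (diag b f) = diag (a * b) f := by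
  ext1 e; rw [coeff_diag, coeff_diag, diagLam_diagLam]; rfl

theorem diag_add (a b : Mo E O → ℝ) (f : Alg E O) :
    diag (a + b) f = diag a f + diag b f := by
  ext1 e; rw [map_add]; simp only [coeff_diag]; rw [← diagLam_add]; rfl

theorem diag_smul (r : ℝ) (a : Mo E O → ℝ) (f : Alg E O) :
    diag (r • a) f = r • diag a f := by
  ext1 e; rw [coeff_rsmul]; simp only [coeff_diag]; rw [← diagLam_smul]; rfl

theorem diag_zero (f : Alg E O) : diag (fun _ => 0) f = 0 := by
  have := diag_smul 0 (fun _ => 0) f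
  rw [zero_smul, zero_smul] at this
  exact this

theorem diag_lmv (a : Mo E O → ℝ) (v : E ⊕ O) (f : Alg E O) :
    diag a (lmv v f) = lmv v (diag (fun μ => a (μ + sv v)) f) := by
  ext1 e
  cases v with
  | inl v =>
    simp only [coeff_diag, lmv, coeff_coeffLin]
    split_ifs with h
    · simp [sv, tsub_add_cancel_of_le h]
    · simp
  | inr o =>
    simp only [coeff_diag, lmv, coeff_coeffLin, LinearMap.mulLeft_apply, id, diagLam_th_mul]
    simp [sv]

theorem dv_diag (a : Mo E O → ℝ) (v : E ⊕ O) (f : Alg E O) :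
    dv v (diag a f) = diag (fun μ => a (μ + sv v)) (dv v f) := by
  ext1 e
  cases v with
  | inl v => simp [coeff_diag, dv, coeff_coeffLin, sv]
  | inr o => simp [coeff_diag, dv, coeff_coeffLin, sv, dth_diagLam]

theorem lmv_dv_diag (a : Mo E O → ℝ) (u w : E ⊕ O) (h : ∀ μ, a (μ + sv u) = a (μ + sv w))
    (f : Alg E O) : lmv u (dv w (diag a f)) = diag a (lmv u (dv w f)) := by
  rw [dv_diag, diag_lmv]; simp only [h]

theorem sum_lmv_dv [Fintype E] (w : E ⊕ O → ℕ) (f : Alg E O) :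
    ∑ v, (w v : ℝ) • lmv v (dv v f) = diag (fun μ => (wt w μ : ℝ)) f := by
  rw [Fintype.sum_sum_type]
  ext1 e
  simp only [map_add, map_sum, coeff_rsmul, coeff_diag]
  have h1 : ∀ v : E, coeff e (lmv (Sum.inl v) (dv (Sum.inl v) f)) = (e v : ℝ) • coeff e f := by
    intro v
    simp only [lmv, dv, coeff_coeffLin]
    split_ifs with h
    · have h1 : 1 ≤ e v := by simpa using h
      simp [tsub_add_cancel_of_le h, h1]
    · have h1 : e v = 0 := by simpa using h
      simp [h1]
  have h2 := sum_th_dth (w ∘ Sum.inr) (coeff e f)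
  simp only [Function.comp] at h2
  have h3 : ∀ o : O, coeff e (lmv (Sum.inr o) (dv (Sum.inr o) f)) = th o * dth o (coeff e f) :=
    fun o => rfl
  simp only [h1, h3]
  rw [h2]
  have h4 : (fun ν => (wt w (e, ν) : ℝ)) =
      (fun ν => ((Finsupp.weight (fun o => w (Sum.inr o)) ν : ℕ) : ℝ))
      + (∑ v, (w (Sum.inl v) : ℝ) * e v) • fun _ => 1 := by
    funext ν
    simp only [wt, Pi.add_apply, Pi.smul_apply, smul_eq_mul, mul_one, Finsupp.weight_eq_sum]
    push_cast
    rw [add_comm]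
    congr 1
    exact Finset.sum_congr rfl fun v _ => mul_comm _ _
  rw [h4, diagLam_add, diagLam_smul, diagLam_one, add_comm, Finset.sum_smul]
  simp only [smul_smul]
  rfl

/-- Power series all of whose monomials have weight at least `n`. -/
def Fil (w : E ⊕ O → ℕ) (n : ℕ) : Submodule ℝ (Alg E O) where
  carrier := {f | ∀ e, coeff e f ∈ FilLam (w ∘ Sum.inr) (n - Finsupp.weight (w ∘ Sum.inl) e)}
  add_mem' := by intro f g hf hg e; rw [map_add]; exact add_mem (hf e) (hg e)
  zero_mem' := by intro e; rw [map_zero]; exact zero_mem _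
  smul_mem' := by intro r f hf e; rw [coeff_rsmul]; exact Submodule.smul_mem _ _ (hf e)

theorem diag_eq_zero {w : E ⊕ O → ℕ} {n : ℕ} {f : Alg E O} (hf : f ∈ Fil w n)
    {a : Mo E O → ℝ} (ha : ∀ μ, n ≤ wt w μ → a μ = 0) : diag a f = 0 := by
  ext1 e
  rw [coeff_diag, map_zero]
  exact hf e _ fun ν hν => ha _ (by unfold wt; dsimp only; omega)

theorem mem_Fil_iff {w : E ⊕ O → ℕ} {n : ℕ} {f : Alg E O} :
    f ∈ Fil w n ↔ ∀ a : Mo E O → ℝ, (∀ μ, n ≤ wt w μ → a μ = 0) → diag a f = 0 := by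
  refine ⟨fun hf a ha => diag_eq_zero hf ha, fun h e a ha => ?_⟩
  -- A multiplier supported on the single even exponent `e` isolates one coefficient.
  have := congrArg (coeff e) (h (fun μ => if μ.1 = e then a μ.2 else 0) ?_)
  · simpa [coeff_diag] using this
  · intro μ hμ
    split_ifs with h1
    · subst h1; apply ha; unfold wt at hμ; omega
    · rfl

theorem Fil_zero (w : E ⊕ O → ℕ) (f : Alg E O) : f ∈ Fil w 0 := by
  intro e; rw [Nat.zero_sub]; exact FilLam_zero _ _

theorem Fil_anti (w : E ⊕ O → ℕ) {m n : ℕ} (h : m ≤ n) {f : Alg E O} (hf : f ∈ Fil w n) :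
    f ∈ Fil w m := fun e => FilLam_anti _ (by omega) (hf e)

theorem diag_mem_Fil {w : E ⊕ O → ℕ} {n : ℕ} (a : Mo E O → ℝ) {f : Alg E O}
    (hf : f ∈ Fil w n) : diag a f ∈ Fil w n := fun e => diagLam_mem_FilLam _ (hf e)

theorem lmv_mem_Fil {w : E ⊕ O → ℕ} {n : ℕ} (v : E ⊕ O) {f : Alg E O} (hf : f ∈ Fil w n) :
    lmv v f ∈ Fil w (n + w v) := by
  rw [mem_Fil_iff]
  intro a ha
  rw [diag_lmv, diag_eq_zero hf, map_zero]
  intro μ hμ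
  exact ha _ (by rw [wt_add_sv]; omega)

theorem dv_mem_Fil {w : E ⊕ O → ℕ} {n : ℕ} (v : E ⊕ O) {f : Alg E O} (hf : f ∈ Fil w n) :
    dv v f ∈ Fil w (n - w v) := by
  intro e
  cases v with
  | inl v =>
    simp only [dv, coeff_coeffLin]
    refine Submodule.smul_mem _ _ (FilLam_anti _ ?_ (hf _))
    simp [Finsupp.weight_single]; omega
  | inr o => exact FilLam_anti _ (by simp; omega) (dth_mem_FilLam o (hf e))

theorem mul_mem_Fil {w : E ⊕ O → ℕ} {m n : ℕ} {f g : Alg E O} (hf : f ∈ Fil w m)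
    (hg : g ∈ Fil w n) : f * g ∈ Fil w (m + n) := by
  intro e
  rw [MvPowerSeries.coeff_mul]
  refine Submodule.sum_mem _ fun p hp => FilLam_anti _ ?_ (mul_mem_FilLam (hf p.1) (hg p.2))
  have hp' : p.1 + p.2 = e := by simpa using hp
  rw [← hp', map_add]; omega

/-- The even part of the exponent contributes a fixed weight and the Grassmann part a bounded one.
This bound makes infinite sums of corrections finite in each coefficient. -/
theorem exists_coeff_eq_zero_of_mem_Fil (w : E ⊕ O → ℕ) :
    ∃ D : (E →₀ ℕ) → ℕ, ∀ e n, D e ≤ n → ∀ f : Alg E O, f ∈ Fil w n → coeff e f = 0 := by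
  obtain ⟨D, hD⟩ := exists_FilLam_eq_bot (O := O) (w ∘ Sum.inr)
  exact ⟨fun e => D + Finsupp.weight (w ∘ Sum.inl) e, fun e n hn f hf =>
    hD _ (FilLam_anti _ (by dsimp only at hn; omega) (hf e))⟩

theorem eq_zero_of_forall_mem_Fil (w : E ⊕ O → ℕ) {f : Alg E O} (hf : ∀ n, f ∈ Fil w n) :
    f = 0 := by
  obtain ⟨D, hD⟩ := exists_coeff_eq_zero_of_mem_Fil w
  ext1 e
  exact hD e _ le_rfl f (hf _)

end Alg

/-! ### Smooth families and scalar operators acting on coefficients. -/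

section Smooth
variable {E O : Type} {X : Type} [NormedAddCommGroup X] [NormedSpace ℝ X]

/-- Smoothness on `U` of a Grassmann algebra valued function. -/
def SmL (F : X → Lam O) (U : Set X) : Prop :=
  ∀ l : Module.Dual ℝ (Lam O), ContDiffOn ℝ ∞ (fun x => l (F x)) U

/-- Smoothness on `U` of a power series valued function: all coefficients are smooth. -/
def Sm (F : X → Alg E O) (U : Set X) : Prop :=
  ∀ (e : E →₀ ℕ) (l : Module.Dual ℝ (Lam O)), ContDiffOn ℝ ∞ (fun x => l (coeff e (F x))) U

variable {U : Set X}

theorem Sm.coeff {F : X → Alg E O} (hF : Sm F U) (e : E →₀ ℕ) : SmL (fun x => coeff e (F x)) U :=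
  fun l => hF e l

theorem SmL.congr {F G : X → Lam O} (hF : SmL F U) (h : ∀ x ∈ U, G x = F x) : SmL G U :=
  fun l => (hF l).congr fun x hx => by rw [h x hx]

theorem Sm.congr {F G : X → Alg E O} (hF : Sm F U) (h : ∀ x ∈ U, G x = F x) : Sm G U :=
  fun e l => (hF e l).congr fun x hx => by rw [h x hx]

theorem Sm.const (c : Alg E O) : Sm (fun _ : X => c) U := fun _ _ => contDiffOn_const

theorem Sm.add {F G : X → Alg E O} (hF : Sm F U) (hG : Sm G U) : Sm (fun x => F x + G x) U :=
  fun e l => ((hF e l).add (hG e l)).congr fun x _ => by simp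

theorem SmL.sum {κ : Type*} (s : Finset κ) {F : κ → X → Lam O} (hF : ∀ i ∈ s, SmL (F i) U) :
    SmL (fun x => ∑ i ∈ s, F i x) U :=
  fun l => (ContDiffOn.sum fun i hi => hF i hi l).congr fun x _ => by simp

theorem Sm.sum {κ : Type*} (s : Finset κ) {F : κ → X → Alg E O} (hF : ∀ i ∈ s, Sm (F i) U) :
    Sm (fun x => ∑ i ∈ s, F i x) U :=
  fun e l => (ContDiffOn.sum fun i hi => hF i hi e l).congr fun x _ => by simp

theorem Sm.smul {c : X → ℝ} {F : X → Alg E O} (hc : ContDiffOn ℝ ∞ c U) (hF : Sm F U) :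
    Sm (fun x => c x • F x) U :=
  fun e l => (hc.mul (hF e l)).congr fun x _ => by simp

theorem Sm.sub {F G : X → Alg E O} (hF : Sm F U) (hG : Sm G U) : Sm (fun x => F x - G x) U :=
  fun e l => ((hF e l).sub (hG e l)).congr fun x _ => by simp

/-- The operators each of whose coefficients is a linear function of one coefficient. -/
def IsCL (L : Alg E O →ₗ[ℝ] Alg E O) : Prop := ∃ s l, L = coeffLin s l

theorem Sm.linear {F : X → Alg E O} (hF : Sm F U) {L : Alg E O →ₗ[ℝ] Alg E O} (hL : IsCL L) :
    Sm (fun x => L (F x)) U := by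
  obtain ⟨s, l, rfl⟩ := hL
  exact fun e m => hF (s e) (m.comp (l e))

theorem isCL_lmv (v : E ⊕ O) : IsCL (lmv v) := by cases v <;> exact ⟨_, _, rfl⟩

theorem isCL_dv (v : E ⊕ O) : IsCL (dv v) := by cases v <;> exact ⟨_, _, rfl⟩

variable [Fintype O]

theorem isCL_diag (a : Mo E O → ℝ) : IsCL (diag a) := ⟨_, _, rfl⟩

theorem SmL.mul {F G : X → Lam O} (hF : SmL F U) (hG : SmL G U) : SmL (fun x => F x * G x) U := by
  intro l
  set b := Module.finBasis ℝ (Lam O)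
  have h : ∀ x, l (F x * G x) = ∑ i, ∑ j, b.coord i (F x) * b.coord j (G x) * l (b i * b j) := by
    intro x
    conv_lhs => rw [← b.sum_repr (F x), ← b.sum_repr (G x)]
    simp only [Finset.sum_mul, Finset.mul_sum, map_sum, smul_mul_assoc, mul_smul_comm, map_smul,
      smul_eq_mul, Module.Basis.coord_apply]
    rw [Finset.sum_comm]
    refine Finset.sum_congr rfl fun i _ => Finset.sum_congr rfl fun j _ => ?_
    ring
  refine ContDiffOn.congr ?_ fun x _ => h x
  exact ContDiffOn.sum fun i _ => ContDiffOn.sum fun j _ =>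
    ((hF _).mul (hG _)).mul contDiffOn_const

theorem Sm.mul {F G : X → Alg E O} (hF : Sm F U) (hG : Sm G U) : Sm (fun x => F x * G x) U := by
  intro e
  refine SmL.congr ?_ fun x _ => MvPowerSeries.coeff_mul e (F x) (G x)
  exact SmL.sum _ fun p _ => (hF.coeff p.1).mul (hG.coeff p.2)

omit [NormedAddCommGroup X] [NormedSpace ℝ X] in
theorem Lam.ext_dual {x y : Lam O} (h : ∀ l : Module.Dual ℝ (Lam O), l x = l y) : x = y := by
  rw [← sub_eq_zero, ← Module.forall_dual_apply_eq_zero_iff ℝ]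
  intro l
  rw [map_sub, h, sub_self]

theorem Alg.ext_dual {f g : Alg E O}
    (h : ∀ e (l : Module.Dual ℝ (Lam O)), l (MvPowerSeries.coeff e f) = l (MvPowerSeries.coeff e g)) :
    f = g := by
  ext1 e
  exact Lam.ext_dual (h e)

/-- Linear operators on smooth functions on `B`. -/
structure IsOp (T : (X → ℝ) → X → ℝ) (B : Set X) : Prop where
  smooth : ∀ f, ContDiffOn ℝ ∞ f B → ContDiffOn ℝ ∞ (T f) B
  congr : ∀ f g, (∀ x ∈ B, f x = g x) → ∀ x ∈ B, T f x = T g x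
  add : ∀ f g, ContDiffOn ℝ ∞ f B → ContDiffOn ℝ ∞ g B →
    ∀ x ∈ B, T (fun y => f y + g y) x = T f x + T g x
  smul : ∀ (r : ℝ) f, ContDiffOn ℝ ∞ f B → ∀ x ∈ B, T (fun y => r * f y) x = r * T f x

theorem IsOp.sum {T : (X → ℝ) → X → ℝ} {B : Set X} (hT : IsOp T B) {κ : Type*} (s : Finset κ)
    (r : κ → ℝ) (f : κ → X → ℝ) (hf : ∀ i ∈ s, ContDiffOn ℝ ∞ (f i) B) (x : X) (hx : x ∈ B) :
    T (fun y => ∑ i ∈ s, f i y * r i) x = ∑ i ∈ s, T (f i) x * r i := by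
  induction s using Finset.induction_on with
  -- That `T` kills the zero function follows from homogeneity with scalar 0.
  | empty => simpa using hT.smul 0 (fun _ => 0) contDiffOn_const x hx
  | insert i s hi ih =>
    simp only [Finset.sum_insert hi]
    have h1 := hf i (Finset.mem_insert_self _ _)
    have h2 : ∀ j ∈ s, ContDiffOn ℝ ∞ (f j) B := fun j hj => hf j (Finset.mem_insert_of_mem hj)
    rw [hT.add _ _ (h1.mul contDiffOn_const)
      (ContDiffOn.sum fun j hj => (h2 j hj).mul contDiffOn_const) x hx, ih h2]
    congr 1
    simpa only [mul_comm] using hT.smul (r i) _ h1 x hx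

/-- The extension of a scalar operator to power series valued functions. -/
def lift (T : (X → ℝ) → X → ℝ) (F : X → Alg E O) (x : X) : Alg E O := fun e =>
  ∑ j, T (fun y => (Module.finBasis ℝ (Lam O)).coord j (coeff e (F y))) x •
    Module.finBasis ℝ (Lam O) j

omit [NormedAddCommGroup X] [NormedSpace ℝ X] in
theorem coeff_lift (T : (X → ℝ) → X → ℝ) (F : X → Alg E O) (x : X) (e : E →₀ ℕ) :
    coeff e (lift T F x) = ∑ j, T (fun y => (Module.finBasis ℝ (Lam O)).coord j (coeff e (F y))) x •
      Module.finBasis ℝ (Lam O) j := rfl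

variable {T : (X → ℝ) → X → ℝ} {B : Set X}

/-- Linearity of `T` removes the dependence on the basis used in `lift`. Identities for lifted
operators are then tested against functionals, where they become scalar statements. -/
theorem dual_lift (hT : IsOp T B) {F : X → Alg E O} (hF : Sm F B) {x : X} (hx : x ∈ B)
    (e : E →₀ ℕ) (l : Module.Dual ℝ (Lam O)) :
    l (coeff e (lift T F x)) = T (fun y => l (coeff e (F y))) x := by
  set b := Module.finBasis ℝ (Lam O)
  have h : (fun y => l (coeff e (F y))) = fun y => ∑ j, b.coord j (coeff e (F y)) * l (b j) := by
    funext y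
    conv_lhs => rw [← b.sum_repr (coeff e (F y))]
    simp only [map_sum, map_smul, smul_eq_mul, Module.Basis.coord_apply]
  rw [h, hT.sum _ _ _ (fun i _ => hF e _) x hx]
  rw [coeff_lift, map_sum]
  exact Finset.sum_congr rfl fun j _ => by rw [map_smul, smul_eq_mul]

theorem Sm.lift (hT : IsOp T B) {F : X → Alg E O} (hF : Sm F B) : Sm (lift T F) B :=
  fun e l => (hT.smooth _ (hF e l)).congr fun _ hx => dual_lift hT hF hx e l

theorem lift_congr (hT : IsOp T B) {F G : X → Alg E O} (h : ∀ x ∈ B, F x = G x) {x : X}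
    (hx : x ∈ B) : SuperAlg.lift T F x = SuperAlg.lift T G x := by
  unfold SuperAlg.lift
  funext e
  exact Finset.sum_congr rfl fun j _ => by rw [hT.congr _ _ (fun y hy => by rw [h y hy]) x hx]

theorem lift_linear (hT : IsOp T B) {F : X → Alg E O} (hF : Sm F B) {L : Alg E O →ₗ[ℝ] Alg E O}
    (hL : IsCL L) {x : X} (hx : x ∈ B) :
    SuperAlg.lift T (fun y => L (F y)) x = L (SuperAlg.lift T F x) := by
  refine Alg.ext_dual fun e l => ?_
  rw [dual_lift hT (hF.linear hL) hx]
  obtain ⟨s, m, rfl⟩ := hL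
  exact (dual_lift hT hF hx (s e) (l.comp (m e))).symm

theorem lift_add (hT : IsOp T B) {F G : X → Alg E O} (hF : Sm F B) (hG : Sm G B) {x : X}
    (hx : x ∈ B) : SuperAlg.lift T (fun y => F y + G y) x
      = SuperAlg.lift T F x + SuperAlg.lift T G x := by
  refine Alg.ext_dual fun e l => ?_
  rw [dual_lift hT (hF.add hG) hx, map_add, map_add, dual_lift hT hF hx, dual_lift hT hG hx,
    ← hT.add _ _ (hF e l) (hG e l) x hx]
  simp

theorem lift_sum (hT : IsOp T B) {κ : Type*} (s : Finset κ) {F : κ → X → Alg E O}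
    (hF : ∀ i ∈ s, Sm (F i) B) {x : X} (hx : x ∈ B) :
    SuperAlg.lift T (fun y => ∑ i ∈ s, F i y) x = ∑ i ∈ s, SuperAlg.lift T (F i) x := by
  induction s using Finset.induction_on with
  | empty =>
    refine Alg.ext_dual fun e l => ?_
    simp only [Finset.sum_empty]
    rw [dual_lift hT (Sm.const 0) hx]
    simpa using hT.smul 0 (fun _ => 0) contDiffOn_const x hx
  | insert i s hi ih =>
    simp only [Finset.sum_insert hi]
    rw [lift_add hT (hF i (Finset.mem_insert_self _ _))
      (Sm.sum s fun j hj => hF j (Finset.mem_insert_of_mem hj)) hx,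
      ih fun j hj => hF j (Finset.mem_insert_of_mem hj)]

end Smooth

/-! ### Weighted averages along partial rescalings. -/

section Scaling
variable {ι : Type} [Fintype ι]

/-- The rescaling of the coordinates in `Y`. -/
def sc (Y : ι → Prop) (s : ℝ) : (ι → ℝ) →L[ℝ] (ι → ℝ) :=
  ContinuousLinearMap.pi fun i => (if Y i then s else 1) • ContinuousLinearMap.proj i

omit [Fintype ι] in
theorem sc_apply (Y : ι → Prop) (s : ℝ) (x : ι → ℝ) (i : ι) :
    sc Y s x i = if Y i then s * x i else x i := by
  simp only [sc, ContinuousLinearMap.pi_apply, smul_apply,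
    ContinuousLinearMap.proj_apply]
  split_ifs <;> simp

/-- The projection to the coordinates in `Y`. -/
def projY (Y : ι → Prop) : (ι → ℝ) →L[ℝ] (ι → ℝ) :=
  ContinuousLinearMap.pi fun i => (if Y i then (1 : ℝ) else 0) • ContinuousLinearMap.proj i

omit [Fintype ι] in
theorem projY_apply (Y : ι → Prop) (x : ι → ℝ) (i : ι) :
    projY Y x i = if Y i then x i else 0 := by
  simp only [projY, ContinuousLinearMap.pi_apply, smul_apply,
    ContinuousLinearMap.proj_apply]
  split_ifs <;> simp

omit [Fintype ι] in
-- The rescaling is affine in `s`, which is why the derivative of an average is built from averages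
-- again, with exponents `k` and `k + 1`.
theorem sc_eq (Y : ι → Prop) (s : ℝ) : sc Y s = sc Y 0 + s • projY Y := by
  ext x i
  simp only [add_apply, smul_apply, Pi.add_apply,
    Pi.smul_apply, sc_apply, projY_apply]
  split_ifs <;> simp

omit [Fintype ι] in
theorem sc_one (Y : ι → Prop) (x : ι → ℝ) : sc Y 1 x = x := by
  funext i; simp [sc_apply]

theorem continuous_sc (Y : ι → Prop) : Continuous fun p : (ι → ℝ) × ℝ => sc Y p.2 p.1 := by
  have : (fun p : (ι → ℝ) × ℝ => sc Y p.2 p.1) = fun p => sc Y 0 p.1 + p.2 • projY Y p.1 := by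
    funext p; rw [sc_eq Y p.2]; rfl
  rw [this]
  fun_prop

/-- A set that is closed under shrinking the coordinates in `Y`. -/
def Star (Y : ι → Prop) (B : Set (ι → ℝ)) : Prop :=
  ∀ x ∈ B, ∀ s ∈ Set.Icc (0 : ℝ) 1, sc Y s x ∈ B

variable {G : Type} [NormedAddCommGroup G] [NormedSpace ℝ G]

/-- The weighted average along the rescaling. -/
def avg (Y : ι → Prop) (k : ℕ) (f : (ι → ℝ) → G) (x : ι → ℝ) : G :=
  ∫ s in (0 : ℝ)..1, s ^ k • f (sc Y s x)

variable {Y : ι → Prop} {B : Set (ι → ℝ)}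

theorem continuousOn_avg_integrand (hB : Star Y B) (k : ℕ) {f : (ι → ℝ) → G}
    (hf : ContinuousOn f B) {x : ι → ℝ} (hx : x ∈ B) :
    ContinuousOn (fun s : ℝ => s ^ k • f (sc Y s x)) (Set.Icc 0 1) := by
  refine ContinuousOn.smul (by fun_prop) (hf.comp ?_ fun s hs => hB x hx s hs)
  exact ((continuous_sc Y).comp (by fun_prop : Continuous fun s : ℝ => (x, s))).continuousOn

theorem intervalIntegrable_avg (hB : Star Y B) (k : ℕ) {f : (ι → ℝ) → G}
    (hf : ContinuousOn f B) {x : ι → ℝ} (hx : x ∈ B) :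
    IntervalIntegrable (fun s : ℝ => s ^ k • f (sc Y s x)) MeasureTheory.volume 0 1 :=
  ContinuousOn.intervalIntegrable
    (by rw [Set.uIcc_of_le zero_le_one]; exact continuousOn_avg_integrand hB k hf hx)

theorem hasFDerivAt_avg [CompleteSpace G] (hBo : IsOpen B) (hB : Star Y B) (k : ℕ)
    {f : (ι → ℝ) → G} (hf : ContDiffOn ℝ 1 f B) {x : ι → ℝ} (hx : x ∈ B) :
    HasFDerivAt (avg Y k f) ((avg Y k (fderiv ℝ f) x).comp (sc Y 0) +
      (avg Y (k + 1) (fderiv ℝ f) x).comp (projY Y)) x := by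
  have hf' : ContinuousOn (fderiv ℝ f) B := hf.continuousOn_fderiv_of_isOpen hBo le_rfl
  have hfd : ∀ y ∈ B, HasFDerivAt f (fderiv ℝ f y) y := fun y hy =>
    ((hf.differentiableOn one_ne_zero).differentiableAt (hBo.mem_nhds hy)).hasFDerivAt
  obtain ⟨ε, hε, hball⟩ := Metric.nhds_basis_closedBall.mem_iff.mp (hBo.mem_nhds hx)
  have hK : IsCompact (Metric.closedBall x ε ×ˢ Set.Icc (0 : ℝ) 1) :=
    (isCompact_closedBall x ε).prod isCompact_Icc
  have hcont : ContinuousOn (fun p : (ι → ℝ) × ℝ =>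
      (p.2 ^ k • fderiv ℝ f (sc Y p.2 p.1)).comp (sc Y p.2))
      (Metric.closedBall x ε ×ˢ Set.Icc (0 : ℝ) 1) := by
    have hc : ContinuousOn (fun p : (ι → ℝ) × ℝ => fderiv ℝ f (sc Y p.2 p.1))
        (Metric.closedBall x ε ×ˢ Set.Icc (0 : ℝ) 1) :=
      hf'.comp (continuous_sc Y).continuousOn fun p hp => hB _ (hball hp.1) _ hp.2
    have hp : ContinuousOn (fun p : (ι → ℝ) × ℝ => p.2 ^ k)
        (Metric.closedBall x ε ×ˢ Set.Icc (0 : ℝ) 1) := by fun_prop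
    refine (hp.smul hc).clm_comp ?_
    have : (fun p : (ι → ℝ) × ℝ => sc Y p.2) = fun p => sc Y 0 + p.2 • projY Y := by
      funext p; rw [sc_eq Y p.2]
    rw [this]
    fun_prop
  -- Compactness of a closed ball times the unit interval supplies the constant dominating function
  -- for differentiation under the integral.
  obtain ⟨C, hC⟩ := hK.exists_bound_of_continuousOn hcont
  have key := intervalIntegral.hasFDerivAt_integral_of_dominated_of_fderiv_le (𝕜 := ℝ)
    (μ := MeasureTheory.volume) (a := 0) (b := 1)
    (F := fun y (s : ℝ) => s ^ k • f (sc Y s y))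
    (F' := fun y s => (s ^ k • fderiv ℝ f (sc Y s y)).comp (sc Y s)) (x₀ := x)
    (s := Metric.closedBall x ε) (bound := fun _ => C)
    (Metric.closedBall_mem_nhds x hε) ?_ (intervalIntegrable_avg hB k hf.continuousOn hx)
    ?_ ?_ (by simp) ?_
  · refine key.congr_fderiv ?_
    have h1 := intervalIntegrable_avg hB k hf' hx
    have h2 := intervalIntegrable_avg hB (k + 1) hf' hx
    have e : ∀ s : ℝ, (s ^ k • fderiv ℝ f (sc Y s x)).comp (sc Y s)
        = (s ^ k • fderiv ℝ f (sc Y s x)).comp (sc Y 0)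
          + (s ^ (k + 1) • fderiv ℝ f (sc Y s x)).comp (projY Y) := by
      intro s
      ext v
      have hv : sc Y s v = sc Y 0 v + s • projY Y v := by rw [sc_eq Y s]; rfl
      simp [pow_succ, mul_smul, hv]
    simp only [e]
    rw [intervalIntegral.integral_add]
    · have := ((ContinuousLinearMap.compL ℝ (ι → ℝ) (ι → ℝ) G).flip
        (sc Y 0)).intervalIntegral_comp_comm h1
      have h3 := ((ContinuousLinearMap.compL ℝ (ι → ℝ) (ι → ℝ) G).flip
        (projY Y)).intervalIntegral_comp_comm h2
      simp only [ContinuousLinearMap.flip_apply, ContinuousLinearMap.compL_apply] at this h3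
      rw [this, h3]
      rfl
    · exact ((ContinuousLinearMap.compL ℝ (ι → ℝ) (ι → ℝ) G).flip (sc Y 0)).integrable_comp h1.1
        |> fun h => ⟨h, by simp⟩
    · exact ((ContinuousLinearMap.compL ℝ (ι → ℝ) (ι → ℝ) G).flip (projY Y)).integrable_comp h2.1
        |> fun h => ⟨h, by simp⟩
  · filter_upwards [hBo.mem_nhds hx] with y hy
    exact (intervalIntegrable_avg hB k hf.continuousOn hy).def'.aestronglyMeasurable
  · refine ContinuousOn.aestronglyMeasurable ?_ measurableSet_uIoc
    rw [Set.uIoc_of_le zero_le_one]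
    exact hcont.comp (f := fun s : ℝ => (x, s)) (by fun_prop) fun s hs =>
      ⟨Metric.mem_closedBall_self hε.le, Set.Ioc_subset_Icc_self hs⟩
  · refine Filter.Eventually.of_forall fun s hs y hy => hC (y, s) ⟨hy, ?_⟩
    rw [Set.uIoc_of_le zero_le_one] at hs
    exact Set.Ioc_subset_Icc_self hs
  · refine Filter.Eventually.of_forall fun s hs y hy => ?_
    rw [Set.uIoc_of_le zero_le_one] at hs
    exact ((hfd _ (hB y (hball hy) s (Set.Ioc_subset_Icc_self hs))).comp y
      (sc Y s).hasFDerivAt).const_smul (s ^ k)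

/-- The derivative of an average is made of averages of a function with another target and another
exponent, so the induction runs over all targets and exponents. One order of smoothness is lost,
which is harmless at order ∞. -/
theorem contDiffOn_avg_nat (hBo : IsOpen B) (hB : Star Y B) (n : ℕ) :
    ∀ (G : Type) [NormedAddCommGroup G] [NormedSpace ℝ G] [CompleteSpace G] (k : ℕ)
      (f : (ι → ℝ) → G), ContDiffOn ℝ (n + 1) f B → ContDiffOn ℝ n (avg Y k f) B := by
  induction n with
  | zero =>
    intro G _ _ _ k f hf
    refine contDiffOn_zero.mpr fun x hx => ?_
    exact (hasFDerivAt_avg hBo hB k (by simpa using hf) hx).continuousAt.continuousWithinAt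
  | succ n ih =>
    intro G _ _ _ k f hf
    have hf1 : ContDiffOn ℝ 1 f B := hf.of_le (by norm_cast; omega)
    push_cast
    rw [contDiffOn_succ_iff_fderiv_of_isOpen hBo]
    refine ⟨fun x hx => (hasFDerivAt_avg hBo hB k hf1 hx).differentiableAt.differentiableWithinAt,
      fun h => absurd h (by simp), ?_⟩
    refine ContDiffOn.congr ?_ fun x hx => (hasFDerivAt_avg hBo hB k hf1 hx).fderiv
    have h' : ContDiffOn ℝ (n + 1) (fderiv ℝ f) B := by
      push_cast at hf
      exact ((contDiffOn_succ_iff_fderiv_of_isOpen hBo).mp hf).2.2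
    exact ((ih _ k _ h').clm_comp contDiffOn_const).add
      ((ih _ (k + 1) _ h').clm_comp contDiffOn_const)

theorem contDiffOn_avg (hBo : IsOpen B) (hB : Star Y B) (k : ℕ) {f : (ι → ℝ) → ℝ}
    (hf : ContDiffOn ℝ ∞ f B) : ContDiffOn ℝ ∞ (avg Y k f) B := by
  rw [contDiffOn_infty] at hf ⊢
  exact fun n => contDiffOn_avg_nat hBo hB n ℝ k f (by exact_mod_cast hf (n + 1))

/-- The partial derivative of a scalar function. -/
def pd (i : ι) (f : (ι → ℝ) → ℝ) (x : ι → ℝ) : ℝ := fderiv ℝ f x (Pi.single i 1)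

theorem isOp_avg (hBo : IsOpen B) (hB : Star Y B) (k : ℕ) : IsOp (avg Y k (G := ℝ)) B where
  smooth f hf := contDiffOn_avg hBo hB k hf
  congr f g h x hx := by
    refine intervalIntegral.integral_congr fun s hs => ?_
    rw [Set.uIcc_of_le zero_le_one] at hs
    simp only [h _ (hB x hx s hs)]
  add f g hf hg x hx := by
    simp only [avg, smul_add]
    exact intervalIntegral.integral_add (intervalIntegrable_avg hB k hf.continuousOn hx)
      (intervalIntegrable_avg hB k hg.continuousOn hx)
  smul r f hf x hx := by
    simp only [avg, smul_eq_mul]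
    rw [← intervalIntegral.integral_const_mul]
    congr 1
    funext s
    ring

theorem isOp_pd (hBo : IsOpen B) (i : ι) : IsOp (pd i) B where
  smooth f hf := ((contDiffOn_infty_iff_fderiv_of_isOpen hBo).mp hf).2.clm_apply contDiffOn_const
  congr f g h x hx := by
    have : f =ᶠ[𝓝 x] g := Filter.eventuallyEq_of_mem (hBo.mem_nhds hx) h
    rw [pd, this.fderiv_eq, pd]
  add f g hf hg x hx := by
    have hf' := (hf.contDiffAt (hBo.mem_nhds hx)).differentiableAt (by simp)
    have hg' := (hg.contDiffAt (hBo.mem_nhds hx)).differentiableAt (by simp)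
    simp only [pd]
    rw [fderiv_fun_add hf' hg']
    rfl
  smul r f hf x hx := by
    have hf' := (hf.contDiffAt (hBo.mem_nhds hx)).differentiableAt (by simp)
    simp only [pd]
    rw [fderiv_const_mul hf']
    rfl

theorem pd_mul (hBo : IsOpen B) (i : ι) {f g : (ι → ℝ) → ℝ} (hf : ContDiffOn ℝ ∞ f B)
    (hg : ContDiffOn ℝ ∞ g B) {x : ι → ℝ} (hx : x ∈ B) :
    pd i (fun y => f y * g y) x = pd i f x * g x + f x * pd i g x := by
  have hf' := (hf.contDiffAt (hBo.mem_nhds hx)).differentiableAt (by simp)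
  have hg' := (hg.contDiffAt (hBo.mem_nhds hx)).differentiableAt (by simp)
  simp only [pd]
  rw [fderiv_fun_mul hf' hg']
  simp
  ring

omit [Fintype ι] in
theorem pd_coord (i j : ι) (x : ι → ℝ) :
    pd i (fun y : ι → ℝ => y j) x = if i = j then 1 else 0 := by
  have : (fun y : ι → ℝ => y j) = (ContinuousLinearMap.proj (R := ℝ) (φ := fun _ : ι => ℝ) j) := rfl
  rw [pd, this, ContinuousLinearMap.fderiv]
  simp [Pi.single_apply, eq_comm]

omit [Fintype ι] in
-- A scaled coordinate carries a factor `s`, which accounts for the change of exponent.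
theorem coord_mul_avg (k : ℕ) {j : ι} (hj : Y j) (f : (ι → ℝ) → ℝ) (x : ι → ℝ) :
    x j * avg Y (k + 1) f x = avg Y k (fun y => y j * f y) x := by
  simp only [avg, smul_eq_mul]
  rw [← intervalIntegral.integral_const_mul]
  congr 1
  funext s
  rw [sc_apply, if_pos hj]
  ring

/-- The integrand is the derivative of s^(k+1) f(sc s x), whose boundary values are f(x) and 0. Thus
`avg Y k` inverts `k + 1` plus the Euler field of the coordinates in `Y`; the positive shift avoids
any condition at the origin. -/
theorem avg_euler (hBo : IsOpen B) (hB : Star Y B) (k : ℕ) {f : (ι → ℝ) → ℝ}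
    (hf : ContDiffOn ℝ ∞ f B) {x : ι → ℝ} (hx : x ∈ B) :
    avg Y k (fun y => ((k + 1 : ℕ) : ℝ) * f y + ∑ i, (if Y i then y i else 0) * pd i f y) x = f x := by
  have hd : ∀ s ∈ Set.uIcc (0 : ℝ) 1, HasDerivAt (fun s : ℝ => s ^ (k + 1) * f (sc Y s x))
      (s ^ k • (((k + 1 : ℕ) : ℝ) * f (sc Y s x)
        + ∑ i, (if Y i then (sc Y s x) i else 0) * pd i f (sc Y s x))) s := by
    intro s hs
    rw [Set.uIcc_of_le zero_le_one] at hs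
    have h1 := ((hf.contDiffAt (hBo.mem_nhds (hB x hx s hs))).differentiableAt (by simp)).hasFDerivAt
    have h2 : HasDerivAt (fun s : ℝ => sc Y s x) (projY Y x) s := by
      have : (fun s : ℝ => sc Y s x) = fun s => sc Y 0 x + s • projY Y x := by
        funext s; rw [sc_eq Y s]; rfl
      rw [this]
      simpa using ((hasDerivAt_id s).smul_const (projY Y x)).const_add (sc Y 0 x)
    have h3 := (hasDerivAt_pow (k + 1) s).mul (h1.comp_hasDerivAt s h2)
    refine h3.congr_deriv ?_
    have h4 : fderiv ℝ f (sc Y s x) (projY Y x)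
        = ∑ i, (if Y i then x i else 0) * pd i f (sc Y s x) := by
      conv_lhs => rw [pi_eq_sum_univ' (projY Y x)]
      rw [map_sum]
      refine Finset.sum_congr rfl fun i _ => ?_
      rw [map_smul, projY_apply, smul_eq_mul]
      rfl
    have h5 : ∑ i, (if Y i then (sc Y s x) i else 0) * pd i f (sc Y s x)
        = s * ∑ i, (if Y i then x i else 0) * pd i f (sc Y s x) := by
      rw [Finset.mul_sum]
      refine Finset.sum_congr rfl fun i _ => ?_
      rw [sc_apply]
      split_ifs <;> ring
    rw [h4, h5, smul_eq_mul, Nat.add_sub_cancel, Function.comp]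
    ring
  unfold avg
  rw [intervalIntegral.integral_eq_sub_of_hasDerivAt hd]
  · simp [sc_one]
  · refine intervalIntegrable_avg hB k (f := fun y => ((k + 1 : ℕ) : ℝ) * f y
      + ∑ i, (if Y i then y i else 0) * pd i f y) ?_ hx
    refine (continuousOn_const.mul hf.continuousOn).add
      (continuousOn_finsetSum _ fun i _ => ?_)
    refine ContinuousOn.mul ?_ ((isOp_pd hBo i).smooth f hf).continuousOn
    split_ifs <;> fun_prop

end Scaling

theorem sum_comm_four {α β M : Type*} [Fintype α] [Fintype β] [AddCommMonoid M]
    (f : α → α → β → β → M) :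
    ∑ a, ∑ b, ∑ c, ∑ d, f a b c d = ∑ c, ∑ d, ∑ a, ∑ b, f a b c d := by
  calc ∑ a, ∑ b, ∑ c, ∑ d, f a b c d = ∑ p : α × α, ∑ q : β × β, f p.1 p.2 q.1 q.2 := by
        simp only [Fintype.sum_prod_type]
    _ = ∑ q : β × β, ∑ p : α × α, f p.1 p.2 q.1 q.2 := Finset.sum_comm
    _ = _ := by simp only [Fintype.sum_prod_type]

theorem Opp.symm {E O : Type} {u w : E ⊕ O} (h : Opp u w) : Opp w u := Ne.symm h

/-! ### First order operators with linear or general coefficients. -/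

section Ops
variable {E O : Type}

/-- Both operators are odd, and the only possible contraction, that of `k` with `w`, is excluded. -/
theorem dv_lmv_dv_anticomm {k : O} {w u : E ⊕ O} (h : Opp w u) (hk : Sum.inr k ≠ w)
    (f : Alg E O) :
    dv (Sum.inr k) (lmv w (dv u f)) + lmv w (dv u (dv (Sum.inr k) f)) = 0 := by
  rw [dv_lmv, if_neg hk, zero_add, dv_dv, map_smul, smul_smul]
  have : sg (Sum.inr k) w * sg (Sum.inr k) u = (-1 : ℝ) := by
    unfold Opp at h
    rcases u with u | u <;> rcases w with w | w <;> simp_all [sg]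
  rw [this, neg_one_smul, neg_add_cancel]

variable [Fintype E] [Fintype O]

/-- The first order operator with linear coefficients given by a matrix. -/
def qop (c : Matrix (E ⊕ O) (E ⊕ O) ℝ) : Alg E O →ₗ[ℝ] Alg E O :=
  ∑ u, ∑ w, c u w • (lmv u).comp (dv w)

theorem qop_apply (c : Matrix (E ⊕ O) (E ⊕ O) ℝ) (f : Alg E O) :
    qop c f = ∑ u, ∑ w, c u w • lmv u (dv w f) := by
  simp [qop, LinearMap.sum_apply]

/-- Odd linear vector fields anticommute to the vector field of the matrix anticommutator. A partial
inverse of `c` therefore produces a counting operator. -/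
theorem qop_anticomm {c g : Matrix (E ⊕ O) (E ⊕ O) ℝ} (hc : ∀ u w, c u w ≠ 0 → Opp u w)
    (hg : ∀ u w, g u w ≠ 0 → Opp u w) (f : Alg E O) :
    qop c (qop g f) + qop g (qop c f) = qop (c * g + g * c) f := by
  have h1 : ∀ u w u' w', (c u w * g w' u') • lmv u (dv w (lmv w' (dv u' f)))
      + (c u w * g w' u') • lmv w' (dv u' (lmv u (dv w f)))
      = (if w = w' then (c u w * g w' u') • lmv u (dv u' f) else 0)
        + (if u' = u then (c u w * g w' u') • lmv w' (dv w f) else 0) := by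
    intro u w u' w'
    rw [← smul_add]
    by_cases h : c u w = 0
    · simp [h]
    by_cases h' : g w' u' = 0
    · simp [h']
    rw [anticomm_lmv_dv (hc _ _ h) (hg _ _ h').symm, smul_add]
    split_ifs <;> simp
  have e1 : qop c (qop g f) = ∑ u, ∑ w, ∑ w', ∑ u',
      (c u w * g w' u') • lmv u (dv w (lmv w' (dv u' f))) := by
    rw [qop_apply c]
    simp only [qop_apply g, map_sum, map_smul]
    simp only [Finset.smul_sum, smul_smul]
  have e2 : qop g (qop c f) = ∑ u, ∑ w, ∑ w', ∑ u',
      (c u w * g w' u') • lmv w' (dv u' (lmv u (dv w f))) := by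
    rw [qop_apply g]
    simp only [qop_apply c, map_sum, map_smul]
    simp only [Finset.smul_sum, smul_smul]
    rw [sum_comm_four]
    simp only [mul_comm]
  rw [e1, e2]
  simp only [← Finset.sum_add_distrib, h1]
  simp only [Finset.sum_add_distrib]
  rw [qop_apply]
  simp only [Matrix.add_apply, Matrix.mul_apply, add_smul, Finset.sum_add_distrib, Finset.sum_smul]
  congr 1
  · refine Finset.sum_congr rfl fun u _ => ?_
    rw [Finset.sum_comm]
    conv_rhs => rw [Finset.sum_comm]
    rw [Finset.sum_comm]
    refine Finset.sum_congr rfl fun w _ => ?_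
    rw [Finset.sum_eq_single w]
    · simp
    · intro b _ hb; simp [Ne.symm hb]
    · simp
  · rw [Finset.sum_comm]
    conv_rhs => rw [Finset.sum_comm]
    refine Finset.sum_congr rfl fun w _ => ?_
    rw [Finset.sum_comm]
    refine Finset.sum_congr rfl fun w' _ => Finset.sum_congr rfl fun u _ => ?_
    rw [Finset.sum_eq_single u]
    · simp [mul_comm]
    · intro b _ hb; simp [hb]
    · simp

theorem qop_diagonal (w : E ⊕ O → ℕ) (f : Alg E O) :
    qop (Matrix.diagonal fun v => (w v : ℝ)) f = diag (fun μ => (wt w μ : ℝ)) f := by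
  rw [← sum_lmv_dv, qop_apply]
  refine Finset.sum_congr rfl fun u _ => ?_
  rw [Finset.sum_eq_single u]
  · simp
  · intro b _ hb; simp [Matrix.diagonal_apply_ne' _ hb]
  · simp

/-- The operator `∑ V_v ∂/∂v`. -/
def kt (V : E ⊕ O → Alg E O) : Alg E O →ₗ[ℝ] Alg E O where
  toFun f := ∑ v, V v * dv v f
  map_add' f g := by simp [mul_add, Finset.sum_add_distrib]
  map_smul' r f := by simp [Finset.smul_sum]

theorem kt_apply (V : E ⊕ O → Alg E O) (f : Alg E O) : kt V f = ∑ v, V v * dv v f := rfl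

theorem kt_mem_Fil {w : E ⊕ O → ℕ} {V : E ⊕ O → Alg E O} {r n : ℕ}
    (hV : ∀ v, V v ∈ Fil w (w v - r)) {f : Alg E O} (hf : f ∈ Fil w n) :
    kt V f ∈ Fil w (n - r) :=
  Submodule.sum_mem _ fun v _ => Fil_anti w (by omega) (mul_mem_Fil (hV v) (dv_mem_Fil v hf))

end Ops

/-! ### Normal form and contraction of the linear pairs. -/

/-- A nilpotent operator `∑ V_v ∂/∂v` on functions on `B` with values in power series, with a
leading part `∑ c_{uw} u ∂/∂w + ∑ x_i ∂/∂κ_i` that is contractible: the variables in `lin` are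
paired by the matrix `c` with partial inverse `g`, and the coordinates `x_i`, `i ∈ Y`, are paired
with odd variables `κ_i`. The remainder is of higher order for the weight `W`. -/
structure NormalForm (E O ι : Type) [Fintype E] [Fintype O] [Fintype ι] where
  Y : ι → Prop
  κ : ι → O
  B : Set (ι → ℝ)
  V : E ⊕ O → (ι → ℝ) → Alg E O
  c : (ι → ℝ) → Matrix (E ⊕ O) (E ⊕ O) ℝ
  g : (ι → ℝ) → Matrix (E ⊕ O) (E ⊕ O) ℝ
  lin : E ⊕ O → Prop
  W : E ⊕ O → ℕ
  afn : E ⊕ O → ℕ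
  isOpen_B : IsOpen B
  star_B : Star Y B
  smooth_V : ∀ v, Sm (V v) B
  smooth_c : ∀ u w, ContDiffOn ℝ ∞ (fun x => c x u w) B
  smooth_g : ∀ u w, ContDiffOn ℝ ∞ (fun x => g x u w) B
  sq_zero : ∀ x ∈ B, ∀ f, kt (fun v => V v x) (kt (fun v => V v x) f) = 0
  c_mul_g : ∀ x ∈ B, c x * g x + g x * c x =
    Matrix.diagonal fun v => (((if lin v then 1 else 0 : ℕ)) : ℝ)
  c_ne : ∀ x ∈ B, ∀ u w, c x u w ≠ 0 → Opp u w ∧ lin u ∧ lin w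
  g_ne : ∀ x ∈ B, ∀ w u, g x w u ≠ 0 →
    Opp w u ∧ lin w ∧ lin u ∧ W u + 2 ≤ W w ∧ afn u + 1 ≤ afn w
  κ_spec : ∀ i, Y i → ¬ lin (Sum.inr (κ i)) ∧ 2 ≤ W (Sum.inr (κ i)) ∧ 1 ≤ afn (Sum.inr (κ i))
  κ_inj : ∀ i j, Y i → Y j → κ i = κ j → i = j
  cover : ∀ v, afn v ≠ 0 → lin v ∨ ∃ i, Y i ∧ Sum.inr (κ i) = v
  lead : ∀ x ∈ B, ∀ v, V v x - (∑ u, c x u v • mv u) -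
    (∑ i, if Y i ∧ Sum.inr (κ i) = v then x i else 0) • (1 : Alg E O) ∈ Fil W (W v - 1)
  afn_V : ∀ x ∈ B, ∀ v, V v x ∈ Fil afn (afn v - 1)

namespace NormalForm
variable {E O ι : Type} [Fintype E] [Fintype O] [Fintype ι] (D : NormalForm E O ι)

/-- The weight that counts the variables in `lin`. -/
def n : E ⊕ O → ℕ := fun v => if D.lin v then 1 else 0

/-- The weight that counts the variables `κ_i`. -/
def kap : E ⊕ O → ℕ := fun v => if ∃ i, D.Y i ∧ Sum.inr (D.κ i) = v then 1 else 0

theorem n_lin {v : E ⊕ O} (h : D.lin v) : D.n v = 1 := if_pos h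

theorem n_κ {i : ι} (h : D.Y i) : D.n (Sum.inr (D.κ i)) = 0 := if_neg (D.κ_spec i h).1

theorem kap_κ {i : ι} (h : D.Y i) : D.kap (Sum.inr (D.κ i)) = 1 := if_pos ⟨i, h, rfl⟩

/-- The part of the leading operator that involves the coordinates. -/
def dy (x : ι → ℝ) : Alg E O →ₗ[ℝ] Alg E O :=
  ∑ i, (if D.Y i then x i else 0) • dv (Sum.inr (D.κ i))

theorem dy_apply (x : ι → ℝ) (f : Alg E O) :
    D.dy x f = ∑ i, (if D.Y i then x i else 0) • dv (Sum.inr (D.κ i)) f := by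
  simp only [dy, LinearMap.sum_apply, LinearMap.smul_apply]

/-- The subleading coefficients. -/
def V1 (x : ι → ℝ) (v : E ⊕ O) : Alg E O :=
  D.V v x - (∑ u, D.c x u v • mv u) -
    (∑ i, if D.Y i ∧ Sum.inr (D.κ i) = v then x i else 0) • (1 : Alg E O)

theorem kt_eq (x : ι → ℝ) (f : Alg E O) :
    kt (fun v => D.V v x) f = qop (D.c x) f + D.dy x f + kt (D.V1 x) f := by
  have h1 : qop (D.c x) f = ∑ v, (∑ u, D.c x u v • mv u) * dv v f := by
    rw [qop_apply, Finset.sum_comm]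
    refine Finset.sum_congr rfl fun v _ => ?_
    rw [Finset.sum_mul]
    exact Finset.sum_congr rfl fun u _ => by rw [smul_mul_assoc, mv_mul]
  have h2 : D.dy x f = ∑ v, ((∑ i, if D.Y i ∧ Sum.inr (D.κ i) = v then x i else 0) •
      (1 : Alg E O)) * dv v f := by
    rw [dy_apply]
    simp only [Finset.sum_smul, Finset.sum_mul, smul_mul_assoc, one_mul]
    rw [Finset.sum_comm]
    refine Finset.sum_congr rfl fun i _ => ?_
    rw [Finset.sum_eq_single (Sum.inr (D.κ i))]
    · simp
    · intro b _ hb; simp [Ne.symm hb]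
    · simp
  rw [h1, h2, kt_apply, kt_apply, ← Finset.sum_add_distrib, ← Finset.sum_add_distrib]
  refine Finset.sum_congr rfl fun v _ => ?_
  rw [← add_mul, ← add_mul, V1]
  congr 1
  abel

theorem n_eq_zero_lmv {v : E ⊕ O} (hv : D.lin v) {a : Mo E O → ℝ}
    (ha : ∀ μ, wt D.n μ ≠ 0 → a μ = 0) (f : Alg E O) : diag a (lmv v f) = 0 := by
  rw [diag_lmv]
  have : (fun μ => a (μ + sv v)) = fun _ => 0 := by
    funext μ; exact ha _ (by rw [wt_add_sv, D.n_lin hv]; omega)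
  rw [this, diag_zero, map_zero]

theorem n_eq_zero_dv {v : E ⊕ O} (hv : D.lin v) {a : Mo E O → ℝ}
    (ha : ∀ μ, wt D.n μ ≠ 0 → a μ = 0) (f : Alg E O) : dv v (diag a f) = 0 := by
  rw [dv_diag]
  have : (fun μ => a (μ + sv v)) = fun _ => 0 := by
    funext μ; exact ha _ (by rw [wt_add_sv, D.n_lin hv]; omega)
  rw [this, diag_zero]

/-- The inverse of the number of variables in `lin`. -/
def ninv (μ : Mo E O) : ℝ := (wt D.n μ : ℝ)⁻¹

/-- Each term replaces one variable in `lin` by another, so their number is unchanged. -/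
theorem qop_diag {x : ι → ℝ} (hx : x ∈ D.B) (f : Alg E O) :
    qop (D.c x) (diag D.ninv f) = diag D.ninv (qop (D.c x) f) := by
  simp only [qop_apply, map_sum, map_smul]
  refine Finset.sum_congr rfl fun u _ => Finset.sum_congr rfl fun w _ => ?_
  by_cases h : D.c x u w = 0
  · simp [h]
  · obtain ⟨-, hu, hw⟩ := D.c_ne x hx u w h
    rw [lmv_dv_diag]
    intro μ
    simp only [ninv, wt_add_sv, D.n_lin hu, D.n_lin hw]

theorem dy_diag (x : ι → ℝ) (f : Alg E O) :
    D.dy x (diag D.ninv f) = diag D.ninv (D.dy x f) := by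
  simp only [dy_apply, map_sum, map_smul]
  refine Finset.sum_congr rfl fun i _ => ?_
  split_ifs with h
  · rw [dv_diag]
    simp only [ninv, wt_add_sv, D.n_κ h, add_zero]
    rfl
  · simp

/-- The variables κ_i are not in `lin`, so no contraction occurs between the two homotopy problems
and they decouple. -/
theorem dy_qop {x : ι → ℝ} (hx : x ∈ D.B) (f : Alg E O) :
    D.dy x (qop (D.g x) f) + qop (D.g x) (D.dy x f) = 0 := by
  simp only [dy_apply, qop_apply, map_sum, map_smul, Finset.smul_sum]
  have hs : ∀ F : ι → (E ⊕ O) → (E ⊕ O) → Alg E O,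
      ∑ u, ∑ w, ∑ i, F i u w = ∑ i, ∑ u, ∑ w, F i u w := by
    intro F
    rw [Finset.sum_congr rfl fun u _ => Finset.sum_comm, Finset.sum_comm]
  rw [hs]
  simp only [← Finset.sum_add_distrib]
  refine Finset.sum_eq_zero fun i _ => Finset.sum_eq_zero fun w _ => Finset.sum_eq_zero fun u _ => ?_
  split_ifs with h
  · by_cases h' : D.g x w u = 0
    · simp [h']
    · obtain ⟨ho, hw, -⟩ := D.g_ne x hx w u h'
      rw [smul_comm, ← smul_add, ← smul_add, dv_lmv_dv_anticomm ho, smul_zero, smul_zero]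
      rintro rfl
      exact (D.κ_spec i h).1 hw
  · simp

/-- The homotopy for the variables in `lin`. -/
theorem lin_homotopy {x : ι → ℝ} (hx : x ∈ D.B) (f : Alg E O) :
    qop (D.c x) (qop (D.g x) (diag D.ninv f)) + D.dy x (qop (D.g x) (diag D.ninv f)) +
      qop (D.g x) (diag D.ninv (qop (D.c x) f + D.dy x f))
      = diag (fun μ => if wt D.n μ = 0 then 0 else 1) f := by
  have h1 := qop_anticomm (fun u w h => (D.c_ne x hx u w h).1)
    (fun u w h => (D.g_ne x hx u w h).1) (diag D.ninv f)
  have h2 := D.dy_qop hx (diag D.ninv f)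
  rw [D.c_mul_g x hx] at h1
  have h3 := qop_diagonal D.n (diag D.ninv f)
  unfold n at h3
  rw [h3, diag_diag] at h1
  -- The convention 0⁻¹ = 0 makes `ninv` vanish where the count is zero, so the product is the
  -- projector onto nonzero count.
  have h4 : (fun μ : Mo E O => (wt (fun v => if D.lin v then 1 else 0) μ : ℝ)) * D.ninv
      = fun μ => if wt D.n μ = 0 then 0 else 1 := by
    funext μ
    change (wt D.n μ : ℝ) * (wt D.n μ : ℝ)⁻¹ = _
    split_ifs with h
    · simp [h]
    · exact mul_inv_cancel₀ (by exact_mod_cast h)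
  rw [h4] at h1
  rw [map_add, map_add, ← D.qop_diag hx, ← D.dy_diag, ← h1]
  rw [add_add_add_comm, h2, add_zero]

end NormalForm

/-! ### Lifted averages and partial derivatives. -/

section Lift
variable {E O : Type} [Fintype O]

theorem lift_zero {X : Type} [NormedAddCommGroup X] [NormedSpace ℝ X] {T : (X → ℝ) → X → ℝ}
    {B : Set X} (hT : IsOp T B) {x : X} (hx : x ∈ B) :
    lift T (fun _ => (0 : Alg E O)) x = 0 := by
  simpa using lift_sum (E := E) (O := O) hT (∅ : Finset ℕ) (F := fun _ _ => 0) (by simp) hx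

/-- The filtration is cut out by the operators `diag a`, which act coefficientwise and hence commute
with `lift`. -/
theorem lift_mem_Fil {X : Type} [NormedAddCommGroup X] [NormedSpace ℝ X] {T : (X → ℝ) → X → ℝ}
    {B : Set X} (hT : IsOp T B) {w : E ⊕ O → ℕ} {n : ℕ} {F : X → Alg E O} (hF : Sm F B)
    (h : ∀ x ∈ B, F x ∈ Fil w n) {x : X} (hx : x ∈ B) : lift T F x ∈ Fil w n := by
  rw [mem_Fil_iff]
  intro a ha
  rw [← lift_linear hT hF (isCL_diag a) hx,
    lift_congr hT (G := fun _ => 0) (fun y hy => diag_eq_zero (h y hy) ha) hx, lift_zero hT hx]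

variable {ι : Type} [Fintype ι] {Y : ι → Prop} {B : Set (ι → ℝ)}

theorem lift_pd_coord_smul (hBo : IsOpen B) (i j : ι) {F : (ι → ℝ) → Alg E O} (hF : Sm F B)
    {x : ι → ℝ} (hx : x ∈ B) : lift (pd i) (fun y => y j • F y) x
      = (if i = j then F x else 0) + x j • lift (pd i) F x := by
  have hj : ContDiffOn ℝ ∞ (fun y : ι → ℝ => y j) B := by fun_prop
  refine Alg.ext_dual fun e l => ?_
  rw [dual_lift (isOp_pd hBo i) (Sm.smul hj hF) hx, map_add, map_add, coeff_rsmul, map_smul,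
    dual_lift (isOp_pd hBo i) hF hx]
  have : (fun y : ι → ℝ => l (coeff e (y j • F y))) = fun y => y j * l (coeff e (F y)) := by
    funext y; rw [coeff_rsmul, map_smul, smul_eq_mul]
  rw [this, pd_mul hBo i hj (hF e l) hx, pd_coord]
  split_ifs <;> simp

theorem coord_smul_lift_avg (hBo : IsOpen B) (hB : Star Y B) (k : ℕ) {j : ι} (hj : Y j)
    {F : (ι → ℝ) → Alg E O} (hF : Sm F B) {x : ι → ℝ} (hx : x ∈ B) :
    x j • lift (avg Y (k + 1)) F x = lift (avg Y k) (fun y => y j • F y) x := by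
  have hc : ContDiffOn ℝ ∞ (fun y : ι → ℝ => y j) B := by fun_prop
  refine Alg.ext_dual fun e l => ?_
  rw [dual_lift (isOp_avg hBo hB k) (Sm.smul hc hF) hx, coeff_rsmul, map_smul,
    dual_lift (isOp_avg hBo hB (k + 1)) hF hx, smul_eq_mul, coord_mul_avg k hj]
  simp only [coeff_rsmul, map_smul, smul_eq_mul]

theorem lift_avg_euler (hBo : IsOpen B) (hB : Star Y B) (k : ℕ)
    {F : (ι → ℝ) → Alg E O} (hF : Sm F B) {x : ι → ℝ} (hx : x ∈ B) :
    lift (avg Y k) (fun y => ((k + 1 : ℕ) : ℝ) • F y +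
      ∑ i, (if Y i then y i else 0) • lift (pd i) F y) x = F x := by
  have hc : ∀ i, ContDiffOn ℝ ∞ (fun y : ι → ℝ => if Y i then y i else 0) B := by
    intro i; split_ifs <;> fun_prop
  have hS : Sm (fun y => ((k + 1 : ℕ) : ℝ) • F y +
      ∑ i, (if Y i then y i else 0) • lift (pd i) F y) B :=
    (Sm.smul contDiffOn_const hF).add
      (Sm.sum _ fun i _ => Sm.smul (hc i) (hF.lift (isOp_pd hBo i)))
  refine Alg.ext_dual fun e l => ?_
  rw [dual_lift (isOp_avg hBo hB k) hS hx, ← avg_euler hBo hB k (hF e l) hx]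
  refine (isOp_avg hBo hB k).congr _ _ (fun y hy => ?_) x hx
  simp only [map_add, map_sum, coeff_rsmul, map_smul, smul_eq_mul]
  congr 1
  exact Finset.sum_congr rfl fun i _ => by rw [dual_lift (isOp_pd hBo i) hF hy]

end Lift

/-! ### Poincaré homotopy for the coordinates. -/

namespace NormalForm
variable {E O ι : Type} [Fintype E] [Fintype O] [Fintype ι] (D : NormalForm E O ι)

/-- A bound for the number of variables `κ_i` in a monomial. -/
theorem exists_kap_bound : ∃ K : ℕ, ∀ a : Mo E O → ℝ, (∀ μ, wt D.kap μ < K → a μ = 0) →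
    ∀ f : Alg E O, diag a f = 0 := by
  obtain ⟨K, hK⟩ := exists_bound_diagLam (D.kap ∘ Sum.inr)
  refine ⟨K, fun a ha f => ?_⟩
  ext1 e
  rw [coeff_diag, map_zero]
  refine hK _ (fun ν hν => ha _ ?_) _
  -- All κ_i are odd, so even variables do not contribute and the Grassmann bound applies.
  have : D.kap ∘ Sum.inl = 0 := by funext v; simp [kap]
  have h0 : Finsupp.weight (D.kap ∘ Sum.inl) e = 0 := by
    rw [this, Finsupp.weight_apply]; simp
  unfold wt
  rw [h0, zero_add]
  exact hν

/-- The chosen bound. -/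
def K : ℕ := D.exists_kap_bound.choose

/-- The indicator of the monomials without variables in `lin` and with `k` variables `κ_i`. -/
def chi (k : ℕ) (μ : Mo E O) : ℝ := if wt D.n μ = 0 ∧ wt D.kap μ = k then 1 else 0

/-- The operator `∑ κ_i ∂/∂x_i`. -/
def sy (F : (ι → ℝ) → Alg E O) (x : ι → ℝ) : Alg E O :=
  ∑ i, if D.Y i then lmv (Sum.inr (D.κ i)) (lift (pd i) F x) else 0

/-- The homotopy for the coordinates. -/
def kz (F : (ι → ℝ) → Alg E O) (x : ι → ℝ) : Alg E O :=
  ∑ k ∈ Finset.range D.K, lift (avg D.Y k) (fun y => diag (D.chi (k + 1)) (D.sy F y)) x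

theorem smooth_sy {F : (ι → ℝ) → Alg E O} (hF : Sm F D.B) : Sm (D.sy F) D.B := by
  refine Sm.sum _ fun i _ => ?_
  split_ifs
  · exact (hF.lift (isOp_pd D.isOpen_B i)).linear (isCL_lmv _)
  · exact Sm.const 0

theorem smooth_kz {F : (ι → ℝ) → Alg E O} (hF : Sm F D.B) : Sm (D.kz F) D.B :=
  Sm.sum _ fun k _ => ((D.smooth_sy hF).linear (isCL_diag _)).lift (isOp_avg D.isOpen_B D.star_B k)

theorem sy_add {F F' : (ι → ℝ) → Alg E O} (hF : Sm F D.B) (hF' : Sm F' D.B) {x : ι → ℝ}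
    (hx : x ∈ D.B) : D.sy (fun y => F y + F' y) x = D.sy F x + D.sy F' x := by
  unfold sy
  rw [← Finset.sum_add_distrib]
  refine Finset.sum_congr rfl fun i _ => ?_
  rw [lift_add (isOp_pd D.isOpen_B i) hF hF' hx, map_add]
  split_ifs <;> simp

theorem kz_add {F F' : (ι → ℝ) → Alg E O} (hF : Sm F D.B) (hF' : Sm F' D.B) {x : ι → ℝ}
    (hx : x ∈ D.B) : D.kz (fun y => F y + F' y) x = D.kz F x + D.kz F' x := by
  unfold kz
  rw [← Finset.sum_add_distrib]
  refine Finset.sum_congr rfl fun k _ => ?_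
  rw [← lift_add (isOp_avg D.isOpen_B D.star_B k) ((D.smooth_sy hF).linear (isCL_diag _))
    ((D.smooth_sy hF').linear (isCL_diag _)) hx]
  refine lift_congr (isOp_avg D.isOpen_B D.star_B k) (fun y hy => ?_) hx
  rw [D.sy_add hF hF' hy, map_add]

theorem sy_mem_Fil {w : E ⊕ O → ℕ} {r n : ℕ} (hw : ∀ i, D.Y i → r ≤ w (Sum.inr (D.κ i)))
    {F : (ι → ℝ) → Alg E O} (hF : Sm F D.B) (h : ∀ x ∈ D.B, F x ∈ Fil w n) {x : ι → ℝ}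
    (hx : x ∈ D.B) : D.sy F x ∈ Fil w (n + r) := by
  refine Submodule.sum_mem _ fun i _ => ?_
  split_ifs with hi
  · exact Fil_anti w (Nat.add_le_add_left (hw i hi) n)
      (lmv_mem_Fil _ (lift_mem_Fil (isOp_pd D.isOpen_B i) hF h hx))
  · exact zero_mem _

theorem kz_mem_Fil {w : E ⊕ O → ℕ} {r n : ℕ} (hw : ∀ i, D.Y i → r ≤ w (Sum.inr (D.κ i)))
    {F : (ι → ℝ) → Alg E O} (hF : Sm F D.B) (h : ∀ x ∈ D.B, F x ∈ Fil w n) {x : ι → ℝ}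
    (hx : x ∈ D.B) : D.kz F x ∈ Fil w (n + r) :=
  Submodule.sum_mem _ fun k _ => lift_mem_Fil (isOp_avg D.isOpen_B D.star_B k)
    ((D.smooth_sy hF).linear (isCL_diag _))
    (fun _ hy => diag_mem_Fil _ (D.sy_mem_Fil hw hF h hy)) hx

theorem chi_eq_zero (k : ℕ) (μ : Mo E O) (h : wt D.n μ ≠ 0) : D.chi k μ = 0 :=
  if_neg fun h' => h h'.1

/-- The output of `kz` contains no variable of `lin`, while every term of the operator
differentiates by one. -/
theorem qop_kz {F : (ι → ℝ) → Alg E O} (hF : Sm F D.B) {x : ι → ℝ} (hx : x ∈ D.B) :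
    qop (D.c x) (D.kz F x) = 0 := by
  rw [qop_apply]
  refine Finset.sum_eq_zero fun u _ => Finset.sum_eq_zero fun w _ => ?_
  by_cases h : D.c x u w = 0
  · simp [h]
  obtain ⟨-, -, hw⟩ := D.c_ne x hx u w h
  rw [kz, map_sum, map_sum, Finset.smul_sum]
  refine Finset.sum_eq_zero fun k _ => ?_
  rw [← lift_linear (isOp_avg D.isOpen_B D.star_B k) ((D.smooth_sy hF).linear (isCL_diag _))
    (isCL_dv w) hx]
  simp only [D.n_eq_zero_dv hw (D.chi_eq_zero (k + 1))]
  rw [lift_zero (isOp_avg D.isOpen_B D.star_B k) hx]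
  simp

theorem smooth_qop {c : (ι → ℝ) → Matrix (E ⊕ O) (E ⊕ O) ℝ}
    (hc : ∀ u w, ContDiffOn ℝ ∞ (fun x => c x u w) D.B) {F : (ι → ℝ) → Alg E O} (hF : Sm F D.B) :
    Sm (fun y => qop (c y) (F y)) D.B :=
  Sm.congr (Sm.sum _ fun u _ => Sm.sum _ fun w _ => Sm.smul (hc u w)
    ((hF.linear (isCL_dv w)).linear (isCL_lmv u))) fun y _ => qop_apply (c y) (F y)

/-- Every term of `qop (c y)` multiplies by a variable of `lin`; the later operations neither remove
it nor survive the projection by `chi`. -/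
theorem kz_qop {F : (ι → ℝ) → Alg E O} (hF' : Sm F D.B) {x : ι → ℝ}
    (hx : x ∈ D.B) : D.kz (fun y => qop (D.c y) (F y)) x = 0 := by
  have hF := D.smooth_qop D.smooth_c hF'
  refine Finset.sum_eq_zero fun k _ => ?_
  rw [← lift_zero (isOp_avg D.isOpen_B D.star_B k) hx]
  refine lift_congr (isOp_avg D.isOpen_B D.star_B k) (fun y hy => ?_) hx
  unfold sy
  rw [map_sum]
  refine Finset.sum_eq_zero fun i _ => ?_
  split_ifs with hi
  · rw [diag_lmv, ← lift_linear (isOp_pd D.isOpen_B i) hF (isCL_diag _) hy,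
      lift_congr (isOp_pd D.isOpen_B i) (G := fun _ => 0) ?_ hy, lift_zero (isOp_pd D.isOpen_B i) hy,
      map_zero]
    intro z hz
    rw [qop_apply, map_sum]
    refine Finset.sum_eq_zero fun u _ => ?_
    rw [map_sum]
    refine Finset.sum_eq_zero fun w _ => ?_
    by_cases h : D.c z u w = 0
    · simp [h]
    obtain ⟨-, hu, -⟩ := D.c_ne z hz u w h
    rw [map_smul, D.n_eq_zero_lmv hu, smul_zero]
    intro μ hμ
    apply D.chi_eq_zero
    rw [wt_add_sv]
    omega
  · simp

theorem chi_add_sv {i : ι} (hi : D.Y i) (k : ℕ) :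
    (fun μ : Mo E O => D.chi (k + 1) (μ + sv (Sum.inr (D.κ i)))) = D.chi k := by
  funext μ
  simp only [chi, wt_add_sv, D.n_κ hi, D.kap_κ hi, add_zero, Nat.add_right_cancel_iff]

/-- A monomial with neither `lin` variables nor κ_i contains no antifield, by `cover`. This is where
positive antifield number replaces the missing homotopy on the constants. -/
theorem diag_chi_zero {f : Alg E O} (hf : f ∈ Fil D.afn 1) : diag (D.chi 0) f = 0 := by
  refine diag_eq_zero hf fun μ hμ => if_neg ?_
  rintro ⟨h1, h2⟩
  have key : ∀ v, D.afn v ≠ 0 → D.n v ≠ 0 ∨ D.kap v ≠ 0 := by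
    intro v hv
    rcases D.cover v hv with h | h
    · left; rw [D.n_lin h]; exact one_ne_zero
    · right; unfold kap; rw [if_pos h]; exact one_ne_zero
  simp only [wt, Finsupp.weight_eq_sum, Function.comp] at h1 h2 hμ
  have a1 : ∀ e : E, μ.1 e • D.n (Sum.inl e) = 0 := fun e =>
    Finset.sum_eq_zero_iff.mp (Nat.add_eq_zero_iff.mp h1).1 e (Finset.mem_univ _)
  have a2 : ∀ o : O, μ.2 o • D.n (Sum.inr o) = 0 := fun e =>
    Finset.sum_eq_zero_iff.mp (Nat.add_eq_zero_iff.mp h1).2 e (Finset.mem_univ _)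
  have b1 : ∀ e : E, μ.1 e • D.kap (Sum.inl e) = 0 := fun e =>
    Finset.sum_eq_zero_iff.mp (Nat.add_eq_zero_iff.mp h2).1 e (Finset.mem_univ _)
  have b2 : ∀ o : O, μ.2 o • D.kap (Sum.inr o) = 0 := fun e =>
    Finset.sum_eq_zero_iff.mp (Nat.add_eq_zero_iff.mp h2).2 e (Finset.mem_univ _)
  have c1 : ∑ e : E, μ.1 e • D.afn (Sum.inl e) = 0 := Finset.sum_eq_zero fun e _ => by
    by_contra h
    have := key (Sum.inl e) (by rintro h'; simp [h'] at h)
    have a := a1 e; have b := b1 e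
    simp only [smul_eq_mul, mul_eq_zero, not_or] at a b h
    rcases this with t | t <;> tauto
  have c2 : ∑ o : O, μ.2 o • D.afn (Sum.inr o) = 0 := Finset.sum_eq_zero fun e _ => by
    by_contra h
    have := key (Sum.inr e) (by rintro h'; simp [h'] at h)
    have a := a2 e; have b := b2 e
    simp only [smul_eq_mul, mul_eq_zero, not_or] at a b h
    rcases this with t | t <;> tauto
  omega

theorem smooth_coord (i : ι) : ContDiffOn ℝ ∞ (fun y : ι → ℝ => if D.Y i then y i else 0) D.B := by
  split_ifs <;> fun_prop

theorem smooth_dy {F : (ι → ℝ) → Alg E O} (hF : Sm F D.B) : Sm (fun y => D.dy y (F y)) D.B :=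
  Sm.congr (Sm.sum _ fun i _ => Sm.smul (D.smooth_coord i) (hF.linear (isCL_dv _)))
    fun y _ => D.dy_apply y (F y)

/-- The Euler operator of the pairs `(x_i, κ_i)`. -/
theorem dy_sy {F : (ι → ℝ) → Alg E O} (hF : Sm F D.B) {x : ι → ℝ} (hx : x ∈ D.B) :
    D.dy x (D.sy F x) + D.sy (fun y => D.dy y (F y)) x
      = diag (fun μ => (wt D.kap μ : ℝ)) (F x)
        + ∑ i, (if D.Y i then x i else 0) • lift (pd i) F x := by
  have h1 : ∀ i, lift (pd i) (fun y => D.dy y (F y)) x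
      = ∑ j, ((if D.Y j ∧ i = j then dv (Sum.inr (D.κ j)) (F x) else 0)
        + (if D.Y j then x j else 0) • dv (Sum.inr (D.κ j)) (lift (pd i) F x)) := by
    intro i
    rw [lift_congr (isOp_pd D.isOpen_B i) (G := fun y => ∑ j, (if D.Y j then y j else 0) •
      dv (Sum.inr (D.κ j)) (F y)) (fun y _ => D.dy_apply y (F y)) hx,
      lift_sum (isOp_pd D.isOpen_B i) _
        (fun j _ => Sm.smul (D.smooth_coord j) (hF.linear (isCL_dv _))) hx]
    refine Finset.sum_congr rfl fun j _ => ?_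
    by_cases hj : D.Y j
    · simp only [hj, if_true, true_and]
      rw [lift_pd_coord_smul D.isOpen_B i j (hF.linear (isCL_dv _)) hx,
        lift_linear (isOp_pd D.isOpen_B i) hF (isCL_dv _) hx]
    · simp only [hj, if_false, zero_smul, false_and, add_zero]
      exact lift_zero (isOp_pd D.isOpen_B i) hx
  have h2 : diag (fun μ => (wt D.kap μ : ℝ)) (F x) =
      ∑ i, if D.Y i then lmv (Sum.inr (D.κ i)) (dv (Sum.inr (D.κ i)) (F x)) else 0 := by
    rw [← sum_lmv_dv]
    have : ∀ v, (D.kap v : ℝ) • lmv v (dv v (F x)) =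
        ∑ i, if D.Y i ∧ Sum.inr (D.κ i) = v then lmv v (dv v (F x)) else 0 := by
      intro v
      unfold kap
      split_ifs with h
      · obtain ⟨i, hi, rfl⟩ := h
        rw [Finset.sum_eq_single i]
        · simp [hi]
        · intro j _ hj
          rw [if_neg]
          rintro ⟨h1, h2⟩
          exact hj (D.κ_inj _ _ h1 hi (Sum.inr_injective h2))
        · simp
      · rw [Finset.sum_eq_zero]
        · simp
        · intro i _
          rw [if_neg]
          exact fun hi => h ⟨i, hi⟩
    rw [Finset.sum_congr rfl fun v _ => this v, Finset.sum_comm]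
    refine Finset.sum_congr rfl fun i _ => ?_
    rw [Finset.sum_eq_single (Sum.inr (D.κ i))]
    · simp
    · intro b _ hb; simp [Ne.symm hb]
    · simp
  have h3 : D.sy (fun y => D.dy y (F y)) x =
      (∑ i, if D.Y i then lmv (Sum.inr (D.κ i)) (dv (Sum.inr (D.κ i)) (F x)) else 0)
      + ∑ i, ∑ j, if D.Y i ∧ D.Y j then x j • lmv (Sum.inr (D.κ i))
          (dv (Sum.inr (D.κ j)) (lift (pd i) F x)) else 0 := by
    unfold sy
    rw [← Finset.sum_add_distrib]
    refine Finset.sum_congr rfl fun i _ => ?_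
    by_cases hi : D.Y i
    · simp only [hi, if_true, true_and]
      rw [h1, map_sum, Finset.sum_congr rfl fun j _ => map_add _ _ _, Finset.sum_add_distrib]
      congr 1
      · rw [Finset.sum_eq_single i]
        · simp [hi]
        · intro j _ hj; simp [Ne.symm hj]
        · simp
      · refine Finset.sum_congr rfl fun j _ => ?_
        split_ifs <;> simp
    · simp [hi]
  have h4 : D.dy x (D.sy F x) =
      (∑ i, (if D.Y i then x i else 0) • lift (pd i) F x)
      - ∑ i, ∑ j, if D.Y i ∧ D.Y j then x j • lmv (Sum.inr (D.κ i))
          (dv (Sum.inr (D.κ j)) (lift (pd i) F x)) else 0 := by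
    rw [dy_apply]
    unfold sy
    simp only [map_sum, Finset.smul_sum]
    rw [Finset.sum_comm, ← Finset.sum_sub_distrib]
    refine Finset.sum_congr rfl fun i _ => ?_
    by_cases hi : D.Y i
    · simp only [hi, if_true, true_and, dv_lmv, smul_add, Finset.sum_add_distrib]
      rw [sub_eq_add_neg]
      congr 1
      · rw [Finset.sum_eq_single i]
        · simp [hi]
        · intro j _ hj
          split_ifs with h5 h6
          · exact absurd (D.κ_inj _ _ h5 hi (Sum.inr_injective h6)) hj
          all_goals simp
        · simp
      · rw [← Finset.sum_neg_distrib]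
        refine Finset.sum_congr rfl fun j _ => ?_
        split_ifs <;> simp [sg]
    · simp [hi]
  rw [h2, h3, h4]
  abel

theorem smooth_diag_sy (a : Mo E O → ℝ) {F : (ι → ℝ) → Alg E O} (hF : Sm F D.B) :
    Sm (fun y => diag a (D.sy F y)) D.B := (D.smooth_sy hF).linear (isCL_diag _)

/-- Moving x_j ∂/∂κ_j inside the average lowers the κ-degree and, through the factor x_j, the
exponent. The two effects match after shifting the summation index by one, and the end terms vanish.
-/
theorem dy_kz {F : (ι → ℝ) → Alg E O} (hF : Sm F D.B) (hpos : ∀ x ∈ D.B, F x ∈ Fil D.afn 1)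
    {x : ι → ℝ} (hx : x ∈ D.B) : D.dy x (D.kz F x) = ∑ k ∈ Finset.range D.K,
      lift (avg D.Y k) (fun y => diag (D.chi (k + 1)) (D.dy y (D.sy F y))) x := by
  have hK : ∀ f : Alg E O, diag (D.chi D.K) f = 0 := fun f =>
    D.exists_kap_bound.choose_spec _ (fun μ hμ => if_neg fun h => by
      have := h.2; unfold K at this; omega) f
  set H : ℕ → ι → Alg E O := fun k j => (if D.Y j then x j else 0) •
    lift (avg D.Y k) (fun y => diag (D.chi k) (dv (Sum.inr (D.κ j)) (D.sy F y))) x with hH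
  have h1 : D.dy x (D.kz F x) = ∑ k ∈ Finset.range D.K, ∑ j, H k j := by
    rw [kz, map_sum]
    refine Finset.sum_congr rfl fun k _ => ?_
    rw [dy_apply]
    refine Finset.sum_congr rfl fun j _ => ?_
    simp only [hH]
    by_cases hj : D.Y j
    · rw [← lift_linear (isOp_avg D.isOpen_B D.star_B k) (D.smooth_diag_sy _ hF) (isCL_dv _) hx]
      simp only [dv_diag, D.chi_add_sv hj]
    · simp [hj]
  -- In κ-degree zero only the contraction of κ_j with ∂/∂κ_j could survive, and it is a derivative
  -- of `diag (chi 0) F`, which is zero.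
  have h0 : ∀ j, H 0 j = 0 := by
    intro j
    by_cases hj : D.Y j
    · simp only [hH]
      rw [lift_congr (isOp_avg D.isOpen_B D.star_B 0) (G := fun _ => 0) ?_ hx,
        lift_zero (isOp_avg D.isOpen_B D.star_B 0) hx, smul_zero]
      intro y hy
      unfold sy
      simp only [map_sum]
      refine Finset.sum_eq_zero fun i _ => ?_
      split_ifs with hi
      · rw [dv_lmv, map_add, map_smul, diag_lmv]
        have e1 : (fun μ : Mo E O => D.chi 0 (μ + sv (Sum.inr (D.κ i)))) = fun _ => 0 := by
          funext μ
          simp [chi, wt_add_sv, D.kap_κ hi]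
        rw [e1, diag_zero, map_zero, smul_zero, add_zero]
        split_ifs
        · rw [← lift_linear (isOp_pd D.isOpen_B i) hF (isCL_diag _) hy,
            lift_congr (isOp_pd D.isOpen_B i) (G := fun _ => 0)
              (fun z hz => D.diag_chi_zero (hpos z hz)) hy, lift_zero (isOp_pd D.isOpen_B i) hy]
        · simp
      · simp
    · simp [hH, hj]
  -- No monomial has κ-degree `K`.
  have hKz : ∀ j, H D.K j = 0 := by
    intro j
    simp only [hH, hK]
    rw [lift_zero (isOp_avg D.isOpen_B D.star_B _) hx, smul_zero]
  have h2 : ∑ k ∈ Finset.range D.K, ∑ j, H k j = ∑ k ∈ Finset.range D.K, ∑ j, H (k + 1) j := by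
    have a := Finset.sum_range_succ (fun k => ∑ j, H k j) D.K
    have b := Finset.sum_range_succ' (fun k => ∑ j, H k j) D.K
    rw [a] at b
    simpa [h0, hKz] using b
  rw [h1, h2]
  refine Finset.sum_congr rfl fun k _ => ?_
  have hs : ∀ j, Sm (fun y => diag (D.chi (k + 1)) (dv (Sum.inr (D.κ j)) (D.sy F y))) D.B :=
    fun j => ((D.smooth_sy hF).linear (isCL_dv _)).linear (isCL_diag _)
  have e : ∀ y ∈ D.B, diag (D.chi (k + 1)) (D.dy y (D.sy F y)) =
      ∑ j, (if D.Y j then y j else 0) •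
        diag (D.chi (k + 1)) (dv (Sum.inr (D.κ j)) (D.sy F y)) := by
    intro y _
    rw [dy_apply, map_sum]
    simp only [map_smul]
  rw [lift_congr (isOp_avg D.isOpen_B D.star_B k) e hx,
    lift_sum (isOp_avg D.isOpen_B D.star_B k) _ (fun j _ => Sm.smul (D.smooth_coord j) (hs j)) hx]
  refine Finset.sum_congr rfl fun j _ => ?_
  by_cases hj : D.Y j
  · simp only [hH, hj, if_true]
    exact coord_smul_lift_avg D.isOpen_B D.star_B k hj (hs j) hx
  · simp only [hH, hj, if_false, zero_smul]
    rw [lift_zero (isOp_avg D.isOpen_B D.star_B k) hx]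

/-- The homotopy for the coordinates. -/
theorem y_homotopy {F : (ι → ℝ) → Alg E O} (hF : Sm F D.B) (hpos : ∀ x ∈ D.B, F x ∈ Fil D.afn 1)
    {x : ι → ℝ} (hx : x ∈ D.B) : D.dy x (D.kz F x) + D.kz (fun y => D.dy y (F y)) x
      = diag (fun μ => if wt D.n μ = 0 then 1 else 0) (F x) := by
  rw [D.dy_kz hF hpos hx, kz, ← Finset.sum_add_distrib]
  -- In κ-degree `k + 1` the Euler operator of `dy_sy` is `k + 1` plus the Euler field of the
  -- coordinates, exactly what `avg D.Y k` inverts.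
  have h1 : ∀ k, lift (avg D.Y k) (fun y => diag (D.chi (k + 1)) (D.dy y (D.sy F y))) x +
      lift (avg D.Y k) (fun y => diag (D.chi (k + 1)) (D.sy (fun y => D.dy y (F y)) y)) x
      = diag (D.chi (k + 1)) (F x) := by
    intro k
    rw [← lift_add (isOp_avg D.isOpen_B D.star_B k)
      ((D.smooth_dy (D.smooth_sy hF)).linear (isCL_diag _))
      (D.smooth_diag_sy _ (D.smooth_dy hF)) hx]
    rw [← lift_avg_euler D.isOpen_B D.star_B k (hF.linear (isCL_diag (D.chi (k + 1)))) hx]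
    refine lift_congr (isOp_avg D.isOpen_B D.star_B k) (fun y hy => ?_) hx
    rw [← map_add, D.dy_sy hF hy, map_add, diag_diag, map_sum]
    congr 1
    · rw [← diag_smul]
      congr 2
      funext μ
      simp only [Pi.mul_apply, Pi.smul_apply, chi, smul_eq_mul]
      split_ifs with h
      · rw [h.2]; ring
      · ring
    · refine Finset.sum_congr rfl fun i _ => ?_
      rw [map_smul, lift_linear (isOp_pd D.isOpen_B i) hF (isCL_diag _) hy]
  simp only [h1]
  have h2 : ∀ m : ℕ, ∑ k ∈ Finset.range m, diag (D.chi (k + 1)) (F x)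
      = diag (∑ k ∈ Finset.range m, D.chi (k + 1)) (F x) := by
    intro m
    induction m with
    | zero => exact (diag_zero (F x)).symm
    | succ m ih => rw [Finset.sum_range_succ, ih, Finset.sum_range_succ, diag_add]
  -- Split by κ-degree: degree 0 vanishes by positivity, degrees 1 to `K` are covered by the sum,
  -- and larger degrees do not occur.
  have h3 : (fun μ : Mo E O => if wt D.n μ = 0 then (1 : ℝ) else 0) =
      D.chi 0 + (∑ k ∈ Finset.range D.K, D.chi (k + 1)
      + fun μ => if wt D.n μ = 0 ∧ D.K < wt D.kap μ then 1 else 0) := by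
    funext μ
    simp only [Pi.add_apply, Finset.sum_apply, chi]
    by_cases hn : wt D.n μ = 0
    · simp only [hn, true_and, if_true]
      rcases Nat.eq_zero_or_pos (wt D.kap μ) with h0 | h0
      · simp [h0]
      · rw [if_neg h0.ne', zero_add]
        by_cases hk : D.K < wt D.kap μ
        · rw [Finset.sum_eq_zero, if_pos hk, zero_add]
          intro k hk'
          rw [if_neg]
          have := Finset.mem_range.mp hk'
          omega
        · rw [if_neg hk, add_zero, Finset.sum_eq_single (wt D.kap μ - 1)]
          · rw [if_pos (by omega)]
          · intro b _ hb; rw [if_neg (by omega)]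
          · intro h; exact absurd (Finset.mem_range.mpr (by omega)) h
    · simp [hn]
  rw [h2, h3, diag_add, diag_add, D.diag_chi_zero (hpos x hx), zero_add]
  have h4 := D.exists_kap_bound.choose_spec
    (fun μ => if wt D.n μ = 0 ∧ D.K < wt D.kap μ then 1 else 0)
    (fun μ hμ => if_neg fun h => by have := h.2; unfold K at this; omega) (F x)
  rw [h4, add_zero]

end NormalForm

/-! ### Perturbation of the homotopy and acyclicity. -/

namespace NormalForm
variable {E O ι : Type} [Fintype E] [Fintype O] [Fintype ι] (D : NormalForm E O ι)

/-- The contracting homotopy of the leading operator. -/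
def hom (F : (ι → ℝ) → Alg E O) (x : ι → ℝ) : Alg E O :=
  qop (D.g x) (diag D.ninv (F x)) + D.kz F x

/-- The operator as a family of linear maps. -/
def op (x : ι → ℝ) : Alg E O →ₗ[ℝ] Alg E O := kt fun v => D.V v x

theorem smooth_hom {F : (ι → ℝ) → Alg E O} (hF : Sm F D.B) : Sm (D.hom F) D.B :=
  (D.smooth_qop D.smooth_g (hF.linear (isCL_diag _))).add (D.smooth_kz hF)

theorem smooth_op {F : (ι → ℝ) → Alg E O} (hF : Sm F D.B) :
    Sm (fun x => D.op x (F x)) D.B :=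
  Sm.sum _ fun v _ => (D.smooth_V v).mul (hF.linear (isCL_dv v))

/-- The two homotopies give complementary projectors, onto nonzero and zero number of `lin`
variables; the cross terms vanish by `qop_kz`, `kz_qop` and `dy_qop`. -/
theorem homotopy {F : (ι → ℝ) → Alg E O} (hF : Sm F D.B) (hpos : ∀ x ∈ D.B, F x ∈ Fil D.afn 1)
    {x : ι → ℝ} (hx : x ∈ D.B) :
    qop (D.c x) (D.hom F x) + D.dy x (D.hom F x)
      + D.hom (fun y => qop (D.c y) (F y) + D.dy y (F y)) x = F x := by
  have h1 := D.lin_homotopy hx (F x)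
  have h2 := D.y_homotopy hF hpos hx
  have h3 := D.qop_kz hF hx
  have h4 := D.kz_qop hF hx
  have h5 : F x = diag (fun μ => if wt D.n μ = 0 then 0 else 1) (F x)
      + diag (fun μ => if wt D.n μ = 0 then 1 else 0) (F x) := by
    rw [← diag_add]
    conv_lhs => rw [← diag_one (F x)]
    congr 2
    funext μ
    simp only [Pi.add_apply]
    split_ifs <;> simp
  unfold hom
  rw [D.kz_add (D.smooth_qop D.smooth_c hF) (D.smooth_dy hF) hx, h4, zero_add, map_add, map_add, h3,
    add_zero]
  conv_rhs => rw [h5]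
  rw [← h1, ← h2]
  abel

theorem hom_mem_Fil {w : E ⊕ O → ℕ} {r n : ℕ} (hw : ∀ i, D.Y i → r ≤ w (Sum.inr (D.κ i)))
    (hg : ∀ x ∈ D.B, ∀ v u, D.g x v u ≠ 0 → w u + r ≤ w v)
    {F : (ι → ℝ) → Alg E O} (hF : Sm F D.B) (h : ∀ x ∈ D.B, F x ∈ Fil w n) {x : ι → ℝ}
    (hx : x ∈ D.B) : D.hom F x ∈ Fil w (n + r) := by
  refine add_mem ?_ (D.kz_mem_Fil hw hF h hx)
  rw [qop_apply]
  refine Submodule.sum_mem _ fun v _ => Submodule.sum_mem _ fun u _ => ?_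
  by_cases h0 : D.g x v u = 0
  · rw [h0, zero_smul]; exact zero_mem _
  · have := hg x hx v u h0
    exact Submodule.smul_mem _ _ (Fil_anti w (by omega)
      (lmv_mem_Fil v (dv_mem_Fil u (diag_mem_Fil _ (h x hx)))))

/-- A gain of two is what the perturbation argument needs, because the remainder may lose one. -/
theorem hom_mem_W {n : ℕ} {F : (ι → ℝ) → Alg E O} (hF : Sm F D.B)
    (h : ∀ x ∈ D.B, F x ∈ Fil D.W n) {x : ι → ℝ} (hx : x ∈ D.B) :
    D.hom F x ∈ Fil D.W (n + 2) :=
  D.hom_mem_Fil (fun i hi => (D.κ_spec i hi).2.1)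
    (fun x hx v u h => (D.g_ne x hx v u h).2.2.2.1) hF h hx

theorem hom_mem_afn {n : ℕ} {F : (ι → ℝ) → Alg E O} (hF : Sm F D.B)
    (h : ∀ x ∈ D.B, F x ∈ Fil D.afn n) {x : ι → ℝ} (hx : x ∈ D.B) :
    D.hom F x ∈ Fil D.afn (n + 1) :=
  D.hom_mem_Fil (fun i hi => (D.κ_spec i hi).2.2)
    (fun x hx v u h => (D.g_ne x hx v u h).2.2.2.2) hF h hx

theorem V1_mem {x : ι → ℝ} (hx : x ∈ D.B) (v : E ⊕ O) : D.V1 x v ∈ Fil D.W (D.W v - 1) :=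
  D.lead x hx v

/-- The correction step raises the order. -/
theorem sub_op_hom_mem {n : ℕ} {F : (ι → ℝ) → Alg E O} (hF : Sm F D.B)
    (hpos : ∀ x ∈ D.B, F x ∈ Fil D.afn 1) (hcl : ∀ x ∈ D.B, D.op x (F x) = 0)
    (h : ∀ x ∈ D.B, F x ∈ Fil D.W n) {x : ι → ℝ} (hx : x ∈ D.B) :
    F x - D.op x (D.hom F x) ∈ Fil D.W (n + 1) := by
  set H : (ι → ℝ) → Alg E O := fun y => qop (D.c y) (F y) + D.dy y (F y) with hH
  have h1 : F x - D.op x (D.hom F x) = D.hom H x - kt (D.V1 x) (D.hom F x) := by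
    conv_lhs => rw [← D.homotopy hF hpos hx]
    rw [op, kt_eq]
    abel
  -- Closedness turns the leading part of the operator on `F` into minus the remainder, which costs
  -- at most one order; the homotopy then gains two.
  have h2 : ∀ y ∈ D.B, H y ∈ Fil D.W (n - 1) := by
    intro y hy
    have h3 : H y = -kt (D.V1 y) (F y) := by
      have := hcl y hy
      rw [op, kt_eq] at this
      exact eq_neg_of_add_eq_zero_left this
    rw [h3]
    exact neg_mem (kt_mem_Fil (D.V1_mem hy) (h y hy))
  have hHs : Sm H D.B := (D.smooth_qop D.smooth_c hF).add (D.smooth_dy hF)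
  rw [h1]
  refine sub_mem (Fil_anti _ (by omega) (D.hom_mem_W hHs h2 hx)) ?_
  exact Fil_anti _ (by omega) (kt_mem_Fil (D.V1_mem hx) (D.hom_mem_W hF h hx))

/-- The successive corrections. -/
def iter (F : (ι → ℝ) → Alg E O) : ℕ → (ι → ℝ) → Alg E O
  | 0 => F
  | k + 1 => fun x => iter F k x - D.op x (D.hom (iter F k) x)

theorem iter_spec {F : (ι → ℝ) → Alg E O} (hF : Sm F D.B)
    (hpos : ∀ x ∈ D.B, F x ∈ Fil D.afn 1) (hcl : ∀ x ∈ D.B, D.op x (F x) = 0) (k : ℕ) :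
    Sm (D.iter F k) D.B ∧ (∀ x ∈ D.B, D.iter F k x ∈ Fil D.afn 1) ∧
      (∀ x ∈ D.B, D.op x (D.iter F k x) = 0) ∧ ∀ x ∈ D.B, D.iter F k x ∈ Fil D.W k := by
  induction k with
  | zero => exact ⟨hF, hpos, hcl, fun x _ => Fil_zero _ _⟩
  | succ k ih =>
    obtain ⟨h1, h2, h3, h4⟩ := ih
    refine ⟨h1.sub (D.smooth_op (D.smooth_hom h1)), fun x hx => ?_, fun x hx => ?_, fun x hx => ?_⟩
    -- Positivity persists: the homotopy raises the antifield number by at least one and the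
    -- operator lowers it by at most one.
    · exact sub_mem (h2 x hx) (kt_mem_Fil (D.afn_V x hx) (D.hom_mem_afn h1 h2 hx))
    · change D.op x (_ - _) = 0
      rw [map_sub, h3 x hx, op, D.sq_zero x hx, sub_zero]
    · exact D.sub_op_hom_mem h1 h2 h3 h4 hx

theorem iter_eq (F : (ι → ℝ) → Alg E O) (k : ℕ) (x : ι → ℝ) :
    D.iter F k x = F x - D.op x (∑ j ∈ Finset.range k, D.hom (D.iter F j) x) := by
  induction k with
  | zero => simp [iter]
  | succ k ih =>
    change D.iter F k x - D.op x (D.hom (D.iter F k) x) = _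
    rw [Finset.sum_range_succ, map_add, ih]
    abel

/-- Closed functions of positive antifield number are exact. -/
theorem acyclic {F : (ι → ℝ) → Alg E O} (hF : Sm F D.B)
    (hpos : ∀ x ∈ D.B, F x ∈ Fil D.afn 1) (hcl : ∀ x ∈ D.B, D.op x (F x) = 0) :
    ∃ G : (ι → ℝ) → Alg E O, Sm G D.B ∧ ∀ x ∈ D.B, F x = D.op x (G x) := by
  obtain ⟨N, hN⟩ := exists_coeff_eq_zero_of_mem_Fil D.W
  have hs := D.iter_spec hF hpos hcl
  have hmem : ∀ k, ∀ x ∈ D.B, D.hom (D.iter F k) x ∈ Fil D.W k := fun k x hx =>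
    Fil_anti _ (by omega) (D.hom_mem_W (hs k).1 (hs k).2.2.2 hx)
  -- The infinite sum of corrections, cut in each coefficient `e` at `N e`, beyond which every
  -- correction contributes zero there.
  set G : (ι → ℝ) → Alg E O := fun x e =>
    ∑ k ∈ Finset.range (N e), coeff e (D.hom (D.iter F k) x) with hG
  have hGc : ∀ x e, coeff e (G x) = ∑ k ∈ Finset.range (N e), coeff e (D.hom (D.iter F k) x) :=
    fun _ _ => rfl
  refine ⟨G, fun e => ?_, fun x hx => ?_⟩
  · exact SmL.congr (SmL.sum _ fun k _ => (D.smooth_hom (hs k).1).coeff e) fun x _ => hGc x e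
  · have hd : ∀ m, G x - ∑ k ∈ Finset.range m, D.hom (D.iter F k) x ∈ Fil D.W m := by
      intro m e
      rw [map_sub, map_sum, hGc]
      rcases le_total (N e) m with h | h
      · rw [← Finset.sum_range_add_sum_Ico _ h, sub_add_cancel_left, Finset.sum_eq_zero, neg_zero]
        · exact zero_mem _
        · intro k hk
          exact hN e k (Finset.mem_Ico.mp hk).1 _ (hmem k x hx)
      · rw [← Finset.sum_range_add_sum_Ico _ h, add_sub_cancel_left]
        refine Submodule.sum_mem _ fun k hk => ?_
        exact Fil_anti _ (Finset.mem_Ico.mp hk).1 (hmem k x hx) e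
    rw [← sub_eq_zero]
    refine eq_zero_of_forall_mem_Fil D.W fun n => ?_
    -- A crude bound on the order lost by the operator; any finite loss suffices since `G` agrees
    -- with the partial sums to arbitrary order.
    set r := ∑ v, D.W v with hr
    have hV : ∀ v, D.V v x ∈ Fil D.W (D.W v - r) := fun v => by
      have : D.W v ≤ r := Finset.single_le_sum (fun _ _ => Nat.zero_le _) (Finset.mem_univ v)
      rw [Nat.sub_eq_zero_of_le this]
      exact Fil_zero _ _
    have h1 := kt_mem_Fil hV (hd (n + r))
    have h2 := D.iter_eq F (n + r) x
    have h3 := (hs (n + r)).2.2.2 x hx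
    rw [h2] at h3
    have h4 : F x - D.op x (G x) = (F x - D.op x (∑ j ∈ Finset.range (n + r),
        D.hom (D.iter F j) x)) - D.op x (G x - ∑ k ∈ Finset.range (n + r), D.hom (D.iter F k) x) := by
      rw [map_sub]; abel
    rw [h4]
    exact sub_mem (Fil_anti _ (by omega) h3) (Fil_anti _ (by omega) h1)

end NormalForm

/-! ### Minors, graded inverses and smooth inversion of matrices. -/

section LinearAlgebra

theorem exists_cols {R K : Type} [Fintype R] [Fintype K] (N : Matrix R K ℝ) :
    ∃ A : Finset K, A.card = N.rank ∧
      ∀ v : K → ℝ, (∀ c, c ∉ A → v c = 0) → N.mulVec v = 0 → v = 0 := by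
  obtain ⟨κ, a, ha, hs, hl⟩ := exists_linearIndependent' ℝ N.col
  have : Finite κ := Finite.of_injective a ha
  have := Fintype.ofFinite κ
  refine ⟨Finset.univ.image a, ?_, fun v hv h => ?_⟩
  · rw [Finset.card_image_of_injective _ ha, Finset.card_univ, Matrix.rank_eq_finrank_span_cols,
      ← hs, finrank_span_eq_card hl]
  · have h1 : ∑ k, v (a k) • (N.col ∘ a) k = 0 := by
      rw [← h]
      funext r
      simp only [Finset.sum_apply, Pi.smul_apply, Function.comp, Matrix.col_apply, smul_eq_mul,
        Matrix.mulVec, dotProduct]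
      rw [← Finset.sum_subset (Finset.subset_univ (Finset.univ.image a)),
        Finset.sum_image fun x _ y _ hxy => ha hxy]
      · exact Finset.sum_congr rfl fun k _ => mul_comm _ _
      · intro c _ hc; rw [hv c hc, mul_zero]
    have h2 := Fintype.linearIndependent_iff.mp hl _ h1
    funext c
    by_cases hc : c ∈ Finset.univ.image a
    · obtain ⟨k, -, rfl⟩ := Finset.mem_image.mp hc
      exact h2 k
    · exact hv c hc

/-- A vector orthogonal to a basis of the row space is orthogonal to every row. -/
theorem exists_rows {R K : Type} [Fintype R] [Fintype K] (N : Matrix R K ℝ) :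
    ∃ Y : Finset R, Y.card = N.rank ∧
      ∀ v : K → ℝ, (∀ r ∈ Y, N.mulVec v r = 0) → N.mulVec v = 0 := by
  obtain ⟨κ, a, ha, hs, hl⟩ := exists_linearIndependent' ℝ N.row
  have : Finite κ := Finite.of_injective a ha
  have := Fintype.ofFinite κ
  refine ⟨Finset.univ.image a, ?_, fun v hv => ?_⟩
  · rw [Finset.card_image_of_injective _ ha, Finset.card_univ, Matrix.rank_eq_finrank_span_row,
      ← hs, finrank_span_eq_card hl]
  · have h1 : Submodule.span ℝ (Set.range N.row) ≤ LinearMap.ker (dotProductBilin ℝ ℝ |>.flip v) := by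
      rw [← hs, Submodule.span_le]
      rintro _ ⟨k, rfl⟩
      exact hv (a k) (Finset.mem_image_of_mem a (Finset.mem_univ k))
    funext r
    exact h1 (Submodule.subset_span ⟨r, rfl⟩)

variable {I F : Type} [Fintype I] [Fintype F]

omit [Fintype F] in
/-- Complementary selections of rows and columns of an exact complex give an invertible minor. -/
theorem minor_injective {J : I ⊕ F → I → ℝ} {A : I → Prop} {Y : F → Prop}
    (h1 : ∀ v : I → ℝ, (∀ a, ¬ A a → v a = 0) → (∀ u, ∑ w, J u w * v w = 0) → v = 0)
    (h2 : ∀ v : I → ℝ, (∀ j, Y j → ∑ w, J (Sum.inr j) w * v w = 0) →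
      ∀ j, ∑ w, J (Sum.inr j) w * v w = 0)
    (h3 : ∀ u w, ∑ a, J u a * J (Sum.inl a) w = 0) (v : {a // A a} → ℝ)
    (hv : ∀ u, Sum.elim (fun a => ¬ A a) Y u → ∑ w, J u w.1 * v w = 0) : v = 0 := by
  set v' : I → ℝ := fun a => if h : A a then v ⟨a, h⟩ else 0 with hv'
  have e : ∀ u, ∑ w, J u w * v' w = ∑ w : {a // A a}, J u w.1 * v w := by
    intro u
    rw [← Finset.sum_subset (Finset.subset_univ (Finset.univ.filter A)), ← Finset.sum_subtype_eq_sum_filter]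
    · refine Finset.sum_bij (fun w _ => ⟨w.1, w.2⟩) (by simp) (by simp) (by simp) ?_
      intro w _
      simp [hv', w.2]
    · intro c _ hc
      have : ¬ A c := by simpa using hc
      simp [hv', this]
  have hY := h2 v' fun j hj => by rw [e]; exact hv (Sum.inr j) hj
  -- The image of `v'` is supported on `A` by the choice of rows and killed by the next
  -- differential, so injectivity on `A` annihilates it. The same injectivity then annihilates `v'`.
  have hA : (fun a => ∑ w, J (Sum.inl a) w * v' w) = 0 := by
    refine h1 _ (fun a ha => by rw [e]; exact hv (Sum.inl a) ha) fun u => ?_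
    simp only [Finset.mul_sum]
    rw [Finset.sum_comm]
    refine Finset.sum_eq_zero fun w _ => ?_
    simp only [← mul_assoc]
    rw [← Finset.sum_mul, h3, zero_mul]
  have h0 : v' = 0 := by
    refine h1 _ (fun a ha => by simp [hv', ha]) fun u => ?_
    cases u with
    | inl a => exact congrFun hA a
    | inr j => exact hY j
  funext w
  have := congrFun h0 w.1
  simpa [hv', w.2] using this

/-- A nonzero determinant has a nonzero Leibniz term, and its permutation runs along nonzero
entries. This matches each column with a row of the same level and parity. -/
theorem exists_equiv_of_injective {P U : Type} [Fintype P] [Fintype U]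
    (hcard : Fintype.card P = Fintype.card U) (J : U → P → ℝ)
    (hinj : ∀ v : P → ℝ, (∀ u, ∑ w, J u w * v w = 0) → v = 0) :
    ∃ e : P ≃ U, ∀ w, J (e w) w ≠ 0 := by
  have f := Fintype.equivOfCardEq hcard
  set N : Matrix P P ℝ := Matrix.of fun p q => J (f p) q with hN
  have hdet : N.det ≠ 0 := by
    intro h
    obtain ⟨v, hv, h0⟩ := Matrix.exists_mulVec_eq_zero_iff.mpr h
    refine hv (hinj v fun u => ?_)
    have := congrFun h0 (f.symm u)
    simpa [hN, Matrix.mulVec, dotProduct] using this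
  rw [Matrix.det_apply] at hdet
  obtain ⟨σ, -, hσ⟩ := Finset.exists_ne_zero_of_sum_ne_zero hdet
  refine ⟨σ.trans f, fun w hw => hσ ?_⟩
  rw [Finset.prod_eq_zero (Finset.mem_univ w) (by simpa [hN] using hw), smul_zero]

/-- The inverse of a matrix that preserves a grading preserves it. -/
theorem inv_ne_zero_key {P : Type} [Fintype P] {Q : Matrix P P ℝ} (hdet : Q.det ≠ 0) (key : P → ℕ)
    (hQ : ∀ p q, Q p q ≠ 0 → key p = key q) (p q : P) (h : Q⁻¹ p q ≠ 0) : key p = key q := by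
  have := Q.invertibleOfIsUnitDet (isUnit_iff_ne_zero.mpr hdet)
  by_contra hne
  apply h
  -- A matrix preserving the grading is block triangular for both orders of the grades, and so is
  -- its inverse.
  rcases lt_or_gt_of_ne hne with hlt | hlt
  · refine (Matrix.blockTriangular_inv_of_blockTriangular (b := fun p => OrderDual.toDual (key p))
      (M := Q) ?_) (by simpa using hlt)
    intro i j hij
    by_contra hc
    exact absurd (hQ i j hc) (by have : key i < key j := hij; omega)
  · refine (Matrix.blockTriangular_inv_of_blockTriangular (b := key) (M := Q) ?_) hlt
    intro i j hij
    by_contra hc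
    exact absurd (hQ i j hc) (by omega)

/-- The matrix `Q` moved along two maps of its index set. -/
def incidence {P S : Type} [Fintype P] (a b : P → S) (Q : Matrix P P ℝ) : Matrix S S ℝ :=
  Matrix.of fun s t => ∑ p, ∑ q, if s = a p ∧ t = b q then Q p q else 0

section Incidence
variable {P S : Type} [Fintype P] {a b : P → S}

theorem exists_of_incidence_ne_zero {Q : Matrix P P ℝ} {s t : S} (h : incidence a b Q s t ≠ 0) :
    ∃ p q, s = a p ∧ t = b q ∧ Q p q ≠ 0 := by
  obtain ⟨p, -, hp⟩ := Finset.exists_ne_zero_of_sum_ne_zero h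
  obtain ⟨q, -, hq⟩ := Finset.exists_ne_zero_of_sum_ne_zero hp
  split_ifs at hq with h1
  · exact ⟨p, q, h1.1, h1.2, hq⟩
  · exact absurd rfl hq

theorem incidence_apply (ha : Function.Injective a) (hb : Function.Injective b)
    (Q : Matrix P P ℝ) (p q : P) : incidence a b Q (a p) (b q) = Q p q := by
  simp only [incidence, Matrix.of_apply, ha.eq_iff, hb.eq_iff]
  rw [Finset.sum_eq_single p, Finset.sum_eq_single q]
  · simp
  · intro b' _ hb'; simp [Ne.symm hb']
  · simp
  · intro a' _ ha'; simp [Ne.symm ha']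
  · simp

/-- Each factor is the matrix conjugated by indicator matrices of the two embeddings; the inner
indicators compose to the identity by injectivity of `b`. -/
theorem incidence_mul [Fintype S] (hb : Function.Injective b)
    (Q R : Matrix P P ℝ) (hQR : Q * R = 1) (ha : Function.Injective a) :
    incidence a b Q * incidence b a R
      = Matrix.diagonal fun s => if ∃ p, a p = s then (1 : ℝ) else 0 := by
  unfold incidence
  have h1 : ∀ (a b : P → S) (Q : Matrix P P ℝ),
      (Matrix.of fun s t => ∑ p, ∑ q, if s = a p ∧ t = b q then Q p q else 0)
      = (Matrix.of fun s p => if s = a p then (1 : ℝ) else 0) * Q *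
        (Matrix.of fun q t => if t = b q then (1 : ℝ) else 0) := by
    intro a b Q
    ext s t
    simp only [Matrix.of_apply, Matrix.mul_apply, Finset.sum_mul]
    rw [Finset.sum_comm]
    refine Finset.sum_congr rfl fun p _ => Finset.sum_congr rfl fun q _ => ?_
    by_cases h1 : s = a q <;> by_cases h2 : t = b p <;> simp [h1, h2]
  have h2 : (Matrix.of fun q t => if t = b q then (1 : ℝ) else 0 : Matrix P S ℝ) *
      (Matrix.of fun s p => if s = b p then (1 : ℝ) else 0) = 1 := by
    ext p q
    simp only [Matrix.of_apply, Matrix.mul_apply, Matrix.one_apply]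
    rw [Finset.sum_eq_single (b p)]
    · simp [hb.eq_iff]
    · intro s _ hs; simp [hs]
    · simp
  rw [h1, h1]
  simp only [Matrix.mul_assoc]
  rw [← Matrix.mul_assoc _ _ (R * _), h2, Matrix.one_mul, ← Matrix.mul_assoc Q, hQR, Matrix.one_mul]
  ext s t
  simp only [Matrix.of_apply, Matrix.mul_apply, Matrix.diagonal_apply]
  by_cases hs : ∃ p, a p = s
  · obtain ⟨p, rfl⟩ := hs
    rw [Finset.sum_eq_single p]
    · simp [eq_comm]
    · intro q _ hq; simp [ha.eq_iff, Ne.symm hq]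
    · simp
  · rw [Finset.sum_eq_zero]
    · simp [hs]
    · intro p _
      have : s ≠ a p := fun h => hs ⟨p, h.symm⟩
      simp [this]

theorem incidence_inv [Fintype S] (ha : Function.Injective a) (hb : Function.Injective b)
    (hab : ∀ p q, a p ≠ b q) {lin : S → Prop} (hlin : ∀ s, lin s ↔ (∃ p, a p = s) ∨ ∃ q, b q = s)
    {Q : Matrix P P ℝ} (hQ : Q.det ≠ 0) :
    incidence a b Q * incidence b a Q⁻¹ + incidence b a Q⁻¹ * incidence a b Q
      = Matrix.diagonal fun s => (((if lin s then 1 else 0 : ℕ)) : ℝ) := by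
  have hu : IsUnit Q.det := isUnit_iff_ne_zero.mpr hQ
  rw [incidence_mul hb _ _ (Matrix.mul_nonsing_inv _ hu) ha,
    incidence_mul ha _ _ (Matrix.nonsing_inv_mul _ hu) hb, Matrix.diagonal_add]
  congr 1
  funext s
  have := hlin s
  by_cases h1 : ∃ p, a p = s <;> by_cases h2 : ∃ q, b q = s
  · obtain ⟨p, rfl⟩ := h1
    obtain ⟨q, h2⟩ := h2
    exact absurd h2.symm (hab p q)
  all_goals simp [this, h1, h2]

variable {X : Type} [NormedAddCommGroup X] [NormedSpace ℝ X] {V : Set X} {N : X → Matrix P P ℝ}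

theorem contDiffOn_incidence (h : ∀ p q, ContDiffOn ℝ ∞ (fun x => N x p q) V) (s t : S) :
    ContDiffOn ℝ ∞ (fun x => incidence a b (N x) s t) V := by
  refine ContDiffOn.sum fun p _ => ContDiffOn.sum fun q _ => ?_
  split_ifs
  · exact h p q
  · exact contDiffOn_const

theorem contDiffOn_det (h : ∀ p q, ContDiffOn ℝ ∞ (fun x => N x p q) V) :
    ContDiffOn ℝ ∞ (fun x => (N x).det) V := by
  simp only [Matrix.det_apply']
  exact ContDiffOn.sum fun τ _ => contDiffOn_const.mul (contDiffOn_prod fun i _ => h _ _)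

theorem contDiffOn_inv (h : ∀ p q, ContDiffOn ℝ ∞ (fun x => N x p q) V)
    (hdet : ∀ x ∈ V, (N x).det ≠ 0) (p q : P) : ContDiffOn ℝ ∞ (fun x => (N x)⁻¹ p q) V := by
  -- Cramer's rule expresses the entry through determinants, hence smoothly.
  have e : ∀ x, (N x)⁻¹ p q = (N x).det⁻¹ * ((N x).updateRow q (Pi.single p 1)).det := by
    intro x
    rw [Matrix.inv_def, Matrix.smul_apply, Matrix.adjugate_apply, Ring.inverse_eq_inv', smul_eq_mul]
  simp only [e]
  refine ((contDiffOn_det h).inv hdet).mul (contDiffOn_det fun i j => ?_)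
  simp only [Matrix.updateRow_apply]
  split_ifs
  · exact contDiffOn_const
  · exact h _ _

end Incidence

end LinearAlgebra

/-! ### Dictionary between fields, ghosts, antifields and generic variables. -/

section Variables
variable {C : FieldContent}

/-- Auxiliary variables and odd original fields, sorted by Grassmann parity. -/
def vars : C.Aux ⊕ C.OddField ≃ C.EvenAux ⊕ C.OddVar :=
  ((Equiv.sumCompl fun v : C.Aux => C.auxParity v = 0).symm.sumCongr (Equiv.refl _)).trans
    ((Equiv.sumAssoc _ _ _).trans ((Equiv.refl _).sumCongr (Equiv.sumComm _ _)))

theorem vars_even {v : C.Aux} (h : C.auxParity v = 0) : vars (Sum.inl v) = Sum.inl ⟨v, h⟩ := by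
  have e : (Equiv.sumCompl fun v : C.Aux => C.auxParity v = 0).symm v = Sum.inl ⟨v, h⟩ := by
    rw [Equiv.symm_apply_eq]; rfl
  simp [vars, e]

theorem vars_odd {v : C.Aux} (h : C.auxParity v ≠ 0) :
    vars (Sum.inl v) = Sum.inr (Sum.inr ⟨v, h⟩) := by
  have e : (Equiv.sumCompl fun v : C.Aux => C.auxParity v = 0).symm v = Sum.inr ⟨v, h⟩ := by
    rw [Equiv.symm_apply_eq]; rfl
  simp [vars, e]

theorem vars_field (j : C.OddField) : vars (Sum.inr j) = Sum.inr (Sum.inl j) := rfl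

theorem isRight_vars {v : C.Aux} :
    (vars (C := C) (Sum.inl v)).isRight = true ↔ C.auxParity v ≠ 0 := by
  by_cases h : C.auxParity v = 0
  · simp [vars_even h, h]
  · simp [vars_odd h, h]

theorem auxVar_eq (v : C.Aux) : auxVar v = mv (vars (Sum.inl v)) := by
  by_cases h : C.auxParity v = 0
  · rw [auxVar, dif_pos h, vars_even h]; rfl
  · rw [auxVar, dif_neg h, vars_odd h]
    simp only [mv, th]
    congr!

theorem auxDeriv_eq (v : C.Aux) (f : C.FullAlg) : auxDeriv v f = dv (vars (Sum.inl v)) f := by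
  by_cases h : C.auxParity v = 0
  · rw [auxDeriv, dif_pos h, vars_even h]; rfl
  · rw [auxDeriv, dif_neg h, vars_odd h]; rfl

/-- The variable of an antifield. -/
def av (a : C.Anti) : C.EvenAux ⊕ C.OddVar := vars (Sum.inl (Sum.inr a))

/-- A function on all variables given by its values on antifields and odd original fields, and
zero on ghosts. -/
def onVars {β : Type} [Zero β] (f : C.Anti → β) (g : C.OddField → β) (v : C.EvenAux ⊕ C.OddVar) : β :=
  Sum.elim (Sum.elim (fun _ => 0) f) g (vars.symm v)

section onVars
variable {β : Type} [Zero β] (f : C.Anti → β) (g : C.OddField → β)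

@[simp] theorem onVars_av (a : C.Anti) : onVars f g (av a) = f a := by simp [onVars, av]

@[simp] theorem onVars_vars_anti (a : C.Anti) : onVars f g (vars (Sum.inl (Sum.inr a))) = f a := by
  simp [onVars]

@[simp] theorem onVars_field (j : C.OddField) : onVars f g (vars (Sum.inr j)) = g j := by
  simp [onVars]

@[simp] theorem onVars_ghost (c : C.Ghost) : onVars f g (vars (Sum.inl (Sum.inl c))) = 0 := by
  simp [onVars]

end onVars

theorem av_injective : Function.Injective (av (C := C)) := fun a b h => by simpa [av] using h

theorem antifield_eq (a : C.Anti) : antifield a = mv (av a) := auxVar_eq _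

theorem antiDeriv_eq (a : C.Anti) (f : C.FullAlg) : antiDeriv a f = dv (av a) f := auxDeriv_eq _ _

theorem sum_vars {M : Type*} [AddCommMonoid M] (f : C.EvenAux ⊕ C.OddVar → M) :
    ∑ v, f v = (∑ c : C.Ghost, f (vars (Sum.inl (Sum.inl c))) + ∑ a : C.Anti, f (av a)) +
      ∑ j : C.OddField, f (vars (Sum.inr j)) := by
  rw [← Equiv.sum_comp vars f, Fintype.sum_sum_type, Fintype.sum_sum_type]
  rfl

theorem vars_cases {P : C.EvenAux ⊕ C.OddVar → Prop}
    (hg : ∀ c : C.Ghost, P (vars (Sum.inl (Sum.inl c)))) (ha : ∀ a, P (av a))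
    (ho : ∀ j : C.OddField, P (vars (Sum.inr j))) (v : C.EvenAux ⊕ C.OddVar) : P v := by
  obtain ⟨u, rfl⟩ := vars.surjective v
  rcases u with (c | a) | j
  exacts [hg c, ha a, ho j]

theorem koszulTate_eq (V : C.Anti → C.Pt → C.FullAlg) (F : C.Pt → C.FullAlg) (x : C.Pt) :
    koszulTate V F x = kt (onVars (fun a => V a x) 0) (F x) := by
  rw [koszulTate, kt_apply, sum_vars]
  simp [antiDeriv_eq]

theorem sum_antifield (r : C.Anti → ℕ) (f : C.FullAlg) :
    ∑ a : C.Anti, (r a : ℝ) • (antifield a * antiDeriv a f) =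
      diag (fun μ => (wt (onVars r 0) μ : ℝ)) f := by
  rw [← sum_lmv_dv, sum_vars]
  simp [antiDeriv_eq, antifield_eq, mv_mul]

end Variables

/-! ### Comparison of weights and detection of filtration order. -/

section Filtration
variable {E O : Type} [Fintype O]

theorem mem_Fil_of_diag_eq_zero {w : E ⊕ O → ℕ} {n : ℕ} {f : Alg E O}
    (h : diag (fun μ => if wt w μ < n then 1 else 0) f = 0) : f ∈ Fil w n := by
  rw [mem_Fil_iff]
  intro a ha
  have e : a = a * fun μ => if wt w μ < n then 1 else 0 := by
    funext μ
    rcases lt_or_ge (wt w μ) n with h | h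
    · simp [h]
    · simp [ha μ h]
  rw [e, ← diag_diag, h, map_zero]

omit [Fintype O] in
theorem wt_mono {w w' : E ⊕ O → ℕ} (h : ∀ v, w v ≤ w' v) (μ : Mo E O) : wt w μ ≤ wt w' μ := by
  unfold wt
  simp only [Finsupp.weight_apply]
  exact add_le_add (Finsupp.sum_le_sum fun i _ => Nat.mul_le_mul_left _ (h _))
    (Finsupp.sum_le_sum fun i _ => Nat.mul_le_mul_left _ (h _))

theorem Fil_mono {w w' : E ⊕ O → ℕ} (h : ∀ v, w v ≤ w' v) {n : ℕ} {f : Alg E O}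
    (hf : f ∈ Fil w n) : f ∈ Fil w' n :=
  mem_Fil_iff.mpr fun _ ha => diag_eq_zero hf fun μ hμ => ha μ (hμ.trans (wt_mono h μ))

/-- Order at least one only records that each monomial contains a variable of nonzero weight, so
only the support of the weight matters. -/
theorem mem_Fil_of_wt_pos {w w' : E ⊕ O → ℕ} (h : ∀ v, w v ≠ 0 → w' v ≠ 0) {f : Alg E O}
    (hf : f ∈ Fil w 1) : f ∈ Fil w' 1 := by
  refine mem_Fil_iff.mpr fun a ha => diag_eq_zero hf fun μ hμ => ha μ ?_
  by_contra h0
  have h0 : wt w' μ = 0 := by omega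
  simp only [wt, Finsupp.weight_apply, Finsupp.sum, add_eq_zero, Finset.sum_eq_zero_iff,
    Finsupp.mem_support_iff, smul_eq_mul, mul_eq_zero] at h0
  have : wt w μ = 0 := by
    simp only [wt, Finsupp.weight_apply, Finsupp.sum, add_eq_zero, Finset.sum_eq_zero_iff,
      Finsupp.mem_support_iff, smul_eq_mul, mul_eq_zero]
    refine ⟨fun i hi => ?_, fun i hi => ?_⟩
    · have := h (Sum.inl i); have := h0.1 i hi; simp only [Function.comp] at *; tauto
    · have := h (Sum.inr i); have := h0.2 i hi; simp only [Function.comp] at *; tauto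
  omega

/-- Eigenvectors of the Euler operator are homogeneous. -/
theorem mem_Fil_of_euler {w : E ⊕ O → ℕ} {n : ℕ} {f : Alg E O}
    (h : diag (fun μ => (wt w μ : ℝ)) f = (n : ℝ) • f) : f ∈ Fil w n := by
  rw [mem_Fil_iff]
  intro a ha
  have h1 : diag ((fun μ => (wt w μ : ℝ)) + (-(n : ℝ)) • fun _ => 1) f = 0 := by
    rw [diag_add, diag_smul, diag_one, h, neg_smul, add_neg_cancel]
  -- Off the eigenvalue `n` the shifted Euler operator is invertible, and `a` is supported there.
  have e : a = (fun μ => a μ * ((wt w μ : ℝ) - n)⁻¹) *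
      ((fun μ => (wt w μ : ℝ)) + (-(n : ℝ)) • fun _ => 1) := by
    funext μ
    by_cases h2 : a μ = 0
    · simp [h2]
    · have h3 : (wt w μ : ℝ) - n ≠ 0 := by
        intro h4
        refine h2 (ha μ ?_)
        have : (wt w μ : ℝ) = n := by linarith
        exact (by exact_mod_cast this.symm : n = wt w μ).le
      simp only [Pi.mul_apply, Pi.add_apply, Pi.smul_apply, smul_eq_mul, mul_one]
      field_simp
      ring
  rw [e, ← diag_diag, h1, map_zero]


theorem map_eq_diagLam (w : O → ℕ) (φ : (O → ℝ) →ₗ[ℝ] (O → ℝ))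
    (hφ : ∀ g o, φ g o = if w o = 0 then g o else 0) (x : Lam O) :
    ExteriorAlgebra.map φ x = diagLam (fun ν => if Finsupp.weight w ν = 0 then 1 else 0) x := by
  induction x using Lam.induction with
  | h0 r => simp [diagLam_algebraMap]
  | hadd x y hx hy => rw [map_add, map_add, hx, hy]
  | hmul o x hx =>
    have h1 : ExteriorAlgebra.map φ (th o) = if w o = 0 then th o else 0 := by
      unfold th
      rw [ExteriorAlgebra.map_apply_ι]
      split_ifs with h
      · congr 1
        funext o'
        rw [hφ]
        by_cases h' : o' = o
        · subst h'; simp [h]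
        · simp [h']
      · rw [← map_zero (ExteriorAlgebra.ι ℝ)]
        congr 1
        funext o'
        rw [hφ]
        by_cases h' : o' = o
        · subst h'; simp [h]
        · simp [h']
    rw [map_mul, hx, h1, diagLam_th_mul]
    split_ifs with h
    · simp [Finsupp.weight_single, h]
    · have : (fun ν : O →₀ ℕ =>
          if (Finsupp.weight w) (ν + Finsupp.single o 1) = 0 then (1 : ℝ) else 0)
          = (0 : ℝ) • fun _ => 1 := by
        funext ν; simp [Finsupp.weight_single, h]
      rw [this, diagLam_smul]
      simp

end Filtration

/-! ### Antifield conditions as filtration orders. -/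

section Antifields
variable {C : FieldContent}

/-- The weight that counts antifields. -/
def antiCount : C.EvenAux ⊕ C.OddVar → ℕ := onVars (fun _ => 1) 0

theorem antiCount_inl (v : C.EvenAux) :
    antiCount (C := C) (Sum.inl v) = if v.1.isRight = true then 1 else 0 := by
  rcases v with ⟨c | a, h⟩
  · rw [← vars_even h]; simp [antiCount]
  · rw [← vars_even h]; simp [antiCount]

theorem antiCount_odd (v : C.OddAux) :
    antiCount (C := C) (Sum.inr (Sum.inr v)) = if v.1.isRight = true then 1 else 0 := by
  rcases v with ⟨c | a, h⟩
  · rw [← vars_odd h]; simp [antiCount]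
  · rw [← vars_odd h]; simp [antiCount]

theorem antiCount_field (j : C.OddField) : antiCount (C := C) (Sum.inr (Sum.inl j)) = 0 := by
  rw [← vars_field j]; simp [antiCount]

theorem atZeroAnti_eq (f : C.FullAlg) :
    atZeroAnti f = diag (fun μ => if wt antiCount μ = 0 then 1 else 0) f := by
  ext1 e
  rw [coeff_diag, atZeroAnti, coeff_ofCoeff]
  have h1 : (∀ v : C.EvenAux, v.1.isRight = true → e v = 0) ↔
      Finsupp.weight (antiCount (C := C) ∘ Sum.inl) e = 0 := by
    rw [Finsupp.weight_apply, Finsupp.sum, Finset.sum_eq_zero_iff]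
    refine forall_congr' fun v => ?_
    simp only [Finsupp.mem_support_iff, Function.comp, antiCount_inl, smul_eq_mul]
    by_cases h : v.1.isRight = true <;> simp [h]
  split_ifs with h
  · rw [map_eq_diagLam (antiCount (C := C) ∘ Sum.inr)]
    · simp only [wt, h1.mp h, zero_add]
    · rintro g (j | v)
      · simp [antiCount_field]
      · by_cases hv : v.1.isRight = true <;> simp [antiCount_odd, hv]
  · have h2 : (fun ν => if wt antiCount (e, ν) = 0 then (1 : ℝ) else 0) =
        (0 : ℝ) • fun _ => 1 := by
      funext ν
      have : wt (antiCount (C := C)) (e, ν) ≠ 0 := by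
        rw [h1] at h
        unfold wt
        dsimp only
        omega
      simp [this]
    rw [h2, diagLam_smul, zero_smul]

theorem PosAfn.mem_Fil {f : C.FullAlg} (h : PosAfn f) : f ∈ Fil antiCount 1 := by
  refine mem_Fil_of_diag_eq_zero ?_
  rw [PosAfn, atZeroAnti_eq] at h
  simpa only [Nat.lt_one_iff] using h

theorem HasAfn.mem_Fil {f : C.FullAlg} {r : ℕ} (h : HasAfn f r) :
    f ∈ Fil (onVars C.antiAfn 0) r := by
  refine mem_Fil_of_euler ?_
  rw [← sum_antifield]
  exact h

theorem AntiQuadratic.mem_Fil {f : C.FullAlg} (h : AntiQuadratic f) : f ∈ Fil antiCount 2 := by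
  refine mem_Fil_of_diag_eq_zero ?_
  obtain ⟨h0, h1⟩ := h
  -- The part linear in the antifields: its antifield derivatives vanish, yet the Euler operator
  -- counting antifields acts on it as the identity, so it is zero.
  set g := diag (fun μ => if wt antiCount μ = 1 then 1 else 0) f with hg
  have h2 : ∀ a, dv (av a) g = 0 := by
    intro a
    have h3 := h1 a
    rw [atZeroAnti_eq, antiDeriv_eq] at h3
    rw [hg, dv_diag, ← h3]
    congr 2
    funext μ
    have : antiCount (C := C) (av a) = 1 := by simp [antiCount]
    rw [wt_add_sv, this]
    split_ifs <;> first | rfl | omega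
  have h4 := sum_antifield (fun _ => 1) g
  simp only [antiDeriv_eq, h2, mul_zero, smul_zero, Finset.sum_const_zero] at h4
  have h5 : diag (fun μ => (wt (antiCount (C := C)) μ : ℝ)) g = g := by
    rw [hg, diag_diag]
    congr 2
    funext μ
    simp only [Pi.mul_apply]
    split_ifs with h
    · simp [h]
    · simp
  have h6 : g = 0 := by rw [← h5, antiCount, ← h4]
  rw [atZeroAnti_eq] at h0
  have h7 : (fun μ : Mo C.EvenAux C.OddVar => if wt antiCount μ < 2 then (1 : ℝ) else 0)
      = (fun μ => if wt antiCount μ = 0 then 1 else 0) +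
        fun μ => if wt antiCount μ = 1 then 1 else 0 := by
    funext μ
    simp only [Pi.add_apply]
    rcases h : wt antiCount μ with _ | _ | n <;> simp
  rw [h7, diag_add, h0, ← hg, h6, add_zero]

end Antifields

/-! ### The body map and Grassmann parity. -/

section Body
variable {C : FieldContent}

theorem body_algebraMap (r : ℝ) : body (C := C) (algebraMap ℝ _ r) = r :=
  ExteriorAlgebra.algebraMap_leftInverse _ r

theorem body_th (o : C.OddField) : body (C := C) (th o) = 0 := by
  simp [body, th, ExteriorAlgebra.algebraMapInv]

theorem body_th_mul (o : C.OddField) (x : C.FieldAlg) : body (th o * x) = 0 := by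
  rw [body, map_mul]
  have := body_th o
  rw [body] at this
  rw [this, zero_mul]

theorem body_mul_th (o : C.OddField) (x : C.FieldAlg) : body (x * th o) = 0 := by
  rw [body, map_mul]
  have := body_th o
  rw [body] at this
  rw [this, mul_zero]

/-- The body as a linear functional. -/
def bodyLin : Module.Dual ℝ C.FieldAlg := ExteriorAlgebra.algebraMapInv.toLinearMap

theorem bodyLin_apply (f : C.FieldAlg) : bodyLin f = body f := rfl

theorem body_add (f g : C.FieldAlg) : body (f + g) = body f + body g := bodyLin.map_add f g

theorem involute_th_mul {O : Type} (o : O) (x : Lam O) :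
    CliffordAlgebra.involute (th o * x) = -(th o * CliffordAlgebra.involute x) := by
  rw [map_mul, ← neg_mul]
  congr 1
  exact CliffordAlgebra.involute_ι _

theorem reverse_th_mul {O : Type} (o : O) (x : Lam O) :
    CliffordAlgebra.reverse (th o * x) = CliffordAlgebra.reverse x * th o := by
  rw [CliffordAlgebra.reverse.map_mul]
  congr 1
  exact CliffordAlgebra.reverse_ι _

theorem involute_dth {O : Type} [Fintype O] (o : O) (x : Lam O) :
    CliffordAlgebra.involute (dth o x) = -dth o (CliffordAlgebra.involute x) := by
  induction x using Lam.induction with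
  | h0 r => rw [dth_algebraMap, AlgHom.commutes, dth_algebraMap]; simp
  | hadd x y hx hy => simp only [map_add, hx, hy, neg_add]
  | hmul o' x hx =>
    rw [involute_th_mul, map_neg, dth_th_mul, dth_th_mul, map_sub, involute_th_mul, hx]
    split_ifs <;> simp

theorem body_involute (x : C.FieldAlg) : body (CliffordAlgebra.involute x) = body x := by
  induction x using Lam.induction with
  | h0 r => rw [AlgHom.commutes]
  | hadd x y hx hy => rw [map_add, body_add, body_add, hx, hy]
  | hmul o x hx =>
    rw [involute_th_mul, body_th_mul, ← mul_neg, body_th_mul]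

theorem body_reverse (x : C.FieldAlg) : body (CliffordAlgebra.reverse x) = body x := by
  induction x using Lam.induction with
  | h0 r => rw [CliffordAlgebra.reverse.commutes]
  | hadd x y hx hy => rw [map_add, body_add, body_add, hx, hy]
  | hmul o x hx => rw [reverse_th_mul, body_th_mul, body_mul_th]

theorem body_eq_zero_of_odd {f : C.FieldAlg} (h : FieldHasParity f 1) : body f = 0 := by
  have h1 := body_involute f
  rw [CliffordAlgebra.involute_eq_of_mem_odd h, ← bodyLin_apply, map_neg, bodyLin_apply] at h1
  linarith

/-- The grade involution preserves bodies but changes the sign of an odd derivative of an even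
element. -/
theorem body_dth_of_even {f : C.FieldAlg} (h : FieldHasParity f 0) (o : C.OddField) :
    body (dth o f) = 0 := by
  have h1 := body_involute (dth o f)
  rw [involute_dth, CliffordAlgebra.involute_eq_of_mem_even h, ← bodyLin_apply, map_neg,
    bodyLin_apply] at h1
  linarith

theorem contractRight_eq_dth (o : C.OddField) (f : C.FieldAlg) :
    CliffordAlgebra.contractRight f
      (LinearMap.proj (R := ℝ) (φ := fun _ : C.OddField => ℝ) o)
      = CliffordAlgebra.reverse (dth o (CliffordAlgebra.reverse f)) :=
  CliffordAlgebra.contractRight_eq _ _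

theorem body_contractRight_of_even {f : C.FieldAlg} (h : FieldHasParity f 0) (o : C.OddField) :
    body (CliffordAlgebra.contractRight f
      (LinearMap.proj (R := ℝ) (φ := fun _ : C.OddField => ℝ) o)) = 0 := by
  rw [contractRight_eq_dth, body_reverse]
  exact body_dth_of_even ((CliffordAlgebra.reverse_mem_evenOdd_iff _).mpr h) o

end Body

/-! ### Field derivatives and the Hessian. -/

section FieldDerivatives
variable {C : FieldContent} {U : Set C.Pt} {F : C.Pt → C.FieldAlg}

theorem dual_evenFieldDeriv (hU : IsOpen U) (hF : FieldSmoothOn F U) (i : C.EvenField)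
    (l : Module.Dual ℝ C.FieldAlg) {x : C.Pt} (hx : x ∈ U) :
    l (evenFieldDeriv i F x) = pd i (fun y => l (F y)) x := by
  set b := (Pi.basisFun ℝ C.OddField).ExteriorAlgebra with hb
  have h : (fun y => l (F y)) = fun y => ∑ j, b.repr (F y) j * l (b j) := by
    funext y
    conv_lhs => rw [← b.sum_repr (F y)]
    simp only [map_sum, map_smul, smul_eq_mul]
  rw [h, (isOp_pd hU i).sum Finset.univ (fun j => l (b j)) (fun j y => b.repr (F y) j)
    (fun j _ => hF (b.coord j)) x hx]
  rw [evenFieldDeriv, map_sum]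
  refine Finset.sum_congr rfl fun j _ => ?_
  rw [map_smul, smul_eq_mul]
  unfold pd
  congr!

theorem smooth_evenFieldDeriv (hU : IsOpen U) (hF : FieldSmoothOn F U) (i : C.EvenField) :
    FieldSmoothOn (evenFieldDeriv i F) U := fun l =>
  ((isOp_pd hU i).smooth _ (hF l)).congr fun _ hx => dual_evenFieldDeriv hU hF i l hx

theorem smooth_fieldRightDeriv (hU : IsOpen U) (hF : FieldSmoothOn F U) (i : Fin (C.m 0)) :
    FieldSmoothOn (fieldRightDeriv i F) U := by
  unfold fieldRightDeriv
  by_cases h : C.ε 0 i = 0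
  · simp only [dif_pos h]
    exact smooth_evenFieldDeriv hU hF _
  · simp only [dif_neg h]
    exact fun l => hF (l.comp (CliffordAlgebra.contractRight.flip
      (LinearMap.proj (R := ℝ) (φ := fun _ : C.OddField => ℝ) ⟨i, h⟩)))

theorem body_fieldRightDeriv_of_odd {x : C.Pt}
    (hF : FieldHasParity (F x) 0) {i : Fin (C.m 0)} (h : C.ε 0 i ≠ 0) :
    body (fieldRightDeriv i F x) = 0 := by
  rw [fieldRightDeriv, dif_neg h]
  exact body_contractRight_of_even hF _

theorem hessian_of_even (hU : IsOpen U) (hF : FieldSmoothOn F U) {x : C.Pt} (hx : x ∈ U)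
    (j : C.EvenField) (i : Fin (C.m 0)) :
    hessian F x j i = pd j (fun y => body (fieldRightDeriv i F y)) x := by
  rw [hessian, Matrix.of_apply, fieldLeftDeriv, dif_pos j.2]
  exact dual_evenFieldDeriv hU (smooth_fieldRightDeriv hU hF i) j bodyLin hx

theorem hessian_of_odd (x : C.Pt) (j : C.OddField) (i : Fin (C.m 0)) :
    hessian F x j i = body (dth j (fieldRightDeriv i F x)) := by
  rw [hessian, Matrix.of_apply, fieldLeftDeriv, dif_neg j.2]
  rfl

theorem smooth_hessian (hU : IsOpen U) (hF : FieldSmoothOn F U) (j i : Fin (C.m 0)) :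
    ContDiffOn ℝ ∞ (fun x => hessian F x j i) U := by
  by_cases h : C.ε 0 j = 0
  · exact ((isOp_pd hU (⟨j, h⟩ : C.EvenField)).smooth _ (smooth_fieldRightDeriv hU hF i bodyLin)).congr
      fun x hx => hessian_of_even hU hF hx ⟨j, h⟩ i
  · exact ((smooth_fieldRightDeriv hU hF i) (bodyLin.comp (dth ⟨j, h⟩))).congr
      fun x _ => hessian_of_odd x ⟨j, h⟩ i

theorem pd_eq_zero (hU : IsOpen U) (i : C.EvenField) {f : C.Pt → ℝ} (h : ∀ x ∈ U, f x = 0)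
    {x : C.Pt} (hx : x ∈ U) : pd i f x = 0 := by
  rw [(isOp_pd hU i).congr f (fun _ => 0) h x hx]
  simp [pd]

/-- For an even action a mixed second derivative is odd and has no body. In both orders of even and
odd fields the even derivative is a partial derivative of an identically vanishing body. -/
theorem hessian_parity (hU : IsOpen U) (hF : FieldSmoothOn F U)
    (hpar : ∀ x ∈ U, FieldHasParity (F x) 0) {x : C.Pt} (hx : x ∈ U) {j i : Fin (C.m 0)}
    (h : hessian F x j i ≠ 0) : C.ε 0 j = C.ε 0 i := by
  by_contra hne
  apply h
  by_cases hj : C.ε 0 j = 0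
  · have hi : C.ε 0 i ≠ 0 := fun hi => hne (hj.trans hi.symm)
    rw [hessian_of_even hU hF hx ⟨j, hj⟩]
    exact pd_eq_zero hU _ (fun y hy => body_fieldRightDeriv_of_odd (hpar y hy) hi) hx
  · have hi : C.ε 0 i = 0 := by
      generalize C.ε 0 j = a at *
      generalize C.ε 0 i = b at *
      revert a b; decide
    rw [hessian_of_odd x ⟨j, hj⟩, fieldRightDeriv, dif_pos hi]
    have := dual_evenFieldDeriv hU hF ⟨i, hi⟩ (bodyLin.comp (dth ⟨j, hj⟩)) hx
    rw [LinearMap.comp_apply, bodyLin_apply] at this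
    rw [this]
    exact pd_eq_zero hU _ (fun y hy => body_dth_of_even (hpar y hy) _) hx

end FieldDerivatives

/-! ### Taylor expansion of field functions in the odd fields. -/

section Inclusion
variable {C : FieldContent}

theorem incl_algebraMap (r : ℝ) : incl (C := C) (algebraMap ℝ _ r) = r • 1 := by
  simp only [incl, RingHom.comp_apply]
  erw [AlgHom.commutes]
  ext1 e
  rw [coeff_rsmul, MvPowerSeries.coeff_C, MvPowerSeries.coeff_one]
  split_ifs <;> simp [Algebra.algebraMap_eq_smul_one]

theorem incl_th (o : C.OddField) : incl (C := C) (th o) = mv (vars (Sum.inr o)) := by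
  simp only [incl, RingHom.comp_apply, vars_field, mv]
  congr 1
  unfold th
  erw [ExteriorAlgebra.map_apply_ι]
  congr 1
  funext v
  rcases v with v | v
  · simp [Pi.single_apply]
  · simp

/-- The weight that counts antifields and odd original fields. -/
def linCount : C.EvenAux ⊕ C.OddVar → ℕ := onVars (fun _ => 1) fun _ => 1

theorem mv_mem_Fil {E O : Type} [Fintype O] (w : E ⊕ O → ℕ) (v : E ⊕ O) : mv v ∈ Fil w (w v) := by
  rw [← mul_one (mv v), mv_mul]
  simpa using lmv_mem_Fil v (Fil_zero w 1)

theorem incl_sub_body_mem (f : C.FieldAlg) :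
    incl f - body f • (1 : C.FullAlg) ∈ Fil (E := C.EvenAux) (O := C.OddVar) linCount 1 := by
  induction f using Lam.induction with
  | h0 r => rw [incl_algebraMap, body_algebraMap, sub_self]; exact zero_mem _
  | hadd x y hx hy =>
    rw [map_add, body_add, add_smul, add_sub_add_comm]
    exact add_mem hx hy
  | hmul o x hx =>
    rw [map_mul, body_th_mul, zero_smul, sub_zero, incl_th]
    refine Fil_anti _ ?_ (mul_mem_Fil (mv_mem_Fil _ _) (Fil_zero _ _))
    simp [linCount]

/-- First order expansion in the odd fields; multiplying by a generator shifts the expansion, so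
`incl_sub_body_mem` controls the new error. -/
theorem incl_sub_linear_mem (f : C.FieldAlg) :
    incl f - body f • (1 : C.FullAlg) - ∑ o : C.OddField, body (dth o f) • mv (vars (Sum.inr o))
      ∈ Fil (E := C.EvenAux) (O := C.OddVar) linCount 2 := by
  induction f using Lam.induction with
  | h0 r =>
    have : ∀ o : C.OddField, body (C := C) (dth o (algebraMap ℝ _ r)) = 0 := fun o => by
      rw [dth_algebraMap, ← bodyLin_apply, map_zero]
    simp only [this, zero_smul, Finset.sum_const_zero, sub_zero]
    rw [incl_algebraMap, body_algebraMap, sub_self]; exact zero_mem _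
  | hadd x y hx hy =>
    simp only [map_add, body_add, add_smul, Finset.sum_add_distrib]
    rw [add_sub_add_comm, add_sub_add_comm]
    exact add_mem hx hy
  | hmul o x hx =>
    have h : ∀ o' : C.OddField, body (dth o' (th o * x)) = if o' = o then body x else 0 := by
      intro o'
      rw [dth_th_mul, ← bodyLin_apply, map_sub, bodyLin_apply, bodyLin_apply, body_th_mul, sub_zero]
      split_ifs
      · rfl
      · rw [← bodyLin_apply, map_zero]
    simp only [h, ite_smul, zero_smul, Finset.sum_ite_eq', Finset.mem_univ, if_true]
    rw [map_mul, body_th_mul, zero_smul, sub_zero, incl_th]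
    have e : mv (vars (Sum.inr o)) * incl x - body x • mv (vars (Sum.inr o))
        = mv (vars (Sum.inr o)) * (incl x - body x • (1 : C.FullAlg)) := by
      rw [mul_sub, mul_smul_comm, mul_one]
    rw [e]
    refine Fil_anti _ ?_ (mul_mem_Fil (mv_mem_Fil _ _) (incl_sub_body_mem x))
    simp [linCount]

theorem smooth_incl {F : C.Pt → C.FieldAlg} {U : Set C.Pt} (hF : FieldSmoothOn F U) :
    Sm (E := C.EvenAux) (O := C.OddVar) (fun x => incl (F x)) U := by
  intro e l
  simp only [incl, RingHom.comp_apply, MvPowerSeries.coeff_C]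
  split_ifs
  · exact hF (l.comp (AlgHom.toLinearMap (ExteriorAlgebra.map _)))
  · simpa using contDiffOn_const

end Inclusion

/-! ### Reading off constant and linear terms. -/

section LinearParts
variable {E O : Type}

theorem dv_one (v : E ⊕ O) : dv v (1 : Alg E O) = 0 := by
  ext1 e
  cases v with
  | inl v =>
    simp only [dv, coeff_coeffLin, MvPowerSeries.coeff_one, map_zero]
    rw [if_neg, map_zero]
    intro h
    have := DFunLike.congr_fun h v
    simp at this
  | inr o =>
    simp only [dv, coeff_coeffLin, MvPowerSeries.coeff_one, map_zero, id]
    split_ifs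
    · rw [← map_one (algebraMap ℝ (Lam O)), dth_algebraMap]
    · rw [map_zero]

theorem dv_mv (v u : E ⊕ O) : dv v (mv u : Alg E O) = (if v = u then 1 else 0 : ℝ) • 1 := by
  rw [← mul_one (mv u), mv_mul, dv_lmv, dv_one, map_zero, smul_zero, add_zero]
  split_ifs <;> simp

variable [Fintype O]

theorem eq_zero_of_smul_one_mem {w : E ⊕ O → ℕ} {r : ℝ} (h : r • (1 : Alg E O) ∈ Fil w 1) :
    r = 0 := by
  have h1 := diag_eq_zero h (a := fun μ => if μ = 0 then 1 else 0) (by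
    intro μ hμ
    rw [if_neg]
    rintro rfl
    rw [wt_zero] at hμ
    omega)
  have h2 := congrArg (coeff 0) h1
  rw [coeff_diag, coeff_rsmul, MvPowerSeries.coeff_one, if_pos rfl, map_zero,
    ← Algebra.algebraMap_eq_smul_one, diagLam_algebraMap, if_pos (show ((0, 0) : Mo E O) = 0 from rfl), one_mul,
    map_eq_zero_iff _ (ExteriorAlgebra.algebraMap_leftInverse (O → ℝ)).injective] at h2
  exact h2

variable [Fintype E]

theorem kt_mv (V : E ⊕ O → Alg E O) (u : E ⊕ O) : kt V (mv u) = V u := by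
  rw [kt_apply, Finset.sum_eq_single u]
  · simp [dv_mv]
  · intro v _ hv; simp [dv_mv, hv]
  · simp

theorem kt_one (V : E ⊕ O → Alg E O) : kt V 1 = 0 := by simp [kt_apply, dv_one]

end LinearParts

/-! ### The Jacobian and the consequences of nilpotency. -/

/-- An action with reducible gauge generators and higher order remainders near a point, subject to
the rank conditions and with nilpotent Koszul–Tate operator. -/
structure GaugeData (C : FieldContent) where
  U : Set C.Pt
  S₀ : C.Pt → C.FieldAlg
  Z : (s : Fin (C.L + 1)) → C.Pt → Matrix (Fin (C.m s.castSucc)) (Fin (C.m s.succ)) C.FieldAlg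
  M : (s : Fin (C.L + 1)) → Fin (C.m s.succ) → C.Pt → C.FullAlg
  isOpen_U : IsOpen U
  smooth_S : FieldSmoothOn S₀ U
  even_S : ∀ x ∈ U, FieldHasParity (S₀ x) 0
  smooth_Z : ∀ s α β, FieldSmoothOn (fun x => Z s x α β) U
  parity_Z : ∀ s α β, ∀ x ∈ U, FieldHasParity (Z s x α β) (C.ε s.castSucc α + C.ε s.succ β)
  smooth_M : ∀ s β, FieldContent.SmoothOn (M s β) U
  quad_M : ∀ s β, ∀ x ∈ U, AntiQuadratic (M s β x)
  afn_M : ∀ s β, ∀ x ∈ U, HasAfn (M s β x) (C.antiAfn ⟨s.succ, β⟩ - 1)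
  rank : RankConditions S₀ Z U
  nil : ∀ F : C.Pt → C.FullAlg, FieldContent.SmoothOn F U → ∀ x ∈ U,
    koszulTate (structureFn S₀ Z M) (koszulTate (structureFn S₀ Z M) F) x = 0

namespace GaugeData
variable {C : FieldContent} (D : GaugeData C)

/-- The coefficients of the Koszul–Tate operator, extended by zero. -/
def coef (x : C.Pt) : C.EvenAux ⊕ C.OddVar → C.FullAlg :=
  onVars (fun a => structureFn D.S₀ D.Z D.M a x) 0

theorem koszulTate_eq_kt (F : C.Pt → C.FullAlg) (x : C.Pt) :
    koszulTate (structureFn D.S₀ D.Z D.M) F x = kt (D.coef x) (F x) := koszulTate_eq _ _ _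

/-- The operator acts pointwise in the even fields, so families constant in `x` suffice. -/
theorem kt_kt {x : C.Pt} (hx : x ∈ D.U) (f : C.FullAlg) : kt (D.coef x) (kt (D.coef x) f) = 0 := by
  have := D.nil (fun _ => f) (fun _ _ => contDiffOn_const) x hx
  rwa [koszulTate_eq_kt, koszulTate_eq_kt] at this

theorem coef_zero (x : C.Pt) (i : Fin (C.m 0)) :
    D.coef x (av ⟨0, i⟩) = incl (fieldRightDeriv i D.S₀ x) := onVars_av _ _ _

theorem coef_succ (x : C.Pt) (s : Fin (C.L + 1)) (β : Fin (C.m s.succ)) :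
    D.coef x (av ⟨s.succ, β⟩) =
      (∑ α : Fin (C.m s.castSucc), mv (av ⟨s.castSucc, α⟩) * incl (D.Z s x α β)) + D.M s β x := by
  simp only [← antifield_eq]
  exact onVars_av _ _ _

theorem coef_ghost (x : C.Pt) (c : C.Ghost) : D.coef x (vars (Sum.inl (Sum.inl c))) = 0 :=
  onVars_ghost _ _ _

theorem coef_field (x : C.Pt) (o : C.OddField) : D.coef x (vars (Sum.inr o)) = 0 :=
  onVars_field _ _ _

theorem anti_cases {P : C.Anti → Prop} (h0 : ∀ i, P ⟨0, i⟩)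
    (hs : ∀ (s : Fin (C.L + 1)) (β : Fin (C.m s.succ)), P ⟨s.succ, β⟩) (a : C.Anti) : P a := by
  obtain ⟨k, β⟩ := a
  induction k using Fin.cases with
  | zero => exact h0 β
  | succ s => exact hs s β

theorem smooth_coef (v : C.EvenAux ⊕ C.OddVar) :
    Sm (E := C.EvenAux) (O := C.OddVar) (fun x => D.coef x v) D.U := by
  induction v using vars_cases with
  | hg c => simp only [coef_ghost]; exact Sm.const 0
  | ho j => simp only [coef_field]; exact Sm.const 0
  | ha a =>
    induction a using anti_cases with
    | h0 i =>
      simp only [coef_zero]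
      exact smooth_incl (smooth_fieldRightDeriv D.isOpen_U D.smooth_S i)
    | hs s β =>
      simp only [coef_succ]
      exact (Sm.sum _ fun α _ => (Sm.const _).mul (smooth_incl (D.smooth_Z s α β))).add
        (D.smooth_M s β)

/-- The bodies of the equations of motion. -/
def eom (x : C.Pt) (w : C.Anti) : ℝ :=
  Fin.cases (motive := fun k => Fin (C.m k) → ℝ) (fun i => body (fieldRightDeriv i D.S₀ x))
    (fun _ _ => 0) w.1 w.2

theorem eom_zero (x : C.Pt) (i : Fin (C.m 0)) :
    D.eom x ⟨0, i⟩ = body (fieldRightDeriv i D.S₀ x) := rfl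

theorem eom_succ (x : C.Pt) (s : Fin (C.L + 1)) (β : Fin (C.m s.succ)) :
    D.eom x ⟨s.succ, β⟩ = 0 := rfl

/-- The Jacobian of the coefficients with respect to antifields and original fields. -/
def jac (x : C.Pt) (u : C.Anti ⊕ Fin (C.m 0)) (w : C.Anti) : ℝ :=
  Fin.cases (motive := fun k => Fin (C.m k) → ℝ)
    (fun i => Sum.elim (fun _ => 0) (fun j => hessian D.S₀ x j i) u)
    (fun s β => Sum.elim (fun a => ∑ α, if a = ⟨s.castSucc, α⟩ then body (D.Z s x α β) else 0)
      (fun _ => 0) u) w.1 w.2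

theorem jac_anti_zero (x : C.Pt) (a : C.Anti) (i : Fin (C.m 0)) :
    D.jac x (Sum.inl a) ⟨0, i⟩ = 0 := rfl

theorem jac_field_zero (x : C.Pt) (j i : Fin (C.m 0)) :
    D.jac x (Sum.inr j) ⟨0, i⟩ = hessian D.S₀ x j i := rfl

theorem jac_anti_succ (x : C.Pt) (a : C.Anti) (s : Fin (C.L + 1)) (β : Fin (C.m s.succ)) :
    D.jac x (Sum.inl a) ⟨s.succ, β⟩ =
      ∑ α, if a = ⟨s.castSucc, α⟩ then body (D.Z s x α β) else 0 := rfl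

theorem jac_field_succ (x : C.Pt) (j : Fin (C.m 0)) (s : Fin (C.L + 1)) (β : Fin (C.m s.succ)) :
    D.jac x (Sum.inr j) ⟨s.succ, β⟩ = 0 := rfl

theorem smooth_jac (u : C.Anti ⊕ Fin (C.m 0)) (w : C.Anti) :
    ContDiffOn ℝ ∞ (fun x => D.jac x u w) D.U := by
  induction w using anti_cases with
  | h0 i =>
    cases u with
    | inl a => exact contDiffOn_const
    | inr j => exact smooth_hessian D.isOpen_U D.smooth_S j i
  | hs s β =>
    cases u with
    | inl a =>
      simp only [jac_anti_succ]
      refine ContDiffOn.sum fun α _ => ?_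
      split_ifs
      · exact D.smooth_Z s α β bodyLin
      · exact contDiffOn_const
    | inr j => exact contDiffOn_const

theorem smooth_eom (w : C.Anti) : ContDiffOn ℝ ∞ (fun x => D.eom x w) D.U := by
  induction w using anti_cases with
  | h0 i => exact smooth_fieldRightDeriv D.isOpen_U D.smooth_S i bodyLin
  | hs s β => exact contDiffOn_const

theorem jac_even {x : C.Pt} (hx : x ∈ D.U) (j : C.EvenField) (w : C.Anti) :
    D.jac x (Sum.inr j) w = pd j (fun y => D.eom y w) x := by
  induction w using anti_cases with
  | h0 i => exact hessian_of_even D.isOpen_U D.smooth_S hx j i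
  | hs s β => simp [jac_field_succ, eom_succ, pd]

/-- Twice the level plus the parity. -/
def key (w : C.Anti) : ℕ := 2 * (w.1 : ℕ) + (C.ε w.1 w.2).val

/-- The key of the rows of the Jacobian. -/
def rowKey : C.Anti ⊕ Fin (C.m 0) → ℕ :=
  Sum.elim (fun a => key a + 2) fun j => (C.ε 0 j).val

/-- Entries of `Z` join consecutive levels and the Hessian stays at level zero; an entry joining
unequal parities is odd, so its body vanishes. All blocks of the minor come from this grading. -/
theorem jac_key {x : C.Pt} (hx : x ∈ D.U) {u : C.Anti ⊕ Fin (C.m 0)} {w : C.Anti}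
    (h : D.jac x u w ≠ 0) : rowKey u = key w := by
  induction w using anti_cases with
  | h0 i =>
    cases u with
    | inl a => exact absurd rfl h
    | inr j =>
      have := hessian_parity D.isOpen_U D.smooth_S D.even_S hx h
      simp [rowKey, key, this]
  | hs s β =>
    cases u with
    | inl a =>
      rw [jac_anti_succ] at h
      obtain ⟨α, -, hα⟩ := Finset.exists_ne_zero_of_sum_ne_zero h
      split_ifs at hα with ha
      · subst ha
        have : C.ε s.castSucc α = C.ε s.succ β := by
          by_contra hne
          refine hα (body_eq_zero_of_odd ?_)
          have : ∀ a b : ZMod 2, a ≠ b → a + b = 1 := by decide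
          have h1 := D.parity_Z s α β x hx
          rwa [this _ _ hne] at h1
        simp [rowKey, key, this]
        ring
      · exact absurd rfl hα
    | inr j => exact absurd rfl h

theorem eom_key {x : C.Pt} (hx : x ∈ D.U) {w : C.Anti} (h : D.eom x w ≠ 0) : key w = 0 := by
  induction w using anti_cases with
  | h0 i =>
    by_contra hk
    refine h (body_fieldRightDeriv_of_odd (D.even_S x hx) fun h0 => hk ?_)
    simp [key, h0]
  | hs s β => exact absurd rfl h

/-- The part of a coefficient that is linear in antifields and odd original fields. -/
def linPart (x : C.Pt) (w : C.Anti) : C.FullAlg :=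
  (∑ a : C.Anti, D.jac x (Sum.inl a) w • mv (av a)) +
    ∑ o : C.OddField, D.jac x (Sum.inr o) w • mv (vars (Sum.inr o))

theorem antiCount_le_linCount (v : C.EvenAux ⊕ C.OddVar) : antiCount v ≤ linCount v := by
  induction v using vars_cases <;> simp [antiCount, linCount]

theorem coef_sub_linPart_mem {x : C.Pt} (hx : x ∈ D.U) (w : C.Anti) :
    D.coef x (av w) - D.eom x w • (1 : C.FullAlg) - D.linPart x w
      ∈ Fil (E := C.EvenAux) (O := C.OddVar) linCount 2 := by
  induction w using anti_cases with
  | h0 i =>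
    rw [coef_zero, eom_zero, linPart]
    simp only [jac_anti_zero, zero_smul, Finset.sum_const_zero, zero_add, jac_field_zero,
      hessian_of_odd]
    exact incl_sub_linear_mem _
  | hs s β =>
    rw [coef_succ, eom_succ, linPart]
    simp only [jac_anti_succ, jac_field_succ, zero_smul, Finset.sum_const_zero, add_zero, sub_zero,
      Finset.sum_smul, ite_smul]
    rw [Finset.sum_comm]
    simp only [Finset.sum_ite_eq', Finset.mem_univ, if_true]
    rw [add_sub_right_comm, ← Finset.sum_sub_distrib]
    refine add_mem (Submodule.sum_mem _ fun α _ => ?_)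
      (Fil_mono antiCount_le_linCount (AntiQuadratic.mem_Fil (D.quad_M s β x hx)))
    have e : mv (av ⟨s.castSucc, α⟩) * incl (D.Z s x α β) -
        body (D.Z s x α β) • mv (av ⟨s.castSucc, α⟩)
        = mv (av ⟨s.castSucc, α⟩) *
          (incl (D.Z s x α β) - body (D.Z s x α β) • (1 : C.FullAlg)) := by
      rw [mul_sub, mul_smul_comm, mul_one]
    rw [e]
    refine Fil_anti _ ?_ (mul_mem_Fil (mv_mem_Fil _ _) (incl_sub_body_mem _))
    simp [linCount]

theorem linPart_mem (x : C.Pt) (w : C.Anti) :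
    D.linPart x w ∈ Fil (E := C.EvenAux) (O := C.OddVar) linCount 1 := by
  refine add_mem (Submodule.sum_mem _ fun a _ => Submodule.smul_mem _ _ ?_)
    (Submodule.sum_mem _ fun o _ => Submodule.smul_mem _ _ ?_)
  · exact Fil_anti _ (by simp [linCount]) (mv_mem_Fil _ _)
  · exact Fil_anti _ (by simp [linCount]) (mv_mem_Fil _ _)

theorem linCount_le_one (v : C.EvenAux ⊕ C.OddVar) : linCount v ≤ 1 := by
  induction v using vars_cases <;> simp [linCount]

/-- The quadratic identity that expresses nilpotency on an antifield. -/
theorem sum_jac_coef_mem {x : C.Pt} (hx : x ∈ D.U) {r : ℕ}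
    (hr : ∀ v, D.coef x v ∈ Fil (E := C.EvenAux) (O := C.OddVar) linCount (linCount v - r))
    (w : C.Anti) :
    ∑ a : C.Anti, D.jac x (Sum.inl a) w • D.coef x (av a)
      ∈ Fil (E := C.EvenAux) (O := C.OddVar) linCount (2 - r) := by
  -- Applied to a coefficient the operator gives zero by nilpotency and it kills constants, so its
  -- value on the linear part is minus its value on the error.
  have h1 := kt_mem_Fil hr (D.coef_sub_linPart_mem hx w)
  have h2 : kt (D.coef x) (D.coef x (av w)) = 0 := by
    rw [← kt_mv (D.coef x) (av w)]; exact D.kt_kt hx _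
  rw [map_sub, map_sub, h2, map_smul, kt_one, smul_zero, sub_zero, zero_sub, neg_mem_iff,
    linPart, map_add, map_sum, map_sum] at h1
  simpa only [map_smul, kt_mv, coef_field, smul_zero, Finset.sum_const_zero, add_zero] using h1

/-- The constant term of the nilpotency identity: the Noether identities for the bodies, valid on
all of `U` and hence open to differentiation. -/
theorem sum_eom_jac {x : C.Pt} (hx : x ∈ D.U) (w : C.Anti) :
    ∑ a : C.Anti, D.eom x a * D.jac x (Sum.inl a) w = 0 := by
  have h1 := D.sum_jac_coef_mem hx (r := 1) (fun v => by
    rw [Nat.sub_eq_zero_of_le (linCount_le_one v)]; exact Fil_zero _ _) w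
  refine eq_zero_of_smul_one_mem (E := C.EvenAux) (O := C.OddVar) (w := linCount) ?_
  have h2 : ∑ a : C.Anti, D.jac x (Sum.inl a) w •
      (D.coef x (av a) - D.eom x a • (1 : C.FullAlg))
      ∈ Fil (E := C.EvenAux) (O := C.OddVar) linCount 1 := by
    refine Submodule.sum_mem _ fun a _ => Submodule.smul_mem _ _ ?_
    have := add_mem (Fil_anti _ one_le_two (D.coef_sub_linPart_mem hx a)) (D.linPart_mem x a)
    simpa using this
  have h3 := sub_mem h1 h2
  rw [← Finset.sum_sub_distrib] at h3
  simp only [← smul_sub, sub_sub_cancel, smul_smul, ← Finset.sum_smul] at h3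
  simpa only [mul_comm] using h3

theorem eq_zero_of_linear_mem {a : C.EvenAux ⊕ C.OddVar → ℝ}
    (h : ∑ v, a v • mv v ∈ Fil (E := C.EvenAux) (O := C.OddVar) linCount 2)
    (v : C.EvenAux ⊕ C.OddVar) : a v = 0 := by
  have h1 := dv_mem_Fil v h
  rw [map_sum] at h1
  simp only [map_smul, dv_mv, smul_smul, mul_ite, mul_one, mul_zero, ← Finset.sum_smul,
    Finset.sum_ite_eq, Finset.mem_univ, if_true] at h1
  exact eq_zero_of_smul_one_mem (Fil_anti _ (by have := linCount_le_one v; omega) h1)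

theorem linPart_eq (x : C.Pt) (w : C.Anti) : D.linPart x w =
    ∑ v, onVars (fun a => D.jac x (Sum.inl a) w) (fun o : C.OddField => D.jac x (Sum.inr o) w) v •
      (mv v : C.FullAlg) := by
  rw [sum_vars]
  simp [linPart]

/-- Where the equations of motion vanish the coefficients have no constant term, so the operator
does not lower `linCount` and the linear term of the identity can be compared. -/
theorem sum_linear_jac {x : C.Pt} (hx : x ∈ D.U) (h0 : ∀ w, D.eom x w = 0) (w : C.Anti)
    (v : C.EvenAux ⊕ C.OddVar) :
    ∑ a : C.Anti, D.jac x (Sum.inl a) w * onVars (fun u => D.jac x (Sum.inl u) a)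
      (fun o : C.OddField => D.jac x (Sum.inr o) a) v = 0 := by
  have hc : ∀ a, D.coef x (av a) - D.linPart x a
      ∈ Fil (E := C.EvenAux) (O := C.OddVar) linCount 2 := fun a => by
    have := D.coef_sub_linPart_mem hx a
    rwa [h0, zero_smul, sub_zero] at this
  have h1 := D.sum_jac_coef_mem hx (r := 0) (fun v => by
    induction v using vars_cases with
    | hg c => rw [coef_ghost]; exact zero_mem _
    | ho o => rw [coef_field]; exact zero_mem _
    | ha a =>
      have := add_mem (Fil_anti _ one_le_two (hc a)) (D.linPart_mem x a)
      simpa [linCount] using this) w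
  have h2 : ∑ a : C.Anti, D.jac x (Sum.inl a) w • (D.coef x (av a) - D.linPart x a)
      ∈ Fil (E := C.EvenAux) (O := C.OddVar) linCount 2 :=
    Submodule.sum_mem _ fun a _ => Submodule.smul_mem _ _ (hc a)
  have h3 := sub_mem h1 h2
  rw [← Finset.sum_sub_distrib] at h3
  simp only [← smul_sub, sub_sub_cancel, linPart_eq, Finset.smul_sum, smul_smul] at h3
  rw [Finset.sum_comm] at h3
  simp only [← Finset.sum_smul] at h3
  exact eq_zero_of_linear_mem h3 v

/-- At a stationary point the Jacobians of consecutive levels compose to zero. -/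
theorem jac_mul_jac {p : C.Pt} (hp : p ∈ D.U) (h0 : ∀ w, D.eom p w = 0)
    (u : C.Anti ⊕ Fin (C.m 0)) (w : C.Anti) :
    ∑ a, D.jac p u a * D.jac p (Sum.inl a) w = 0 := by
  rcases u with u | j
  · have := D.sum_linear_jac hp h0 w (av u)
    simpa only [onVars_av, mul_comm] using this
  · by_cases hj : C.ε 0 j = 0
    · have h1 : ∀ a, D.jac p (Sum.inr j) a = pd ⟨j, hj⟩ (fun y => D.eom y a) p :=
        D.jac_even hp ⟨j, hj⟩
      -- Even fields are coordinates, not generators, so these rows come from differentiating the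
      -- Noether identity; the other Leibniz term vanishes at a stationary point.
      have h2 := pd_eq_zero D.isOpen_U ⟨j, hj⟩ (fun x hx => D.sum_eom_jac hx w) hp
      have h3 := (isOp_pd D.isOpen_U (⟨j, hj⟩ : C.EvenField)).sum Finset.univ (fun _ => 1)
        (fun a y => D.eom y a * D.jac y (Sum.inl a) w)
        (fun a _ => (D.smooth_eom a).mul (D.smooth_jac _ _)) p hp
      simp only [mul_one] at h3
      rw [h3] at h2
      rw [← h2]
      refine Finset.sum_congr rfl fun a _ => ?_
      rw [pd_mul D.isOpen_U _ (D.smooth_eom a) (D.smooth_jac _ _) hp, h0 a, zero_mul, add_zero, h1]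
    · have := D.sum_linear_jac hp h0 w (vars (Sum.inr ⟨j, hj⟩))
      simpa only [onVars_field, mul_comm] using this

end GaugeData

/-! ### Alternating sums of multiplicities. -/

section AltMult
variable (C : FieldContent)

theorem altMult_last : C.altMult (Fin.last _) = C.m (Fin.last _) := by
  have : Finset.Ici (Fin.last (C.L + 1)) = {Fin.last _} := by
    ext j; simp [Fin.last_le_iff]
  rw [altMult, this]
  simp

theorem altMult_castSucc (s : Fin (C.L + 1)) :
    C.altMult s.castSucc + C.altMult s.succ = C.m s.castSucc := by
  have h : Finset.Ici s.castSucc = insert s.castSucc (Finset.Ici s.succ) := by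
    ext j
    simp only [Finset.mem_Ici, Finset.mem_insert, Fin.le_def, Fin.ext_iff, Fin.val_castSucc,
      Fin.val_succ]
    omega
  rw [altMult, h, Finset.sum_insert (by simp [Fin.le_def]), altMult]
  simp only [Fin.val_castSucc, Fin.val_succ, Nat.sub_self, pow_zero, one_mul]
  rw [add_assoc, ← Finset.sum_add_distrib, Finset.sum_eq_zero, add_zero]
  intro j hj
  have hj' : (s : ℕ) + 1 ≤ j := by simpa [Fin.le_def] using hj
  have : (j : ℕ) - s = (j - (s + 1)) + 1 := by omega
  rw [this, pow_succ]
  ring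

/-- The dimension count behind exactness: selected columns are as many as unselected antifields plus
the rank of the Hessian, so the minor is square. -/
theorem sum_altMult : ∑ k, C.altMult k = ∑ k, ((C.m k : ℤ) - C.altMult k) + C.altMult 0 := by
  rw [Finset.sum_sub_distrib]
  have h1 : ∑ k, (C.m k : ℤ) = ∑ k, C.altMult k + (∑ k, C.altMult k - C.altMult 0) := by
    rw [Fin.sum_univ_castSucc]
    simp only [← altMult_castSucc, ← altMult_last]
    rw [Finset.sum_add_distrib, Fin.sum_univ_castSucc (fun k => C.altMult k)]
    have := Fin.sum_univ_succ (fun k => C.altMult k)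
    rw [Fin.sum_univ_castSucc] at this
    linarith
  rw [h1]
  ring

end AltMult

/-! ### Selection of an invertible minor. -/

namespace GaugeData
variable {C : FieldContent} (D : GaugeData C)

theorem key_div_two (w : C.Anti) : key w / 2 = (w.1 : ℕ) := by
  have := ZMod.val_lt (C.ε w.1 w.2)
  unfold key
  omega

theorem key_mod_two (w : C.Anti) : key w % 2 = (C.ε w.1 w.2).val := by
  have := ZMod.val_lt (C.ε w.1 w.2)
  unfold key
  omega

/-- Columns of one level on which the Jacobian is injective. -/
theorem exists_level_cols {p : C.Pt} (hp : p ∈ D.U) (k : Fin (C.L + 2)) :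
    ∃ A : Finset (Fin (C.m k)), (A.card : ℤ) = C.altMult k ∧
      ∀ v : Fin (C.m k) → ℝ, (∀ β, β ∉ A → v β = 0) →
        (∀ u, ∑ β, D.jac p u ⟨k, β⟩ * v β = 0) → v = 0 := by
  induction k using Fin.cases with
  | zero =>
    obtain ⟨A, hA, h⟩ := exists_cols (hessian D.S₀ p)
    refine ⟨A, by rw [hA]; exact (D.rank p hp).1, fun v hv h0 => h v hv ?_⟩
    funext j
    exact h0 (Sum.inr j)
  | succ s =>
    obtain ⟨A, hA, h⟩ := exists_cols ((D.Z s p).map body)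
    refine ⟨A, by rw [hA]; exact (D.rank p hp).2 s, fun v hv h0 => h v hv ?_⟩
    funext α
    have := h0 (Sum.inl ⟨s.castSucc, α⟩)
    simp only [jac_anti_succ] at this
    simpa [Matrix.mulVec, dotProduct] using this

/-- A choice of independent columns `A` and rows `Y` that gives an invertible minor of the
Jacobian at `p`, with a bijection between rows and columns along nonzero entries. -/
structure Selection (p : C.Pt) where
  A : C.Anti → Prop
  Y : Fin (C.m 0) → Prop
  e : {w // A w} ≃ {u : C.Anti ⊕ Fin (C.m 0) // Sum.elim (fun a => ¬ A a) Y u}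
  jac_ne : ∀ w, D.jac p (e w).1 w.1 ≠ 0
  inj : ∀ v : {w // A w} → ℝ, (∀ u, Sum.elim (fun a => ¬ A a) Y u →
    ∑ w : {w // A w}, D.jac p u w.1 * v w = 0) → v = 0

theorem card_rows {I F : Type} [Fintype I] [Fintype F] (A : I → Prop) (Y : F → Prop) :
    Fintype.card {u : I ⊕ F // Sum.elim (fun a => ¬ A a) Y u} =
      Fintype.card {a // ¬ A a} + Fintype.card {j // Y j} := by
  rw [← Fintype.card_sum]
  exact Fintype.card_congr Equiv.subtypeSum

/-- `A` collects independent columns level by level and `Y` indexes independent Hessian rows;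
`minor_injective` applies because the Jacobian squares to zero at `p`. -/
theorem nonempty_selection {p : C.Pt} (hp : p ∈ D.U) (h0 : ∀ w, D.eom p w = 0) :
    Nonempty (D.Selection p) := by
  choose A hA hinj using D.exists_level_cols hp
  obtain ⟨Y, hY, hrows⟩ := exists_rows (hessian D.S₀ p)
  obtain ⟨B, hB⟩ : ∃ B : C.Anti → Prop, ∀ w, B w ↔ w.2 ∈ A w.1 := ⟨_, fun _ => Iff.rfl⟩
  obtain ⟨R, hR⟩ : ∃ R : Fin (C.m 0) → Prop, ∀ j, R j ↔ j ∈ Y := ⟨_, fun _ => Iff.rfl⟩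
  have hcard : Fintype.card {w // B w} =
      Fintype.card {u : C.Anti ⊕ Fin (C.m 0) // Sum.elim (fun w => ¬ B w) R u} := by
    have h1 : Fintype.card {w // B w} = ∑ k, (A k).card := by
      rw [Fintype.card_of_subtype (Finset.univ.sigma A) (by simp [hB]), Finset.card_sigma]
    have h2 := Fintype.card_subtype_compl B
    have h3 : Fintype.card {w // B w} ≤ Fintype.card C.Anti :=
      Fintype.card_subtype_le _
    have h4 : Fintype.card C.Anti = ∑ k, C.m k := by simp
    have h5 : (Y.card : ℤ) = C.altMult 0 := by rw [hY]; exact (D.rank p hp).1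
    have h6 := sum_altMult C
    rw [Finset.sum_sub_distrib] at h6
    simp only [← hA] at h6
    rw [card_rows]
    have h7 : Fintype.card {j // R j} = Y.card := Fintype.card_of_subtype Y (by simp [hR])
    have h8 : (A 0).card = Y.card := by exact_mod_cast (hA 0).trans h5.symm
    rw [h8] at h6
    zify
    zify at h1 h4 h7
    have h9 : (Fintype.card {w // ¬ B w} : ℤ) =
        Fintype.card C.Anti - Fintype.card {w // B w} := by omega
    rw [h9, h7, h1, h4]
    exact h6
  -- Each row meets only columns of the one level determined by its key, so injectivity can be
  -- checked level by level.
  have key1 : ∀ v : C.Anti → ℝ, (∀ a, ¬ B a → v a = 0) →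
      (∀ u, ∑ w, D.jac p u w * v w = 0) → v = 0 := by
    intro v hv hu
    funext ⟨k, β⟩
    refine congrFun (hinj k (fun β => v ⟨k, β⟩) (fun β hβ => hv ⟨k, β⟩ ((hB _).not.mpr hβ)) fun u => ?_) β
    by_cases hk : rowKey u / 2 = (k : ℕ)
    · rw [← hu u, Fintype.sum_sigma, Finset.sum_eq_single k]
      · intro k' _ hk'
        refine Finset.sum_eq_zero fun β' _ => ?_
        by_contra hne
        have h1 := D.jac_key hp (left_ne_zero_of_mul hne)
        rw [h1, key_div_two] at hk
        exact hk' (Fin.ext hk)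
      · simp
    · refine Finset.sum_eq_zero fun β' _ => ?_
      by_contra hne
      have h1 := D.jac_key hp (left_ne_zero_of_mul hne)
      rw [h1, key_div_two] at hk
      exact hk rfl
  have hmul : ∀ (v : C.Anti → ℝ) (j : Fin (C.m 0)), ∑ w, D.jac p (Sum.inr j) w * v w
      = (hessian D.S₀ p).mulVec (fun i => v ⟨0, i⟩) j := by
    intro v j
    rw [Fintype.sum_sigma, Fin.sum_univ_succ, Finset.sum_eq_zero (s := Finset.univ)
      (f := fun s : Fin (C.L + 1) => _), add_zero]
    · rfl
    · intro s _
      exact Finset.sum_eq_zero fun β _ => by rw [jac_field_succ, zero_mul]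
  have hinj' := minor_injective (J := D.jac p) (A := B) (Y := R) key1
    (fun v hv j => by
      rw [hmul, hrows (fun i => v ⟨0, i⟩) fun r hr => by rw [← hmul]; exact hv r ((hR r).mpr hr)]; rfl)
    (D.jac_mul_jac hp h0)
  obtain ⟨e, he⟩ := exists_equiv_of_injective hcard
    (fun u w => D.jac p u.1 w.1) fun v hv => hinj' v fun u hu => hv ⟨u, hu⟩
  exact ⟨⟨_, _, e, he, hinj'⟩⟩

end GaugeData

/-! ### Block structure of the minor and the perturbation weight. -/

namespace GaugeData
variable {C : FieldContent} {D : GaugeData C}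

theorem key_eq_zero_iff (w : C.Anti) : key w = 0 ↔ ∃ i : C.EvenField, w = ⟨0, i.1⟩ := by
  constructor
  · intro h
    obtain ⟨k, β⟩ := w
    have h1 : (k : ℕ) = 0 := by unfold key at h; dsimp only at h; omega
    obtain rfl : k = 0 := Fin.ext h1
    refine ⟨⟨β, ?_⟩, rfl⟩
    rw [← ZMod.val_eq_zero]
    unfold key at h; dsimp only at h; omega
  · rintro ⟨i, rfl⟩
    simp [key, i.2]

theorem rowKey_anti (a : C.Anti) : rowKey (C := C) (Sum.inl a) = key a + 2 := rfl

theorem rowKey_even (j : C.EvenField) : rowKey (C := C) (Sum.inr j.1) = 0 := by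
  simp [rowKey, j.2]

theorem rowKey_odd (j : C.OddField) : rowKey (C := C) (Sum.inr j.1) = 1 := by
  have : ∀ a : ZMod 2, a ≠ 0 → a.val = 1 := by decide
  exact this _ j.2

theorem rowKey_eq_zero_iff (u : C.Anti ⊕ Fin (C.m 0)) :
    rowKey u = 0 ↔ ∃ j : C.EvenField, u = Sum.inr j.1 := by
  constructor
  · intro h
    rcases u with a | j
    · exact absurd h (Nat.succ_ne_zero _)
    · exact ⟨⟨j, (ZMod.val_eq_zero _).mp h⟩, rfl⟩
  · rintro ⟨j, rfl⟩
    exact rowKey_even j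

/-- The variable of a row of the Jacobian; the rows of even fields do not matter. -/
def rowVar (u : C.Anti ⊕ Fin (C.m 0)) : C.EvenAux ⊕ C.OddVar :=
  Sum.elim av (fun j => if h : C.ε 0 j ≠ 0 then vars (Sum.inr ⟨j, h⟩) else av ⟨0, j⟩) u

theorem rowVar_anti (a : C.Anti) : rowVar (C := C) (Sum.inl a) = av a := rfl

theorem rowVar_odd (j : C.OddField) : rowVar (C := C) (Sum.inr j.1) = vars (Sum.inr j) :=
  dif_pos j.2

theorem row_cases {u : C.Anti ⊕ Fin (C.m 0)} (hu : rowKey u ≠ 0) :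
    (∃ a, u = Sum.inl a) ∨ ∃ j : C.OddField, u = Sum.inr j.1 := by
  rcases u with a | j
  · exact Or.inl ⟨a, rfl⟩
  · exact Or.inr ⟨⟨j, fun h => hu (rowKey_even ⟨j, h⟩)⟩, rfl⟩

theorem av_ne_field (a : C.Anti) (j : C.OddField) : av a ≠ vars (Sum.inr j) := by
  simp [av]

theorem rowVar_injOn {u u' : C.Anti ⊕ Fin (C.m 0)} (hu : rowKey u ≠ 0) (hu' : rowKey u' ≠ 0)
    (h : rowVar u = rowVar u') : u = u' := by
  rcases row_cases hu with ⟨a, rfl⟩ | ⟨j, rfl⟩ <;> rcases row_cases hu' with ⟨a', rfl⟩ | ⟨j', rfl⟩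
  · rw [av_injective h]
  · rw [rowVar_odd] at h; exact absurd h (av_ne_field _ _)
  · rw [rowVar_odd] at h; exact absurd h.symm (av_ne_field _ _)
  · rw [rowVar_odd, rowVar_odd] at h
    have : j = j' := by simpa using h
    rw [this]

/-- Antifields of equal ε at neighboring levels have opposite parity, and the antifield of an odd
field is even. -/
theorem opp_rowVar {u : C.Anti ⊕ Fin (C.m 0)} {w : C.Anti} (h : rowKey u = key w)
    (hw : key w ≠ 0) : Opp (rowVar u) (av w) := by
  have key2 : ∀ a b : ZMod 2, (a = 0 ↔ b = 0) → a = b := by decide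
  rw [← h] at hw
  rcases row_cases hw with ⟨a, rfl⟩ | ⟨j, rfl⟩
  · rw [rowKey_anti] at h
    have h1 := key_div_two a
    have h2 := key_div_two w
    have h3 := key_mod_two a
    have h4 := key_mod_two w
    have h5 : (w.1 : ℕ) = a.1 + 1 := by omega
    have h6 : C.ε a.1 a.2 = C.ε w.1 w.2 := by
      apply ZMod.val_injective; omega
    intro h7
    have h8 := isRight_vars (C := C) (v := Sum.inr a)
    have h9 := isRight_vars (C := C) (v := Sum.inr w)
    change (rowVar (C := C) (Sum.inl a)).isRight = true ↔ _ at h8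
    change (av w).isRight = true ↔ _ at h9
    rw [h7, h9, not_iff_not] at h8
    have h10 := key2 _ _ h8
    simp only [auxParity, h5, h6] at h10
    push_cast at h10
    generalize (C.ε w.1 w.2) = x at h10
    generalize ((a.1 : ℕ) : ZMod 2) = y at h10
    revert x y; decide
  · rw [rowKey_odd] at h
    have h2 := key_div_two w
    have h4 := key_mod_two w
    have h5 : (w.1 : ℕ) = 0 := by omega
    have h6 : C.ε w.1 w.2 = 1 := by
      apply ZMod.val_injective; rw [← h4, ← h]; rfl
    rw [rowVar_odd, vars_field]
    intro h7
    have h9 := isRight_vars (C := C) (v := Sum.inr w)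
    change (av w).isRight = true ↔ _ at h9
    rw [← h7] at h9
    refine h9.mp rfl ?_
    simp only [auxParity, h5, h6]
    decide

namespace Selection
variable {p : C.Pt} (σ : D.Selection p)

/-- The selected columns whose key has a property. -/
def Block (r : ℕ → Prop) : Type := {w : {w // σ.A w} // r (key w.1)}

instance (r : ℕ → Prop) : Fintype (σ.Block r) :=
  inferInstanceAs (Fintype {w : {w // σ.A w} // r (key w.1)})

/-- The block of the Jacobian of the selected columns and their partners. -/
def Q (r : ℕ → Prop) (x : C.Pt) : Matrix (σ.Block r) (σ.Block r) ℝ :=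
  Matrix.of fun a b => D.jac x (σ.e a.1).1 b.1.1

/-- The selected columns that do not belong to the equations of motion of even fields. -/
abbrev P : Type := σ.Block fun k => k ≠ 0

/-- The row partners of `P`. -/
def ra (a : σ.P) : C.EvenAux ⊕ C.OddVar := rowVar (σ.e a.1).1

/-- The antifields of `P`. -/
def rb (b : σ.P) : C.EvenAux ⊕ C.OddVar := av b.1.1

section
variable (hp : p ∈ D.U)
include hp

theorem rowKey_e (w : {w // σ.A w}) : rowKey (σ.e w).1 = key w.1 := D.jac_key hp (σ.jac_ne w)

/-- The invertible minor is block diagonal. -/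
theorem det_Q_ne_zero (r : ℕ → Prop) : (σ.Q r p).det ≠ 0 := by
  intro hdet
  obtain ⟨v, hv0, hv⟩ := Matrix.exists_mulVec_eq_zero_iff.mpr hdet
  refine hv0 ?_
  -- A kernel vector of the block, extended by zero, is a kernel vector of the whole minor: rows of
  -- other blocks do not meet its support.
  have h := σ.inj (fun w => if h : r (key w.1) then v ⟨w, h⟩ else 0) fun u hu => ?_
  · funext w
    have := congrFun h w.1
    rwa [dif_pos w.2] at this
  · obtain ⟨a, ha⟩ := σ.e.surjective ⟨u, hu⟩
    have hu' : u = (σ.e a).1 := by rw [ha]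
    subst hu'
    by_cases hr : r (key a.1)
    · refine Eq.trans ?_ (congrFun hv ⟨a, hr⟩)
      refine (Finset.sum_subset (Finset.subset_univ (Finset.univ.filter fun w :
        {w // σ.A w} => r (key w.1))) ?_).symm.trans ?_
      · intro w _ hw
        have : ¬ r (key w.1) := by simpa using hw
        rw [dif_neg this, mul_zero]
      · refine (Finset.sum_bij (fun (b : σ.Block r) _ => b.1) (fun b _ => by simpa using b.2)
          (fun a _ b _ h => Subtype.ext h) ?_ ?_).symm
        · intro w hw
          exact ⟨⟨w, (Finset.mem_filter.mp hw).2⟩, Finset.mem_univ _, rfl⟩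
        · intro w _
          rw [dif_pos w.2]
          rfl
    · refine Finset.sum_eq_zero fun w _ => ?_
      split_ifs with hw
      · by_contra hne
        have h1 := D.jac_key hp (left_ne_zero_of_mul hne)
        rw [σ.rowKey_e hp] at h1
        rw [h1] at hr
        exact hr hw
      · exact mul_zero _

theorem ra_injective : Function.Injective σ.ra := fun a b h => by
  have h1 := rowVar_injOn (by rw [σ.rowKey_e hp]; exact a.2) (by rw [σ.rowKey_e hp]; exact b.2) h
  exact Subtype.ext (σ.e.injective (Subtype.ext h1))

theorem ra_anti (a : σ.P) {w : C.Anti} (h : σ.ra a = av w) : ¬ σ.A w := by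
  have h1 : (σ.e a.1).1 = Sum.inl w :=
    rowVar_injOn (by rw [σ.rowKey_e hp]; exact a.2) (Nat.succ_ne_zero _) h
  have := (σ.e a.1).2
  rwa [h1] at this

theorem exists_ra {u : C.Anti ⊕ Fin (C.m 0)} (hu : Sum.elim (fun a => ¬ σ.A a) σ.Y u)
    (hk : rowKey u ≠ 0) : ∃ a : σ.P, (σ.e a.1).1 = u ∧ σ.ra a = rowVar u := by
  obtain ⟨a, ha⟩ := σ.e.surjective ⟨u, hu⟩
  have hu' : u = (σ.e a).1 := by rw [ha]
  subst hu'
  exact ⟨⟨a, by rwa [σ.rowKey_e hp] at hk⟩, rfl, rfl⟩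

theorem Q_key {x : C.Pt} (hx : x ∈ D.U) (a b : σ.P) (h : σ.Q (fun k => k ≠ 0) x a b ≠ 0) :
    key a.1.1 = key b.1.1 := by
  rw [← σ.rowKey_e hp]; exact D.jac_key hx h

theorem opp_ra_rb {a b : σ.P} (h : key a.1.1 = key b.1.1) : Opp (σ.ra a) (σ.rb b) :=
  opp_rowVar ((σ.rowKey_e hp _).trans h) b.2

end

theorem rb_injective : Function.Injective σ.rb := fun _ _ h =>
  Subtype.ext (Subtype.ext (av_injective h))

/-- The matrix of the linear part that is contracted. -/
def c (x : C.Pt) : Matrix (C.EvenAux ⊕ C.OddVar) (C.EvenAux ⊕ C.OddVar) ℝ :=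
  incidence σ.ra σ.rb (σ.Q _ x)

/-- The matrix of the contraction. -/
def g (x : C.Pt) : Matrix (C.EvenAux ⊕ C.OddVar) (C.EvenAux ⊕ C.OddVar) ℝ :=
  incidence σ.rb σ.ra (σ.Q _ x)⁻¹

/-- The contracted variables. -/
def lin (v : C.EvenAux ⊕ C.OddVar) : Prop := (∃ a, σ.ra a = v) ∨ ∃ b, σ.rb b = v

theorem ra_ne_rb (hp : p ∈ D.U) (a b : σ.P) : σ.ra a ≠ σ.rb b := fun h =>
  σ.ra_anti hp a h b.1.2

/-- The weight for the perturbation expansion. -/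
def W : C.EvenAux ⊕ C.OddVar → ℕ :=
  onVars (fun a => if σ.A a then (if key a = 0 then 2 else 3) else 1) fun o => if σ.Y o.1 then 1 else 2

/-- Terms of second order in antifields and odd fields thus have `W` at least 2. The weights are
chosen so that partners in `c` have weights 1 and 3 and each κ_i has weight 2, while every linear
term not matched by the minor also has weight at least 2. -/
theorem linCount_le_W (v : C.EvenAux ⊕ C.OddVar) : linCount v ≤ σ.W v := by
  induction v using vars_cases with
  | hg c => simp [linCount, W]
  | ha a => simp only [linCount, W, onVars_av]; split_ifs <;> omega
  | ho j => simp only [linCount, W, onVars_field]; split_ifs <;> omega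

theorem W_rb (b : σ.P) : σ.W (σ.rb b) = 3 := by
  simp [W, rb, b.1.2, b.2]

theorem W_ra (hp : p ∈ D.U) (a : σ.P) : σ.W (σ.ra a) = 1 := by
  have h0 : rowKey (σ.e a.1).1 ≠ 0 := by rw [σ.rowKey_e hp]; exact a.2
  have h1 := (σ.e a.1).2
  unfold ra
  rcases row_cases h0 with ⟨w, hw⟩ | ⟨j, hj⟩
  · rw [hw] at h1 ⊢
    rw [rowVar_anti, W, onVars_av, if_neg h1]
  · rw [hj] at h1 ⊢
    rw [rowVar_odd, W, onVars_field, if_pos (show σ.Y j.1 from h1)]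

/-- An antifield partner lies one level below, and an odd field has antifield number zero. -/
theorem afn_ra_rb (hp : p ∈ D.U) {a b : σ.P} (h : key a.1.1 = key b.1.1) :
    onVars C.antiAfn 0 (σ.ra a) + 1 ≤ onVars C.antiAfn 0 (σ.rb b) := by
  have h0 : rowKey (σ.e a.1).1 ≠ 0 := by rw [σ.rowKey_e hp]; exact a.2
  have h1 : rowKey (σ.e a.1).1 = key b.1.1 := by rw [σ.rowKey_e hp, h]
  unfold ra rb
  rcases row_cases h0 with ⟨w, hw⟩ | ⟨j, hj⟩
  · rw [hw] at h1 ⊢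
    rw [rowKey_anti] at h1
    have h2 := key_div_two w
    have h3 := key_div_two b.1.1
    rw [rowVar_anti, onVars_av, onVars_av, antiAfn, antiAfn]
    omega
  · rw [hj, rowVar_odd, onVars_field, onVars_av, antiAfn]; simp

theorem afn_coef {x : C.Pt} (hx : x ∈ D.U) (v : C.EvenAux ⊕ C.OddVar) :
    D.coef x v ∈ Fil (E := C.EvenAux) (O := C.OddVar) (onVars C.antiAfn 0)
      (onVars C.antiAfn 0 v - 1) := by
  induction v using vars_cases with
  | hg c => rw [coef_ghost]; exact zero_mem _
  | ho j => rw [coef_field]; exact zero_mem _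
  | ha a =>
    rw [onVars_av]
    induction a using anti_cases with
    | h0 i => exact Fil_zero _ _
    | hs s β =>
      rw [coef_succ]
      refine add_mem (Submodule.sum_mem _ fun α _ => ?_) (HasAfn.mem_Fil (D.afn_M s β x hx))
      refine Fil_anti _ ?_ (mul_mem_Fil (mv_mem_Fil _ _) (Fil_zero _ _))
      simp [antiAfn]

/-- The difference of the linear parts has subleading weight. -/
theorem linPart_sub_mem (hp : p ∈ D.U) (x : C.Pt) (b : σ.P) :
    D.linPart x b.1.1 - ∑ v, σ.c x v (σ.rb b) • mv v
      ∈ Fil (E := C.EvenAux) (O := C.OddVar) σ.W 2 := by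
  rw [linPart_eq, ← Finset.sum_sub_distrib]
  refine Submodule.sum_mem _ fun v _ => ?_
  rw [← sub_smul]
  by_cases hW : 2 ≤ σ.W v
  · exact Submodule.smul_mem _ _ (Fil_anti _ hW (mv_mem_Fil _ _))
  -- Variables of weight below 2 other than ghosts are exactly the rows of the minor, and there `c`
  -- reproduces the Jacobian.
  · have hrow : ∀ u, Sum.elim (fun a => ¬ σ.A a) σ.Y u → rowKey u ≠ 0 →
        D.jac x u b.1.1 - σ.c x (rowVar u) (σ.rb b) = 0 := by
      intro u hu hk
      obtain ⟨a, ha, ha'⟩ := σ.exists_ra hp hu hk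
      rw [← ha', c, incidence_apply (σ.ra_injective hp) σ.rb_injective, ← ha, sub_eq_zero]
      rfl
    have hz : onVars (fun a => D.jac x (Sum.inl a) b.1.1)
        (fun o : C.OddField => D.jac x (Sum.inr o) b.1.1) v - σ.c x v (σ.rb b) = 0 := by
      induction v using vars_cases with
      | hg c =>
        rw [onVars_ghost, zero_sub, neg_eq_zero]
        by_contra hne
        obtain ⟨a, -, h1, -, -⟩ := exists_of_incidence_ne_zero hne
        have h2 := σ.W_ra hp a
        rw [← h1] at h2
        simp [W] at h2
      | ha a =>
        rw [onVars_av]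
        refine hrow (Sum.inl a) ?_ (Nat.succ_ne_zero _)
        intro hA
        rw [W, onVars_av, if_pos hA] at hW
        split_ifs at hW <;> omega
      | ho j =>
        rw [onVars_field, ← rowVar_odd]
        refine hrow (Sum.inr j.1) ?_ (by rw [rowKey_odd]; exact one_ne_zero)
        by_contra hY
        exact hW (by rw [W, onVars_field, if_neg (show ¬ σ.Y j.1 from hY)])
    rw [hz, zero_smul]
    exact zero_mem _

end Selection
end GaugeData

/-! ### Inverse function theorem and star-shaped balls. -/

section Chart
variable {ι : Type} [Fintype ι]

/-- A smooth map with injective derivative at `p` restricts to a diffeomorphism from a neighborhood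
of `p` onto a ball. -/
theorem exists_chart {U : Set (ι → ℝ)} (hU : IsOpen U) {Ψ : (ι → ℝ) → (ι → ℝ)}
    (hΨ : ContDiffOn ℝ ∞ Ψ U) {p : ι → ℝ} (hp : p ∈ U)
    (hinj : ∀ v, fderiv ℝ Ψ p v = 0 → v = 0) :
    ∃ (U' : Set (ι → ℝ)) (r : ℝ) (χ : (ι → ℝ) → (ι → ℝ)), IsOpen U' ∧ p ∈ U' ∧ U' ⊆ U ∧
      Set.MapsTo Ψ U' (Metric.ball (Ψ p) r) ∧ Set.MapsTo χ (Metric.ball (Ψ p) r) U' ∧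
      (∀ x ∈ U', χ (Ψ x) = x) ∧ (∀ y ∈ Metric.ball (Ψ p) r, Ψ (χ y) = y) ∧
      ContDiffOn ℝ ∞ χ (Metric.ball (Ψ p) r) := by
  have hat : ∀ x ∈ U, ContDiffAt ℝ ∞ Ψ x := fun x hx => hΨ.contDiffAt (hU.mem_nhds hx)
  have hd : ∀ x ∈ U, HasFDerivAt Ψ (fderiv ℝ Ψ x) x := fun x hx =>
    ((hat x hx).differentiableAt (by simp)).hasFDerivAt
  have hinj' : Function.Injective (fderiv ℝ Ψ p : (ι → ℝ) →ₗ[ℝ] (ι → ℝ)) :=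
    (injective_iff_map_eq_zero _).mpr hinj
  set f' : (ι → ℝ) ≃L[ℝ] (ι → ℝ) :=
    (LinearEquiv.ofInjectiveEndo _ hinj').toContinuousLinearEquiv with hf'
  have hf : (f' : (ι → ℝ) →L[ℝ] (ι → ℝ)) = fderiv ℝ Ψ p := by
    ext1 v; rfl
  have hcont : ContinuousOn (fderiv ℝ Ψ) U := hΨ.continuousOn_fderiv_of_isOpen hU (by simp)
  -- The derivative is invertible on an open set around `p`; the ball is kept inside its image so
  -- that the inverse is smooth at every point, not only at the center.
  set N : Set (ι → ℝ) := U ∩ fderiv ℝ Ψ ⁻¹'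
    Set.range ((↑) : ((ι → ℝ) ≃L[ℝ] (ι → ℝ)) → ((ι → ℝ) →L[ℝ] (ι → ℝ))) with hN
  have hNo : IsOpen N := hcont.isOpen_inter_preimage hU (ContinuousLinearEquiv.isOpen)
  have hpN : p ∈ N := ⟨hp, f', hf⟩
  set T := (hat p hp).toOpenPartialHomeomorph Ψ (hf ▸ hd p hp) (by simp) with hT
  have hTp : p ∈ T.source := (hat p hp).mem_toOpenPartialHomeomorph_source (hf ▸ hd p hp) (by simp)
  have hTc : ∀ x, T x = Ψ x := fun x => rfl
  have hO : IsOpen (T.target ∩ T.symm ⁻¹' N) := T.symm.isOpen_inter_preimage hNo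
  have hpO : Ψ p ∈ T.target ∩ T.symm ⁻¹' N := by
    refine ⟨T.map_source hTp, ?_⟩
    rw [Set.mem_preimage, ← hTc, T.left_inv hTp]
    exact hpN
  obtain ⟨r, hr, hB⟩ := Metric.isOpen_iff.mp hO _ hpO
  refine ⟨T.source ∩ T ⁻¹' Metric.ball (Ψ p) r, r, T.symm,
    T.isOpen_inter_preimage Metric.isOpen_ball, ⟨hTp, Metric.mem_ball_self hr⟩, ?_, ?_, ?_, ?_, ?_, ?_⟩
  · rintro x ⟨hx, hx'⟩
    have := (hB hx').2
    rw [Set.mem_preimage, T.left_inv hx] at this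
    exact this.1
  · exact fun x hx => hx.2
  · intro y hy
    refine ⟨T.map_target (hB hy).1, ?_⟩
    rw [Set.mem_preimage, T.right_inv (hB hy).1]
    exact hy
  · exact fun x hx => T.left_inv hx.1
  · exact fun y hy => T.right_inv (hB hy).1
  · intro y hy
    obtain ⟨hyT, hyU, f, hfy⟩ := hB hy
    exact (T.contDiffAt_symm hyT (f₀' := f) (hfy ▸ hd _ hyU) (hat _ hyU)).contDiffWithinAt

/-- The metric is the sup metric and the center has vanishing `Y`-coordinates, so shrinking these
moves no coordinate away from the center. -/
theorem star_ball {Y : ι → Prop} {q : ι → ℝ} (hq : ∀ i, Y i → q i = 0) (r : ℝ) :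
    Star Y (Metric.ball q r) := by
  intro x hx s hs
  rw [Metric.mem_ball] at hx ⊢
  refine lt_of_le_of_lt ((dist_pi_le_iff dist_nonneg).mpr fun i => ?_) hx
  refine le_trans ?_ (dist_le_pi_dist x q i)
  rw [sc_apply]
  split_ifs with h
  · rw [hq i h, Real.dist_eq, Real.dist_eq, sub_zero, sub_zero, abs_mul, abs_of_nonneg hs.1]
    exact mul_le_of_le_one_left (abs_nonneg _) hs.2
  · exact le_rfl

theorem Sm.comp {E O : Type} {X X' : Type} [NormedAddCommGroup X] [NormedSpace ℝ X]
    [NormedAddCommGroup X'] [NormedSpace ℝ X'] {F : X → Alg E O} {U : Set X} {B : Set X'}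
    {χ : X' → X} (hF : Sm F U) (hχ : ContDiffOn ℝ ∞ χ B) (h : Set.MapsTo χ B U) :
    Sm (fun y => F (χ y)) B := fun e l => (hF e l).comp hχ h

theorem fderiv_apply_eq_sum {f : (ι → ℝ) → ℝ} (x v : ι → ℝ) :
    fderiv ℝ f x v = ∑ i, v i * pd i f x := by
  conv_lhs => rw [pi_eq_sum_univ' v]
  simp only [map_sum, map_smul, smul_eq_mul, pd, Pi.single]

end Chart

/-! ### Adapted coordinates and reduction to normal form. -/

namespace GaugeData
namespace Selection
variable {C : FieldContent} {D : GaugeData C} {p : C.Pt} (σ : D.Selection p)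

/-- A row of an even field has key zero, so the column matched with it is the antifield of an even
field. -/
theorem exists_partner (hp : p ∈ D.U) : ∃ π : C.EvenField → C.EvenField, ∀ j, σ.Y j.1 →
    ∃ h : σ.A ⟨0, (π j).1⟩, (σ.e ⟨⟨0, (π j).1⟩, h⟩).1 = Sum.inr j.1 := by
  have : ∀ j : C.EvenField, ∃ i : C.EvenField, σ.Y j.1 →
      ∃ h : σ.A ⟨0, i.1⟩, (σ.e ⟨⟨0, i.1⟩, h⟩).1 = Sum.inr j.1 := by
    intro j
    by_cases hj : σ.Y j.1
    · obtain ⟨⟨w, hw⟩, he⟩ := σ.e.surjective ⟨Sum.inr j.1, hj⟩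
      have h1 := σ.rowKey_e hp ⟨w, hw⟩
      rw [he, rowKey_even] at h1
      obtain ⟨i, rfl⟩ := (key_eq_zero_iff w).mp h1.symm
      exact ⟨i, fun _ => ⟨hw, by rw [he]⟩⟩
    · exact ⟨j, fun h => absurd h hj⟩
  exact Classical.axiomOfChoice this

/-- The equation of motion that serves as the coordinate `j ∈ Y`. -/
def partner (hp : p ∈ D.U) : C.EvenField → C.EvenField := (σ.exists_partner hp).choose

variable (hp : p ∈ D.U)

theorem A_partner {j : C.EvenField} (hj : σ.Y j.1) : σ.A ⟨0, (σ.partner hp j).1⟩ :=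
  ((σ.exists_partner hp).choose_spec j hj).1

theorem e_partner {j : C.EvenField} (hj : σ.Y j.1) :
    (σ.e ⟨⟨0, (σ.partner hp j).1⟩, σ.A_partner hp hj⟩).1 = Sum.inr j.1 :=
  ((σ.exists_partner hp).choose_spec j hj).2

theorem partner_inj {i j : C.EvenField} (hi : σ.Y i.1) (hj : σ.Y j.1)
    (h : σ.partner hp i = σ.partner hp j) : i = j := by
  have h1 := σ.e_partner hp hi
  have h2 := σ.e_partner hp hj
  simp only [h] at h1
  rw [h1] at h2
  exact Subtype.ext (Sum.inr_injective h2)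

theorem exists_eq_partner {w : C.Anti} (hw : σ.A w) (hk : key w = 0) :
    ∃ j : C.EvenField, σ.Y j.1 ∧ w = ⟨0, (σ.partner hp j).1⟩ := by
  have h1 := σ.rowKey_e hp ⟨w, hw⟩
  obtain ⟨j, hj⟩ := (rowKey_eq_zero_iff _).mp (h1.trans hk)
  have hY : σ.Y j.1 := by
    have := (σ.e ⟨w, hw⟩).2
    rwa [hj] at this
  refine ⟨j, hY, ?_⟩
  have h2 := hj.trans (σ.e_partner hp hY).symm
  exact congrArg Subtype.val (σ.e.injective (Subtype.ext h2))

theorem key_partner (j : C.EvenField) : key (C := C) ⟨0, (σ.partner hp j).1⟩ = 0 :=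
  (key_eq_zero_iff _).mpr ⟨_, rfl⟩

/-- Coordinates in which the selected equations of motion are linear. -/
def coord (x : C.Pt) : C.Pt := fun j =>
  if σ.Y j.1 then D.eom x ⟨0, (σ.partner hp j).1⟩ else x j

theorem smooth_coord : ContDiffOn ℝ ∞ (σ.coord hp) D.U := by
  rw [contDiffOn_pi]
  intro j
  unfold coord
  by_cases h : σ.Y j.1
  · simp only [if_pos h]; exact D.smooth_eom _
  · simp only [if_neg h]; exact contDiffOn_pi.mp contDiffOn_id j

theorem fderiv_coord_apply (v : C.Pt) (j : C.EvenField) :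
    fderiv ℝ (σ.coord hp) p v j = if σ.Y j.1 then
      ∑ i : C.EvenField, v i * D.jac p (Sum.inr i.1) ⟨0, (σ.partner hp j).1⟩ else v j := by
  have hd : DifferentiableAt ℝ (σ.coord hp) p :=
    ((σ.smooth_coord hp).contDiffAt (D.isOpen_U.mem_nhds hp)).differentiableAt (by simp)
  have h1 : fderiv ℝ (σ.coord hp) p v j = fderiv ℝ (fun x => σ.coord hp x j) p v := by
    rw [show σ.coord hp = fun x i => σ.coord hp x i from rfl,
      fderiv_pi fun i => differentiableAt_pi.mp hd i]
    rfl
  rw [h1, fderiv_apply_eq_sum]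
  split_ifs with h
  · refine Finset.sum_congr rfl fun i _ => ?_
    rw [D.jac_even hp]
    simp only [coord, if_pos h]
  · simp only [coord, if_neg h, pd_coord]
    simp

/-- The unchanged coordinates kill the components of `v` outside `Y`; the others form a left kernel
vector of the key-zero block, which is invertible. -/
theorem fderiv_coord_injective (v : C.Pt) (hv : fderiv ℝ (σ.coord hp) p v = 0) : v = 0 := by
  have h1 : ∀ j : C.EvenField, ¬ σ.Y j.1 → v j = 0 := fun j hj => by
    have := congrFun hv j
    rwa [fderiv_coord_apply, if_neg hj] at this
  have hrow : ∀ a : σ.Block (fun k => k = 0), ∃ j : C.EvenField, (σ.e a.1).1 = Sum.inr j.1 :=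
    fun a => (rowKey_eq_zero_iff _).mp ((σ.rowKey_e hp a.1).trans a.2)
  choose ρ hρ using hrow
  have h2 : (fun a => v (ρ a)) = 0 := by
    refine Matrix.eq_zero_of_vecMul_eq_zero (σ.det_Q_ne_zero hp fun k => k = 0) ?_
    funext b
    obtain ⟨j, hj, hb⟩ := σ.exists_eq_partner hp b.1.2 b.2
    have h3 := congrFun hv j
    rw [fderiv_coord_apply, if_pos hj, ← hb] at h3
    refine Eq.trans ?_ h3
    change ∑ a, v (ρ a) * D.jac p (σ.e a.1).1 b.1.1 = _
    simp only [hρ]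
    refine Finset.sum_of_injOn ρ ?_ (by simp) ?_ (by simp)
    · intro a _ a' _ h
      have h4 := hρ a
      rw [h, ← hρ a'] at h4
      exact Subtype.ext (σ.e.injective (Subtype.ext h4))
    · intro i _ hi
      rw [h1 i, zero_mul]
      intro hY
      refine hi ⟨⟨⟨_, σ.A_partner hp hY⟩, σ.key_partner hp i⟩, Finset.mem_coe.mpr (Finset.mem_univ _), ?_⟩
      have h5 := hρ ⟨⟨_, σ.A_partner hp hY⟩, σ.key_partner hp i⟩
      rw [σ.e_partner hp hY] at h5
      exact (Subtype.ext (Sum.inr_injective h5)).symm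
  funext j
  by_cases hj : σ.Y j.1
  · have h5 := hρ ⟨⟨_, σ.A_partner hp hj⟩, σ.key_partner hp j⟩
    rw [σ.e_partner hp hj] at h5
    have h6 := congrFun h2 ⟨⟨_, σ.A_partner hp hj⟩, σ.key_partner hp j⟩
    rw [Subtype.ext (Sum.inr_injective h5)]
    exact h6
  · exact h1 j hj

/-- The odd variable of the antifield of an even field. -/
def evenAnti (i : C.EvenField) : C.OddVar :=
  Sum.inr ⟨Sum.inr ⟨0, i.1⟩, by simp [auxParity, i.2]⟩

theorem evenAnti_eq (i : C.EvenField) :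
    (Sum.inr (evenAnti i) : C.EvenAux ⊕ C.OddVar) = av ⟨0, i.1⟩ := (vars_odd _).symm

theorem c_eq_zero {x : C.Pt} {u v : C.EvenAux ⊕ C.OddVar} (h : ∀ b, σ.rb b ≠ v) :
    σ.c x u v = 0 := by
  by_contra hne
  obtain ⟨-, b, -, hb, -⟩ := exists_of_incidence_ne_zero hne
  exact h b hb.symm

/-- In adapted coordinates the operator agrees with its leading part up to subleading terms. -/
theorem lead_mem {x y : C.Pt} (hx : x ∈ D.U) (hy : σ.coord hp x = y) (v : C.EvenAux ⊕ C.OddVar) :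
    D.coef x v - (∑ u, σ.c x u v • mv u) -
      (∑ i : C.EvenField, if σ.Y i.1 ∧ Sum.inr (evenAnti (σ.partner hp i)) = v then y i else 0) •
        (1 : Alg C.EvenAux C.OddVar) ∈ Fil σ.W (σ.W v - 1) := by
  simp only [evenAnti_eq]
  induction v using vars_cases with
  | hg c => simp only [W, onVars_ghost]; exact Fil_zero _ _
  | ho j =>
    rw [coef_field]
    have h1 : ∀ u, σ.c x u (vars (Sum.inr j)) = 0 := fun u => σ.c_eq_zero fun b => av_ne_field _ _
    have h2 : ∀ i, ¬ (σ.Y i.1 ∧ av ⟨0, (σ.partner hp i).1⟩ = vars (Sum.inr j)) := fun i h =>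
      av_ne_field _ _ h.2
    simp only [h1, h2, zero_smul, Finset.sum_const_zero, if_false, sub_zero]
    exact zero_mem _
  | ha w =>
    have h3 : D.coef x (av w) - D.eom x w • (1 : C.FullAlg) - D.linPart x w
        ∈ Fil (E := C.EvenAux) (O := C.OddVar) σ.W 2 :=
      Fil_mono σ.linCount_le_W (D.coef_sub_linPart_mem hx w)
    have h4 : D.linPart x w ∈ Fil (E := C.EvenAux) (O := C.OddVar) σ.W 1 :=
      Fil_mono σ.linCount_le_W (D.linPart_mem x w)
    by_cases hA : σ.A w
    -- For κ_j the weight demands order 1: the constant term is the coordinate itself, and the rest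
    -- has order 1.
    · by_cases hk : key w = 0
      · obtain ⟨j, hj, rfl⟩ := σ.exists_eq_partner hp hA hk
        have h1 : ∀ u, σ.c x u (av ⟨0, (σ.partner hp j).1⟩) = 0 := fun u =>
          σ.c_eq_zero fun b hb => b.2 (by rw [av_injective hb]; exact hk)
        have h2 : (∑ i : C.EvenField, if σ.Y i.1 ∧
            av (C := C) ⟨0, (σ.partner hp i).1⟩ = av ⟨0, (σ.partner hp j).1⟩ then y i else 0)
            = D.eom x ⟨0, (σ.partner hp j).1⟩ := by
          rw [Finset.sum_eq_single j]
          · rw [if_pos ⟨hj, rfl⟩, ← hy, coord, if_pos hj]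
          · rintro i - hij
            rw [if_neg]
            rintro ⟨hi, h⟩
            have h5 := av_injective h
            exact hij (σ.partner_inj hp hi hj (Subtype.ext (by simpa using h5)))
          · simp
        rw [h2]
        simp only [h1, zero_smul, Finset.sum_const_zero, sub_zero]
        have h5 := add_mem (Fil_anti _ one_le_two h3) h4
        rw [sub_add_cancel] at h5
        rwa [W, onVars_av, if_pos hA, if_pos hk]
      -- For the other selected antifields the weight 3 demands order 2: there is no constant term,
      -- and `linPart_sub_mem` disposes of the linear one.
      · have h2 : ∀ i, ¬ (σ.Y i.1 ∧ av ⟨0, (σ.partner hp i).1⟩ = av w) := fun i h =>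
          hk (by rw [← av_injective h.2]; exact σ.key_partner hp i)
        have h5 : D.eom x w = 0 := by
          by_contra hne
          exact hk (D.eom_key hx hne)
        have h6 := add_mem h3 (σ.linPart_sub_mem hp x ⟨⟨w, hA⟩, hk⟩)
        simp only [h2, if_false, Finset.sum_const_zero, zero_smul, sub_zero]
        rw [h5, zero_smul, sub_zero] at h6
        rw [W, onVars_av, if_pos hA, if_neg hk]
        have h7 : ∀ a b c : C.FullAlg, a - b + (b - c) = a - c := fun a b c => by abel
        rw [h7] at h6
        exact h6
    -- Unselected antifields have weight 1, so the required order is 0.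
    · rw [W, onVars_av, if_neg hA]
      exact Fil_zero _ _

/-- The Koszul–Tate operator in adapted coordinates. -/
def normalForm {U' : Set C.Pt} {r : ℝ} {χ : C.Pt → C.Pt} (hU' : U' ⊆ D.U)
    (hdet : ∀ x ∈ U', (σ.Q (fun k => k ≠ 0) x).det ≠ 0) (h0 : ∀ w, D.eom p w = 0)
    (hχ : Set.MapsTo χ (Metric.ball (σ.coord hp p) r) U')
    (hΨχ : ∀ y ∈ Metric.ball (σ.coord hp p) r, σ.coord hp (χ y) = y)
    (hsm : ContDiffOn ℝ ∞ χ (Metric.ball (σ.coord hp p) r)) :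
    NormalForm C.EvenAux C.OddVar C.EvenField where
  Y j := σ.Y j.1
  κ j := evenAnti (σ.partner hp j)
  B := Metric.ball (σ.coord hp p) r
  V v y := D.coef (χ y) v
  c y := σ.c (χ y)
  g y := σ.g (χ y)
  lin := σ.lin
  W := σ.W
  afn := onVars C.antiAfn 0
  isOpen_B := Metric.isOpen_ball
  star_B := star_ball (fun j hj => by rw [coord, if_pos hj, h0]) r
  smooth_V v := (D.smooth_coef v).comp hsm fun y hy => hU' (hχ hy)
  smooth_c s t := contDiffOn_incidence (fun _ _ => ((D.smooth_jac _ _).mono hU').comp hsm hχ) s t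
  smooth_g s t := contDiffOn_incidence (contDiffOn_inv
    (fun _ _ => ((D.smooth_jac _ _).mono hU').comp hsm hχ) fun y hy => hdet _ (hχ hy)) s t
  sq_zero y hy f := D.kt_kt (hU' (hχ hy)) f
  c_mul_g y hy := (incidence_inv (lin := σ.lin) (σ.ra_injective hp) σ.rb_injective
    (σ.ra_ne_rb hp) (fun _ => Iff.rfl) (hdet _ (hχ hy))).trans (by congr!)
  c_ne y hy u w h := by
    obtain ⟨a, b, rfl, rfl, hab⟩ := exists_of_incidence_ne_zero h
    exact ⟨σ.opp_ra_rb hp (σ.Q_key hp (hU' (hχ hy)) a b hab), Or.inl ⟨a, rfl⟩, Or.inr ⟨b, rfl⟩⟩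
  g_ne y hy w u h := by
    obtain ⟨a, b, rfl, rfl, hab⟩ := exists_of_incidence_ne_zero h
    have hk := inv_ne_zero_key (hdet _ (hχ hy)) (fun a => key a.1.1)
      (σ.Q_key hp (hU' (hχ hy))) a b hab
    refine ⟨(σ.opp_ra_rb hp hk.symm).symm, Or.inr ⟨a, rfl⟩, Or.inl ⟨b, rfl⟩, ?_,
      σ.afn_ra_rb hp hk.symm⟩
    rw [σ.W_ra hp, σ.W_rb]
  κ_spec j hj := by
    rw [evenAnti_eq]
    refine ⟨?_, ?_, ?_⟩
    · rintro (⟨a, ha⟩ | ⟨b, hb⟩)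
      · exact σ.ra_anti hp a ha (σ.A_partner hp hj)
      · have h1 := b.2
        rw [av_injective hb] at h1
        exact h1 (σ.key_partner hp j)
    · rw [W, onVars_av, if_pos (σ.A_partner hp hj), if_pos (σ.key_partner hp j)]
    · rw [onVars_av, antiAfn]; omega
  κ_inj i j hi hj h := by
    have h1 : av (C := C) ⟨0, (σ.partner hp i).1⟩ = av ⟨0, (σ.partner hp j).1⟩ := by
      rw [← evenAnti_eq, ← evenAnti_eq, h]
    have h2 := av_injective h1
    refine σ.partner_inj hp hi hj (Subtype.ext ?_)
    simpa using h2
  cover v hv := by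
    induction v using vars_cases with
    | hg c => simp at hv
    | ho j => simp at hv
    | ha a =>
      by_cases hA : σ.A a
      · by_cases hk : key a = 0
        · obtain ⟨j, hj, rfl⟩ := σ.exists_eq_partner hp hA hk
          exact Or.inr ⟨j, hj, evenAnti_eq _⟩
        · exact Or.inl (Or.inr ⟨⟨⟨a, hA⟩, hk⟩, rfl⟩)
      · obtain ⟨b, -, hb⟩ := σ.exists_ra hp (u := Sum.inl a) hA (Nat.succ_ne_zero _)
        exact Or.inl (Or.inl ⟨b, hb⟩)
  lead y hy v := by convert σ.lead_mem hp (hU' (hχ hy)) (hΨχ y hy) v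
  afn_V y hy v := afn_coef (hU' (hχ hy)) v

end Selection
end GaugeData

/-! ### Transport of acyclicity back to the original fields. -/

/-- Local acyclicity of the Koszul–Tate operator at a stationary point. -/
theorem GaugeData.acyclic {C : FieldContent} (D : GaugeData C) {p : C.Pt} (hp : p ∈ D.U)
    (hstat : IsStationary D.S₀ p) :
    ∃ U' : Set C.Pt, IsOpen U' ∧ p ∈ U' ∧ U' ⊆ D.U ∧
      ∀ F : C.Pt → C.FullAlg, FieldContent.SmoothOn F U' → (∀ x ∈ U', PosAfn (F x)) →
        (∀ x ∈ U', koszulTate (structureFn D.S₀ D.Z D.M) F x = 0) →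
        ∃ G : C.Pt → C.FullAlg, FieldContent.SmoothOn G U' ∧
          ∀ x ∈ U', F x = koszulTate (structureFn D.S₀ D.Z D.M) G x := by
  have h0 : ∀ w, D.eom p w = 0 := fun w => by
    induction w using anti_cases with
    | h0 i => exact hstat i
    | hs s β => rfl
  obtain ⟨σ⟩ := D.nonempty_selection hp h0
  -- The block inverted by `g` must stay invertible, so the chart is taken inside the open set where
  -- its determinant is nonzero.
  have hN : IsOpen (D.U ∩ (fun x => (σ.Q (fun k => k ≠ 0) x).det) ⁻¹' {0}ᶜ) :=
    (contDiffOn_det fun _ _ => D.smooth_jac _ _).continuousOn.isOpen_inter_preimage D.isOpen_U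
      isOpen_compl_singleton
  obtain ⟨U', r, χ, hU'o, hpU', hU', hΨ, hχ, hχΨ, hΨχ, hsm⟩ := exists_chart hN
    ((σ.smooth_coord hp).mono Set.inter_subset_left) ⟨hp, σ.det_Q_ne_zero hp _⟩
    (σ.fderiv_coord_injective hp)
  have hUU : U' ⊆ D.U := fun x hx => (hU' hx).1
  refine ⟨U', hU'o, hpU', hUU, fun F hF hpos hcl => ?_⟩
  set N := σ.normalForm hp hUU (fun x hx => (hU' hx).2) h0 hχ hΨχ hsm
  have hw : ∀ v : C.EvenAux ⊕ C.OddVar, antiCount v ≠ 0 → onVars C.antiAfn 0 v ≠ 0 := by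
    intro v hv
    induction v using vars_cases with
    | hg c => simp [antiCount] at hv
    | ho j => simp [antiCount] at hv
    | ha a => simp [antiAfn]
  obtain ⟨G, hG, hFG⟩ := N.acyclic (F := fun y => F (χ y)) (Sm.comp hF hsm hχ)
    (fun y hy => mem_Fil_of_wt_pos hw (PosAfn.mem_Fil (hpos _ (hχ hy))))
    (fun y hy => by rw [← hcl _ (hχ hy), D.koszulTate_eq_kt]; rfl)
  -- The primitive found on the ball is pulled back along the coordinates.
  refine ⟨fun x => G (σ.coord hp x), Sm.comp hG ((σ.smooth_coord hp).mono hUU) hΨ,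
    fun x hx => ?_⟩
  have h1 := hFG _ (hΨ hx)
  simp only [hχΨ x hx] at h1
  rw [h1, D.koszulTate_eq_kt]
  change kt (D.coef (χ (σ.coord hp x))) _ = _
  rw [hχΨ x hx]

end SuperAlg

end

open FieldContent in
theorem mainTheorem5 (C : FieldContent)
    (U : Set C.Pt) (hU : IsOpen U) (p : C.Pt) (hp : p ∈ U)
    (S₀ : C.Pt → C.FieldAlg)
    (Z : (s : Fin (C.L + 1)) → C.Pt →
      Matrix (Fin (C.m s.castSucc)) (Fin (C.m s.succ)) C.FieldAlg)
    (M : (s : Fin (C.L + 1)) → Fin (C.m s.succ) → C.Pt → C.FullAlg)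
    -- the action and the generators are smooth of definite Grassmann parity
    (hS : FieldSmoothOn S₀ U) (hSpar : ∀ x ∈ U, FieldHasParity (S₀ x) 0)
    (hZ : ∀ s α β, FieldSmoothOn (fun x => Z s x α β) U)
    (hZpar : ∀ s α β, ∀ x ∈ U,
      FieldHasParity (Z s x α β) (C.ε s.castSucc α + C.ε s.succ β))
    -- the remainders are smooth, independent of the ghosts, at least quadratic in the antifields,
    -- and have parity `ε(Φ*_α) + 1` and antifield number `afn(Φ*_α) - 1`
    (hM : ∀ s β, SmoothOn (M s β) U)
    (hMghost : ∀ s β, ∀ x ∈ U, GhostFree (M s β x))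
    (hMquad : ∀ s β, ∀ x ∈ U, AntiQuadratic (M s β x))
    (hMpar : ∀ s β, ∀ x ∈ U, HasParity (M s β x) (C.auxParity (Sum.inr ⟨s.succ, β⟩) + 1))
    (hMafn : ∀ s β, ∀ x ∈ U, HasAfn (M s β x) (C.antiAfn ⟨s.succ, β⟩ - 1))
    -- `p` is a stationary point near which the rank conditions hold
    (hstat : IsStationary S₀ p)
    (hrank : RankConditions S₀ Z U)
    -- the Koszul–Tate operator is nilpotent on `U`
    (hnil : ∀ F : C.Pt → C.FullAlg, SmoothOn F U → ∀ x ∈ U,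
      koszulTate (structureFn S₀ Z M) (koszulTate (structureFn S₀ Z M) F) x = 0) :
    ∃ U' : Set C.Pt, IsOpen U' ∧ p ∈ U' ∧ U' ⊆ U ∧
      ∀ F : C.Pt → C.FullAlg, SmoothOn F U' → (∀ x ∈ U', PosAfn (F x)) →
        (∀ x ∈ U', koszulTate (structureFn S₀ Z M) F x = 0) →
        ∃ G : C.Pt → C.FullAlg, SmoothOn G U' ∧
          ∀ x ∈ U', F x = koszulTate (structureFn S₀ Z M) G x := by
  exact SuperAlg.GaugeData.acyclic ⟨U, S₀, Z, M, hU, hS, hSpar, hZ, hZpar, hM, hMquad, hMafn, hrank,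
    hnil⟩ hp hstat
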